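/- All functions of the times $x=(x_1,x_2,\dots)$, $y=(y_1,y_2,\dots)$ are formal power series over $\mathbb{C}$. Let $\Lambda=(\delta_{j-i,1})_{i,j\in\mathbb{Z}}$, $\xi(x,z)=\sum_{l\ge1}x_lz^l$, $[z]=(z,\tfrac12z^2,\tfrac13z^3,\dots)$, $\chi(z)=(z^i)_{i\in\mathbb{Z}}$; for a matrix $P$ let $P_u$, $P_l$ be its upper triangular (including the diagonal) and strictly lower triangular parts, and put $(P_1,P_2)_-=(P_{1l}-P_{2l},P_{2u}-P_{1u})$ and $(A\otimes B)_{ij}=A_iB_j$. Let $S_1=\sum_{i\ge0}\mathrm{diag}[c_i(s;x,y)]\Lambda^{-i}$, $S_2=\sum_{i\ge0}\mathrm{diag}[c_i'(s;x,y)]\Lambda^{i}$, with $c_0=1$ and all $c_0'(s;x,y)$ invertible, be a solution of the Toda lattice hierarchy, i.e. for $S=(S_1,S_2)$ and all $n\ge1$ $$\partial_{x_n}S=-(L_1^n,0)_-S,\qquad \partial_{y_n}S=-(0,L_2^n)_-S,\qquad L_1=S_1\Lambda S_1^{-1},\quad L_2=S_2\Lambda^{-1}S_2^{-1}.$$ Put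 $W_1=S_1e^{\xi(x,\Lambda)}$, $W_2=S_2e^{\xi(y,\Lambda^{-1})}$, $\Psi_i(x,y;z)=W_i\chi(z)$, $\Psi_i^*(x,y;z)=(W_i^{-1})^T\chi(z^{-1})$, with entries $\Psi_i(n;x,y;z)$, $\Psi_i^*(n;x,y;z)$, $n\in\mathbb{Z}$; these are expanded at $z=\infty$ for $i=1$ and at $z=0$ for $i=2$. Let $\tau(s;x,y)$, $s\in\mathbb{Z}$, be a tau function of the solution: invertible power series with $$\Psi_1(s;x,y;z)=\frac{\tau(s;x-[z^{-1}],y)}{\tau(s;x,y)}e^{\xi(x,z)}z^s,\qquad \Psi_2(s;x,y;z)=\frac{\tau(s+1;x,y-[z])}{\tau(s;x,y)}e^{\xi(y,z^{-1})}z^s,$$ $$\Psi_1^*(s;x,y;z)=\frac{\tau(s+1;x+[z^{-1}],y)}{\tau(s+1;x,y)}e^{-\xi(x,z)}z^{-s},\qquad \Psi_2^*(s;x,y;z)=\frac{\tau(s;x,y+[z])}{\tau(s+1;x,y)}e^{-\xi(y,z^{-1})}z^{-s}.$$ Let the flows $\partial_{\alpha_1},\partial_{\alpha_2}$ (the squared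 eigenfunction symmetries) act on the wave matrices by $$\partial_{\alpha_1}W_1=\big(\lambda^{-1}\Psi_1(x,y;\mu)\otimes\Psi_1^*(x,y;\lambda)\big)_lW_1,\qquad \partial_{\alpha_1}W_2=-\big(\lambda^{-1}\Psi_1(x,y;\mu)\otimes\Psi_1^*(x,y;\lambda)\big)_uW_2,$$ $$\partial_{\alpha_2}W_1=-\big(\lambda^{-1}\Psi_2(x,y;\mu^{-1})\otimes\Psi_2^*(x,y;\lambda^{-1})\big)_lW_1,\qquad \partial_{\alpha_2}W_2=\big(\lambda^{-1}\Psi_2(x,y;\mu^{-1})\otimes\Psi_2^*(x,y;\lambda^{-1})\big)_uW_2,$$ and on the wave functions by $\partial_{\alpha_j}\Psi_i=(\partial_{\alpha_j}W_i)\chi(z)$. Let $$X(x,\lambda,\mu)=\frac1\lambda e^{\xi(x+[\lambda^{-1}],\mu)-\xi(x,\lambda)}\exp\Big(\sum_{l\ge1}\frac1l(\lambda^{-l}-\mu^{-l})\frac{\partial}{\partial x_l}\Big),$$ let $X(y,\lambda,\mu)$ be the same operator in the variables $y$, and put $$\frac{\mathbb{X}(x,\lambda,\mu)\tau}{\tau}=\Big(\Big(\frac\mu\lambda\Big)^n\frac{X(x,\lambda,\mu)\tau(n;x,y)}{\tau(n;x,y)}\Big)_{n\in\mathbb{Z}},\qquad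 \frac{\tilde{\mathbb{X}}(y,\lambda,\mu)\tau}{\tau}=\Big(\Big(\frac\lambda\mu\Big)^n\frac{X(y,\lambda,\mu)\tau(n;x,y)}{\tau(n;x,y)}\Big)_{n\in\mathbb{Z}}.$$ On sequences $f=(f(n;x,y))_{n\in\mathbb{Z}}$ let $G_1(z)f(n;x,y)=f(n;x-[z^{-1}],y)$, $G_2(z)f(n;x,y)=f(n;x,y-[z])$ and $(\Lambda f)(n)=f(n+1)$. Here coefficients lie in $\mathbb{C}((\mu^{-1}))((\lambda^{-1}))$ (so that $\frac1{1-\mu/\lambda}$ is expanded in powers of $\mu/\lambda$), and the identities for $\Psi_1$ and $\Psi_2$ hold over $\mathbb{C}((\mu^{-1}))((\lambda^{-1}))((z^{-1}))$ and $\mathbb{C}((\mu^{-1}))((\lambda^{-1}))((z))$ respectively. Proposition. For every $n\in\mathbb{Z}$ the series $\Psi_1(n;x,y;z)$ and $\Psi_2(n;x,y;z)$ are invertible, and, entry by entry in $n$, $$\frac{\partial_{\alpha_1}\Psi}{\Psi}:=\Big(\frac{\partial_{\alpha_1}\Psi_1}{\Psi_1},\frac{\partial_{\alpha_1}\Psi_2}{\Psi_2}\Big)=\Big((G_1(z)-1)\frac{\mathbb{X}(x,\lambda,\mu)\tau}{\tau},\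 (\Lambda G_2(z)-1)\frac{\mathbb{X}(x,\lambda,\mu)\tau}{\tau}\Big),$$ $$\frac{\partial_{\alpha_2}\Psi}{\Psi}:=\Big(\frac{\partial_{\alpha_2}\Psi_1}{\Psi_1},\frac{\partial_{\alpha_2}\Psi_2}{\Psi_2}\Big)=\frac\mu\lambda\Big((G_1(z)-1)\frac{\tilde{\mathbb{X}}(y,\lambda,\mu)\tau}{\tau},\ (\Lambda G_2(z)-1)\frac{\tilde{\mathbb{X}}(y,\lambda,\mu)\tau}{\tau}\Big).$$ -/

import Mathlib

noncomputable section

namespace TodaLattice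

/-- The two families of times `x = (x₁, x₂, …)` and `y = (y₁, y₂, …)`. -/
inductive Side where
  | x : Side
  | y : Side
  deriving DecidableEq

/-- The variable `x_l` is `(Side.x, l)`, the variable `y_l` is `(Side.y, l)`, for `l ≥ 1`. -/
abbrev Var : Type := Side × ℕ+

/-- Functions of `(x, y)`: formal power series with coefficients in `K`. -/
abbrev Fn (K : Type) : Type := MvPowerSeries Var K

/-- Matrices `(P_{ij})_{i,j ∈ ℤ}` whose entries are functions of `(x, y)`. -/
abbrev Mat (K : Type) : Type := Matrix ℤ ℤ (Fn K)

section Generic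

variable {K : Type} [Field K]

/-! ### Infinite matrices -/

/-- The product `(A B)_{ij} = ∑_k A_{ik} B_{kj}`.  The sum over `k` is taken separately for the
coefficient of each monomial in `(x, y)`, where only finitely many terms are nonzero for all the
products formed below (all of them are between triangular or banded matrices, or matrices
multiplied by `e^{ξ(x,Λ)}` or `e^{ξ(y,Λ⁻¹)}`, whose `(i,j)` entry has weight `|i - j|`). -/
def mulMat (A B : Mat K) : Mat K :=
  fun i j m => ∑ᶠ k : ℤ, MvPowerSeries.coeff m (A i k * B k j)

/-- `Λ^k`, where `Λ = (δ_{j-i,1})`. -/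
def shiftMat (k : ℤ) : Mat K := fun i j => if j - i = k then 1 else 0

/-- `P_u`: the upper triangular part, including the diagonal. -/
def upperPart (P : Mat K) : Mat K := fun i j => if i ≤ j then P i j else 0

/-- `P_l`: the strictly lower triangular part. -/
def lowerPart (P : Mat K) : Mat K := fun i j => if j < i then P i j else 0

/-- `(P₁, P₂)_- = (P_{1l} - P_{2l}, P_{2u} - P_{1u})`. -/
def minusPart (P : Mat K × Mat K) : Mat K × Mat K :=
  (lowerPart P.1 - lowerPart P.2, upperPart P.2 - upperPart P.1)

/-- The entrywise partial derivative `∂P/∂v` with respect to a time `v`. -/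
def dMat (v : Var) (P : Mat K) : Mat K := fun i j => MvPowerSeries.pderiv K v (P i j)

/-! ### Formal Laurent series in a spectral parameter, and exponentials

A spectral parameter is adjoined through a formal Laurent series field `K((T))`, where
`T = z⁻¹` for expansions at `z = ∞` and `T = z` for expansions at `z = 0`. -/

/-- The field `K((T))` of formal Laurent series in `T`. -/
def Laurent (K : Type) [Field K] : Type := LaurentSeries K

instance : Field (Laurent K) := inferInstanceAs (Field (LaurentSeries K))

/-- A Mathlib Laurent series as an element of `K((T))`. -/
def Laurent.of (f : LaurentSeries K) : Laurent K := f

/-- The coefficient of `T^d`. -/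
def Laurent.coeff (f : Laurent K) (d : ℤ) : K := HahnSeries.coeff (Γ := ℤ) f d

/-- The Laurent monomial `a T^k`. -/
def Laurent.single (k : ℤ) (a : K) : Laurent K := Laurent.of (HahnSeries.single k a)

/-- The inclusion of the constants `K → K((T))`. -/
def Laurent.const : K →+* Laurent K := (HahnSeries.C : K →+* LaurentSeries K)

/-- The inclusion `K⟦T⟧ → K((T))`. -/
def Laurent.ofPowerSeries : PowerSeries K →+* Laurent K := HahnSeries.ofPowerSeries ℤ K

/-- A function with coefficients in `K`, seen as one with coefficients in `K((T))`. -/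
def lift : Fn K →+* Fn (Laurent K) := MvPowerSeries.map Laurent.const

open Classical in
/-- The Laurent series `∑_d a_d T^d` (for a sequence with `a_d = 0` for `d ≪ 0`). -/
def laurent (a : ℤ → K) : Laurent K :=
  if h : BddBelow (Function.support a) then Laurent.of (HahnSeries.ofSuppBddBelow a h) else 0

theorem coeff_laurent {a : ℤ → K} (h : BddBelow (Function.support a)) (d : ℤ) :
    (laurent a).coeff d = a d := by
  rw [laurent, dif_pos h]; rfl

/-- `∑_k w_k T^k`, coefficientwise in `(x, y)`. -/
def seriesPos (w : ℤ → Fn K) : Fn (Laurent K) :=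
  fun m => laurent fun d => MvPowerSeries.coeff m (w d)

/-- `∑_k w_k T^{-k}`, coefficientwise in `(x, y)`. -/
def seriesNeg (w : ℤ → Fn K) : Fn (Laurent K) :=
  fun m => laurent fun d => MvPowerSeries.coeff m (w (-d))

/-- `exp(∑_v u_v v)`, the sum being over all the times `v`: the coefficient of `∏ v^{m_v}` is
`∏ u_v^{m_v} / m_v!`. -/
def expLin (u : Var → K) : Fn K :=
  fun m => m.prod fun v a => u v ^ a / (a.factorial : K)

/-- `e^{ε ξ(x,T^s)}` (for `b = Side.x`) or `e^{ε ξ(y,T^s)}` (for `b = Side.y`), where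
`ξ(x,z) = ∑_{l ≥ 1} x_l z^l`, with coefficients in `K((T))`. -/
def expXi (b : Side) (ε : K) (s : ℤ) : Fn (Laurent K) :=
  expLin fun v => if v.1 = b then Laurent.single (s * ((v.2 : ℕ) : ℤ)) ε else 0

/-- The matrix `e^{ε ξ(x,Λ^s)}` or `e^{ε ξ(y,Λ^s)}`: the coefficient of `Λ^d` in it is that of
`T^d` in the scalar exponential with `T` in place of `Λ`. -/
def expMat (b : Side) (ε : K) (s : ℤ) : Mat K :=
  fun i j m => (MvPowerSeries.coeff m (expXi b ε s)).coeff (j - i)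

/-- The shift `f(x + ε[T], y)` (for `b = Side.x`) or `f(x, y + ε[T])` (for `b = Side.y`), where
`[T] = (T, T²/2, T³/3, …)`.  Since `(x_l + ε T^l/l)^{m_l + e_l}` contains `x_l^{m_l}` with the
coefficient `binom(m_l + e_l, e_l) (ε T^l/l)^{e_l}`, the coefficient of `∏ v^{m_v} · T^d` is the sum
of `∏_l binom(m_l + e_l, e_l) (ε/l)^{e_l} · f_{m+e}` over the finitely many families
`e = (e_l)_{l ≥ 1}` with `∑_l l e_l = d`. -/
def shiftFn (b : Side) (ε : K) (f : Fn K) : Fn (Laurent K) :=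
  fun m => Laurent.ofPowerSeries <| PowerSeries.mk fun d =>
    ∑ᶠ (e : ℕ+ →₀ ℕ) (_ : (e.sum fun l a => (l : ℕ) * a) = d),
      (e.prod fun l a => ((m (b, l) + a).choose a : K) * (ε / ((l : ℕ) : K)) ^ a) *
        MvPowerSeries.coeff (m + e.mapDomain fun l => (b, l)) f

/-! ### Wave functions of a pair of wave matrices -/

/-- `Ψ₁(n; x, y; z)`, the `n`-th entry of `W₁ χ(z)`, where `χ(z) = (z^i)`; here `T = z⁻¹`. -/
def psi₁ (W : Mat K) (n : ℤ) : Fn (Laurent K) := seriesNeg fun k => W n k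

/-- `Ψ₂(n; x, y; z)`, the `n`-th entry of `W₂ χ(z)`; here `T = z`. -/
def psi₂ (W : Mat K) (n : ℤ) : Fn (Laurent K) := seriesPos fun k => W n k

/-- `Ψ₁*(n; x, y; z)`, the `n`-th entry of `(W₁⁻¹)ᵀ χ(z⁻¹)`, from `V = W₁⁻¹`; here `T = z⁻¹`. -/
def psi₁Star (V : Mat K) (n : ℤ) : Fn (Laurent K) := seriesPos fun k => V k n

/-- `Ψ₂*(n; x, y; z)`, the `n`-th entry of `(W₂⁻¹)ᵀ χ(z⁻¹)`, from `V = W₂⁻¹`; here `T = z`. -/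
def psi₂Star (V : Mat K) (n : ℤ) : Fn (Laurent K) := seriesNeg fun k => V k n

/-- The matrix with coefficients in `K((T))` given by one with coefficients in `K`. -/
def liftMat (P : Mat K) : Mat (Laurent K) := fun i j => lift (P i j)

end Generic

/-! ### The Toda lattice hierarchy -/

/-- A solution of the Toda lattice hierarchy, given by its dressing operators `S = (S₁, S₂)`:
`S₁ = ∑_{i ≥ 0} diag[c_i(s)] Λ^{-i}` with `c_0 = 1`, `S₂ = ∑_{i ≥ 0} diag[c_i'(s)] Λ^i` with all the
`c_0'(s)` invertible, their inverses, and the equations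
`∂_{x_n} S = -(L₁^n, 0)_- S`, `∂_{y_n} S = -(0, L₂^n)_- S`,
where `(L₁^n, L₂^n) = (S₁ Λ^n S₁⁻¹, S₂ Λ^{-n} S₂⁻¹)`. -/
structure Solution where
  S₁ : Mat ℂ
  S₁inv : Mat ℂ
  S₂ : Mat ℂ
  S₂inv : Mat ℂ
  S₁_lower : ∀ i j : ℤ, i < j → S₁ i j = 0
  S₁_diag : ∀ i : ℤ, S₁ i i = 1
  S₁inv_lower : ∀ i j : ℤ, i < j → S₁inv i j = 0
  S₂_upper : ∀ i j : ℤ, j < i → S₂ i j = 0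
  S₂inv_upper : ∀ i j : ℤ, j < i → S₂inv i j = 0
  S₁_mul_inv : mulMat S₁ S₁inv = 1
  S₁_inv_mul : mulMat S₁inv S₁ = 1
  S₂_mul_inv : mulMat S₂ S₂inv = 1
  S₂_inv_mul : mulMat S₂inv S₂ = 1
  deriv_x₁ : ∀ n : ℕ+, dMat (Side.x, n) S₁ =
    -mulMat (minusPart (mulMat (mulMat S₁ (shiftMat ((n : ℕ) : ℤ))) S₁inv, 0)).1 S₁
  deriv_x₂ : ∀ n : ℕ+, dMat (Side.x, n) S₂ =
    -mulMat (minusPart (mulMat (mulMat S₁ (shiftMat ((n : ℕ) : ℤ))) S₁inv, 0)).2 S₂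
  deriv_y₁ : ∀ n : ℕ+, dMat (Side.y, n) S₁ =
    -mulMat (minusPart (0, mulMat (mulMat S₂ (shiftMat (-((n : ℕ) : ℤ)))) S₂inv)).1 S₁
  deriv_y₂ : ∀ n : ℕ+, dMat (Side.y, n) S₂ =
    -mulMat (minusPart (0, mulMat (mulMat S₂ (shiftMat (-((n : ℕ) : ℤ)))) S₂inv)).2 S₂

namespace Solution

/-- `W₁ = S₁ e^{ξ(x,Λ)}`. -/
def W₁ (D : Solution) : Mat ℂ := mulMat D.S₁ (expMat Side.x 1 1)

/-- `W₂ = S₂ e^{ξ(y,Λ⁻¹)}`. -/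
def W₂ (D : Solution) : Mat ℂ := mulMat D.S₂ (expMat Side.y 1 (-1))

/-- `W₁⁻¹ = e^{-ξ(x,Λ)} S₁⁻¹`. -/
def W₁inv (D : Solution) : Mat ℂ := mulMat (expMat Side.x (-1) 1) D.S₁inv

/-- `W₂⁻¹ = e^{-ξ(y,Λ⁻¹)} S₂⁻¹`. -/
def W₂inv (D : Solution) : Mat ℂ := mulMat (expMat Side.y (-1) (-1)) D.S₂inv

/-- `τ` is a tau function of the solution: the `τ(s; x, y)` are invertible and
```
Ψ₁(s;x,y;z)  = τ(s; x-[z⁻¹], y) / τ(s; x, y) · e^{ξ(x,z)} z^s,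
Ψ₂(s;x,y;z)  = τ(s+1; x, y-[z]) / τ(s; x, y) · e^{ξ(y,z⁻¹)} z^s,
Ψ₁*(s;x,y;z) = τ(s+1; x+[z⁻¹], y) / τ(s+1; x, y) · e^{-ξ(x,z)} z^{-s},
Ψ₂*(s;x,y;z) = τ(s; x, y+[z]) / τ(s+1; x, y) · e^{-ξ(y,z⁻¹)} z^{-s}.
```
In the first and the third line `T = z⁻¹`, in the others `T = z`. -/
structure IsTau (D : Solution) (τ : ℤ → Fn ℂ) : Prop where
  isUnit : ∀ s : ℤ, IsUnit (τ s)
  psi₁_eq : ∀ s : ℤ, psi₁ D.W₁ s = (Laurent.single (-s) 1 : Laurent ℂ) •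
    (shiftFn Side.x (-1) (τ s) * (lift (τ s))⁻¹ * expXi Side.x 1 (-1))
  psi₂_eq : ∀ s : ℤ, psi₂ D.W₂ s = (Laurent.single s 1 : Laurent ℂ) •
    (shiftFn Side.y (-1) (τ (s + 1)) * (lift (τ s))⁻¹ * expXi Side.y 1 (-1))
  psi₁Star_eq : ∀ s : ℤ, psi₁Star D.W₁inv s = (Laurent.single s 1 : Laurent ℂ) •
    (shiftFn Side.x 1 (τ (s + 1)) * (lift (τ (s + 1)))⁻¹ * expXi Side.x (-1) (-1))
  psi₂Star_eq : ∀ s : ℤ, psi₂Star D.W₂inv s = (Laurent.single (-s) 1 : Laurent ℂ) •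
    (shiftFn Side.y 1 (τ s) * (lift (τ (s + 1)))⁻¹ * expXi Side.y (-1) (-1))

end Solution

/-! ### The spectral parameters `λ`, `μ`, `z` -/

/-- The field `ℂ((μ⁻¹))((λ⁻¹))`, in which `1/(1 - μ/λ)` is expanded in powers of `μ/λ`. -/
abbrev Klm : Type := Laurent (Laurent ℂ)

/-- The field `ℂ((μ⁻¹))((λ⁻¹))((T))`, where `T = z⁻¹` for `Ψ₁(x,y;z)` and `T = z` for
`Ψ₂(x,y;z)`. -/
abbrev Klmz : Type := Laurent Klm

/-- The parameter `λ`. -/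
def lam : Klm := Laurent.single (-1) 1

/-- The parameter `μ`. -/
def mu : Klm := Laurent.const (Laurent.single (-1) 1)

namespace Solution

/-- `Ψ₁(n; x, y; z)`, with `T = z⁻¹`. -/
def Psi₁ (D : Solution) (n : ℤ) : Fn Klmz := psi₁ (liftMat (liftMat D.W₁)) n

/-- `Ψ₂(n; x, y; z)`, with `T = z`. -/
def Psi₂ (D : Solution) (n : ℤ) : Fn Klmz := psi₂ (liftMat (liftMat D.W₂)) n

/-- The matrix `λ⁻¹ Ψ₁(x,y;μ) ⊗ Ψ₁*(x,y;λ)`. -/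
def gen₁ (D : Solution) : Mat Klm :=
  fun i j => lam⁻¹ • (lift (psi₁ D.W₁ i) * psi₁Star (liftMat D.W₁inv) j)

/-- The matrix `λ⁻¹ Ψ₂(x,y;μ⁻¹) ⊗ Ψ₂*(x,y;λ⁻¹)`. -/
def gen₂ (D : Solution) : Mat Klm :=
  fun i j => lam⁻¹ • (lift (psi₂ D.W₂ i) * psi₂Star (liftMat D.W₂inv) j)

/-- The flow `∂_{α₁}` on the wave matrices:
`∂_{α₁} W₁ = (λ⁻¹ Ψ₁(μ) ⊗ Ψ₁*(λ))_l W₁`, `∂_{α₁} W₂ = -(λ⁻¹ Ψ₁(μ) ⊗ Ψ₁*(λ))_u W₂`. -/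
def flow₁W (D : Solution) : Mat Klm × Mat Klm :=
  (mulMat (lowerPart D.gen₁) (liftMat (liftMat D.W₁)),
    -mulMat (upperPart D.gen₁) (liftMat (liftMat D.W₂)))

/-- The flow `∂_{α₂}` on the wave matrices:
`∂_{α₂} W₁ = -(λ⁻¹ Ψ₂(μ⁻¹) ⊗ Ψ₂*(λ⁻¹))_l W₁`, `∂_{α₂} W₂ = (λ⁻¹ Ψ₂(μ⁻¹) ⊗ Ψ₂*(λ⁻¹))_u W₂`. -/
def flow₂W (D : Solution) : Mat Klm × Mat Klm :=
  (-mulMat (lowerPart D.gen₂) (liftMat (liftMat D.W₁)),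
    mulMat (upperPart D.gen₂) (liftMat (liftMat D.W₂)))

/-- `∂_{α₁} Ψ₁ = (∂_{α₁} W₁) χ(z)`, with `T = z⁻¹`. -/
def flow₁Psi₁ (D : Solution) (n : ℤ) : Fn Klmz := psi₁ D.flow₁W.1 n

/-- `∂_{α₁} Ψ₂ = (∂_{α₁} W₂) χ(z)`, with `T = z`. -/
def flow₁Psi₂ (D : Solution) (n : ℤ) : Fn Klmz := psi₂ D.flow₁W.2 n

/-- `∂_{α₂} Ψ₁ = (∂_{α₂} W₁) χ(z)`, with `T = z⁻¹`. -/
def flow₂Psi₁ (D : Solution) (n : ℤ) : Fn Klmz := psi₁ D.flow₂W.1 n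

/-- `∂_{α₂} Ψ₂ = (∂_{α₂} W₂) χ(z)`, with `T = z`. -/
def flow₂Psi₂ (D : Solution) (n : ℤ) : Fn Klmz := psi₂ D.flow₂W.2 n

end Solution

/-! ### Vertex operators and Miwa shifts -/

/-- The vertex operator
`X(x,λ,μ) f = λ⁻¹ e^{ξ(x+[λ⁻¹],μ) - ξ(x,λ)} f(x+[λ⁻¹]-[μ⁻¹], y)` for `b = Side.x`, and `X(y,λ,μ)`,
the same with the times `y`, for `b = Side.y`. -/
def vertexOp (b : Side) (f : Fn ℂ) : Fn Klm :=
  lam⁻¹ • (shiftFn b 1 (expXi b 1 (-1)) * expXi b (-1) (-1) * shiftFn b 1 (shiftFn b (-1) f))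

/-- `𝕏(x,λ,μ)τ / τ = ((μ/λ)^n X(x,λ,μ)τ(n) / τ(n))_n`. -/
def vertexRatioX (τ : ℤ → Fn ℂ) (n : ℤ) : Fn Klm :=
  ((mu / lam) ^ n) • (vertexOp Side.x (τ n) * (lift (lift (τ n)))⁻¹)

/-- `𝕏̃(y,λ,μ)τ / τ = ((λ/μ)^n X(y,λ,μ)τ(n) / τ(n))_n`. -/
def vertexRatioY (τ : ℤ → Fn ℂ) (n : ℤ) : Fn Klm :=
  ((lam / mu) ^ n) • (vertexOp Side.y (τ n) * (lift (lift (τ n)))⁻¹)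

/-- `((G₁(z) - 1) F)(n; x, y) = F(n; x-[z⁻¹], y) - F(n; x, y)`, with `T = z⁻¹`. -/
def G₁SubOne (F : ℤ → Fn Klm) (n : ℤ) : Fn Klmz := shiftFn Side.x (-1) (F n) - lift (F n)

/-- `((Λ G₂(z) - 1) F)(n; x, y) = F(n+1; x, y-[z]) - F(n; x, y)`, with `T = z`. -/
def ΛG₂SubOne (F : ℤ → Fn Klm) (n : ℤ) : Fn Klmz := shiftFn Side.y (-1) (F (n + 1)) - lift (F n)

end TodaLattice

end

open TodaLattice

noncomputable section

namespace TodaLattice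

section

open Finset.HasAntidiagonal
open Finset (range)

variable {K : Type} [Field K]

/-! ### Shifts as solutions of a differential equation -/

/-! The identities rest on difference Fay identities for `τ`, obtained here from the dressing
equations by linear algebra on rows. The shift of `x` by `-[T]` multiplies `e^{ξ(x,Λ)}` by `1 - TΛ`.
The Toda equations say that the span of the rows `i, i+1, …` of the pair `(S₁, S₂)` is stable under
`∂/∂x_l` corrected by right multiplication by `Λ^l` on the first component (`rowDeriv_mem_of_lax`).
Hence all `T`-coefficients of the shifted row, with the exponentials stripped off, lie in that span.
In the first component they end at column `i + 1`, so triangularity leaves only rows `i` and `i + 1`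
(`exists_shift_rows`). The two coefficients are read off at extreme columns, and writing `S₁, S₂`
through `τ` gives the Fay identities (`isFay_of_rows`). Reflecting the indices, `i ↦ -i`, exchanges
the two dressing operators and gives the identities for the `y`-shifts.

The flows are sums over `k < n` or `k ≥ n` of `Ψ*(k;λ) Ψ(k;z)` times a factor independent of `k`.
The Fay identity in `λ, z` makes each summand a difference of consecutive terms, so the sum
collapses to its boundary term at `n`. The other end disappears coefficientwise, because its order
in `T` tends to infinity (`seriesPos_eq_of_telescoping`).

It remains to compare this boundary term with the difference of the vertex operator ratios. After
common factors are removed, this is a three-term Fay identity in `λ, μ, z`; it follows from three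
two-parameter identities by eliminating the common factor `τ(x+[λ⁻¹])` (`IsFay.three_term` and its
variants).

The shift itself is handled as the unique solution of a first-order equation in `T` (`IsFlow.eq`),
which yields its multiplicativity, its naturality and its effect on exponentials. -/

/-- The weight `∑ l e_l` of a family `e = (e_l)`. -/
def wtFam (e : ℕ+ →₀ ℕ) : ℕ := e.sum fun l a => (l : ℕ) * a

theorem wtFam_add (e f : ℕ+ →₀ ℕ) : wtFam (e + f) = wtFam e + wtFam f :=
  Finsupp.sum_add_index' (by simp) (by intros; ring)

theorem wtFam_single (l : ℕ+) (a : ℕ) : wtFam (Finsupp.single l a) = l * a :=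
  Finsupp.sum_single_index (by simp)

theorem mul_le_wtFam (e : ℕ+ →₀ ℕ) (l : ℕ+) : (l : ℕ) * e l ≤ wtFam e := by
  by_cases h : l ∈ e.support
  · exact Finset.single_le_sum (f := fun l : ℕ+ => (l : ℕ) * e l) (fun _ _ => Nat.zero_le _) h
  · simp [Finsupp.notMem_support_iff.mp h]

theorem finite_wtFam_eq (d : ℕ) : {e : ℕ+ →₀ ℕ | wtFam e = d}.Finite := by
  classical
  refine (Set.finite_Iic (Finsupp.onFinset (Finset.Icc 1 d.succPNat)
    (fun l => if (l : ℕ) ≤ d then d else 0) ?_)).subset ?_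
  · intro l hl
    have : (l : ℕ) ≤ d := by by_contra h; simp [h] at hl
    rw [Finset.mem_Icc]
    exact ⟨one_le, by rw [← PNat.coe_le_coe]; simp; omega⟩
  · rintro e he l
    have h := mul_le_wtFam e l
    rw [show wtFam e = d from he] at h
    simp only [Finsupp.onFinset_apply]
    rcases Nat.eq_zero_or_pos (e l) with h0 | h0
    · omega
    · rw [if_pos ((Nat.le_mul_of_pos_right _ h0).trans h)]
      exact (Nat.le_mul_of_pos_left _ l.pos).trans h

/-- The power series with the given coefficients. -/
def mkFn (a : (Var →₀ ℕ) → K) : Fn K := a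

theorem coeff_mkFn (a : (Var →₀ ℕ) → K) (m : Var →₀ ℕ) : MvPowerSeries.coeff m (mkFn a) = a m := rfl

/-- The families of weight `d`. -/
def famOfWt (d : ℕ) : Finset (ℕ+ →₀ ℕ) := (finite_wtFam_eq d).toFinset

theorem mem_famOfWt {d : ℕ} {e : ℕ+ →₀ ℕ} : e ∈ famOfWt d ↔ wtFam e = d := by
  simp [famOfWt]

/-- The coefficient of `∏ x_l^{m_l}` in the Taylor term of index `e`. -/
def taylorCoeff (b : Side) (ε : K) (m : Var →₀ ℕ) (e : ℕ+ →₀ ℕ) : K :=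
  e.prod fun l a => ((m (b, l) + a).choose a : K) * (ε / ((l : ℕ) : K)) ^ a

/-- The series `f(x + ε[T])` (or `f(y + ε[T])`) in powers of `T`, with coefficients functions
of the times. -/
def shiftSeries (b : Side) (ε : K) (f : Fn K) : PowerSeries (Fn K) :=
  PowerSeries.mk fun d => mkFn fun m => ∑ᶠ (e : ℕ+ →₀ ℕ) (_ : wtFam e = d),
      taylorCoeff b ε m e * MvPowerSeries.coeff (m + e.mapDomain fun l => (b, l)) f

theorem coeff_shiftSeries (b : Side) (ε : K) (f : Fn K) (d : ℕ) (m : Var →₀ ℕ) :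
    MvPowerSeries.coeff m (PowerSeries.coeff d (shiftSeries b ε f)) =
      ∑ e ∈ famOfWt d, taylorCoeff b ε m e *
        MvPowerSeries.coeff (m + e.mapDomain fun l => (b, l)) f := by
  rw [shiftSeries, PowerSeries.coeff_mk, coeff_mkFn]
  change (∑ᶠ (e : ℕ+ →₀ ℕ) (_ : e ∈ {e : ℕ+ →₀ ℕ | wtFam e = d}), _) = _
  rw [finsum_mem_eq_finite_toFinset_sum _ (finite_wtFam_eq d)]
  rfl

theorem coeff_zero_shiftSeries (b : Side) (ε : K) (f : Fn K) :
    PowerSeries.coeff 0 (shiftSeries b ε f) = f := by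
  ext m
  rw [coeff_shiftSeries]
  have : famOfWt 0 = {0} := by
    ext e
    rw [mem_famOfWt, Finset.mem_singleton]
    constructor
    · intro h
      ext l
      have := mul_le_wtFam e l
      rw [h] at this
      simpa using this
    · rintro rfl; rfl
  simp [this, taylorCoeff]

/-- Only the factor at `l` changes, and there `(e+1) binom(m+e+1, e+1) = (m+1) binom(m+1+e, e)`. The
factor `m (b, l) + 1` on the right is the one produced by `∂/∂x_l`. -/
theorem taylorCoeff_add_single [CharZero K] (b : Side) (ε : K) (m : Var →₀ ℕ) (e : ℕ+ →₀ ℕ)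
    (l : ℕ+) : ((l : ℕ) : K) * ((e l : K) + 1) * taylorCoeff b ε m (e + Finsupp.single l 1) =
      ε * taylorCoeff b ε (m + Finsupp.single (b, l) 1) e * ((m (b, l) : K) + 1) := by
  classical
  set s := insert l e.support
  have hl : l ∈ s := Finset.mem_insert_self _ _
  have h1 : (e + Finsupp.single l 1).support ⊆ s := by
    refine Finsupp.support_add.trans ?_
    intro k hk
    rcases Finset.mem_union.mp hk with h | h
    · exact Finset.mem_insert_of_mem h
    · rw [Finset.mem_singleton.mp (Finsupp.support_single_subset h)]; exact hl
  have h2 : e.support ⊆ s := Finset.subset_insert _ _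
  rw [taylorCoeff, taylorCoeff, Finsupp.prod_of_support_subset _ h1 _ (by simp),
    Finsupp.prod_of_support_subset _ h2 _ (by simp), ← Finset.mul_prod_erase s _ hl,
    ← Finset.mul_prod_erase s _ hl]
  have h3 : ∀ k ∈ s.erase l, (((m (b, k) + (e + Finsupp.single l 1 : ℕ+ →₀ ℕ) k).choose
        ((e + Finsupp.single l 1 : ℕ+ →₀ ℕ) k) : K) *
        (ε / ((k : ℕ) : K)) ^ (e + Finsupp.single l 1 : ℕ+ →₀ ℕ) k) =
      (((m + Finsupp.single (b, l) 1 : Var →₀ ℕ) (b, k) + e k).choose (e k) : K) *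
        (ε / ((k : ℕ) : K)) ^ e k := by
    intro k hk
    have hkl : k ≠ l := Finset.ne_of_mem_erase hk
    have : ((b, k) : Var) ≠ (b, l) := by simpa using hkl
    simp [hkl.symm]
  rw [Finset.prod_congr rfl h3]
  generalize (∏ k ∈ s.erase l,
    (((m + Finsupp.single (b, l) 1 : Var →₀ ℕ) (b, k) + e k).choose (e k) : K) *
        (ε / ((k : ℕ) : K)) ^ e k) = R
  have hl0 : ((l : ℕ) : K) ≠ 0 := by exact_mod_cast l.pos.ne'
  have hc : ((m (b, l) + (e l + 1)).choose (e l + 1) : K) * ((e l : K) + 1) =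
      ((m (b, l) + 1 + e l).choose (e l) : K) * ((m (b, l) : K) + 1) := by
    have := Nat.choose_succ_right_eq (m (b, l) + (e l + 1)) (e l)
    rw [show m (b, l) + 1 + e l = m (b, l) + (e l + 1) by ring]
    rw [show m (b, l) + (e l + 1) - e l = m (b, l) + 1 by omega] at this
    exact_mod_cast this
  simp only [Finsupp.add_apply, Finsupp.single_eq_same, pow_succ]
  field_simp
  linear_combination (ε / ((l : ℕ) : K)) ^ e l * R * ε * hc

/-- The equation `∂F/∂T = ε ∑_l T^{l-1} ∂F/∂x_l` satisfied by the shift `F = f(x + ε[T])`. -/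
def IsFlow (b : Side) (ε : K) (F : PowerSeries (Fn K)) : Prop :=
  ∀ d : ℕ, ((d : Fn K) + 1) * PowerSeries.coeff (d + 1) F =
    MvPowerSeries.C ε * ∑ p ∈ antidiagonal d,
      MvPowerSeries.pderiv K ((b, p.1.succPNat) : Var) (PowerSeries.coeff p.2 F)

theorem wtFam_eq_sum_range {e : ℕ+ →₀ ℕ} {d : ℕ} (h : wtFam e ≤ d) :
    ∑ l ∈ range d, (l + 1) * e l.succPNat = wtFam e := by
  classical
  have hs : e.support ⊆ (range d).image Nat.succPNat := by
    intro l hl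
    have h1 := (mul_le_wtFam e l).trans h
    have h2 : (l : ℕ) ≤ d :=
      (Nat.le_mul_of_pos_right _ (Nat.pos_of_ne_zero (Finsupp.mem_support_iff.mp hl))).trans h1
    refine Finset.mem_image.mpr ⟨l.natPred, ?_, PNat.succPNat_natPred l⟩
    have := l.pos
    rw [Finset.mem_range]
    have := PNat.natPred_add_one l
    omega
  rw [wtFam, Finsupp.sum_of_support_subset _ hs _ (by simp),
    Finset.sum_image (by intro a _ b _ h; exact Nat.succPNat_injective h)]
  simp

/-- Euler's trick: on Taylor indices of weight `d + 1` the factor `d + 1` equals `∑ l e_l`. In the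
summand with factor `l e_l`, one unit of `e_l` is traded for one derivative `∂/∂x_l`. -/
theorem isFlow_shiftSeries [CharZero K] (b : Side) (ε : K) (f : Fn K) :
    IsFlow b ε (shiftSeries b ε f) := by
  intro d
  ext m
  have hcast : ((d : Fn K) + 1) = MvPowerSeries.C ((d : K) + 1) := by simp
  rw [hcast, MvPowerSeries.coeff_C_mul, MvPowerSeries.coeff_C_mul, coeff_shiftSeries, map_sum]
  have h1 : ∀ e ∈ famOfWt (d + 1), ((d : K) + 1) * (taylorCoeff b ε m e *
        MvPowerSeries.coeff (m + e.mapDomain fun l => (b, l)) f) =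
      ∑ l ∈ range (d + 1), (((l : K) + 1) * (e l.succPNat : K)) * (taylorCoeff b ε m e *
        MvPowerSeries.coeff (m + e.mapDomain fun l => (b, l)) f) := by
    intro e he
    rw [← Finset.sum_mul]
    congr 1
    have := wtFam_eq_sum_range (mem_famOfWt.mp he).le
    rw [mem_famOfWt.mp he] at this
    exact_mod_cast this.symm
  rw [Finset.mul_sum, Finset.sum_congr rfl h1, Finset.sum_comm,
    Finset.Nat.sum_antidiagonal_eq_sum_range_succ_mk, Finset.mul_sum]
  refine Finset.sum_congr rfl fun l hl => ?_
  have hl' : l ≤ d := Nat.lt_succ_iff.mp (Finset.mem_range.mp hl)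
  rw [MvPowerSeries.coeff_pderiv, coeff_shiftSeries, Finset.sum_mul, Finset.mul_sum]
  symm
  refine Finset.sum_of_injOn (fun e => e + Finsupp.single l.succPNat 1)
    (fun a _ b _ h => add_right_cancel h) ?_ ?_ ?_
  · intro e he
    rw [Finset.mem_coe, mem_famOfWt] at he ⊢
    rw [wtFam_add, wtFam_single, he]
    simp only [Nat.succPNat_coe]
    omega
  -- Indices that are not of the form `e + δ_l` have `e_l = 0` and are killed by the factor `e_l`.
  · intro e he hne
    have : e l.succPNat = 0 := by
      by_contra h0
      apply hne
      have hle : Finsupp.single l.succPNat 1 ≤ e := by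
        rw [Finsupp.single_le_iff]; omega
      refine ⟨e - Finsupp.single l.succPNat 1, ?_, tsub_add_cancel_of_le hle⟩
      have h2 := congrArg wtFam (tsub_add_cancel_of_le hle)
      rw [wtFam_add, wtFam_single, mem_famOfWt.mp he] at h2
      rw [Finset.mem_coe, mem_famOfWt]
      simp only [Nat.succPNat_coe] at h2
      omega
    simp [this]
  · intro e he
    have h := taylorCoeff_add_single b ε m e l.succPNat
    have h3 : m + (e + Finsupp.single l.succPNat 1).mapDomain (fun l => ((b, l) : Var)) =
        m + Finsupp.single (b, l.succPNat) 1 + e.mapDomain fun l => (b, l) := by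
      rw [Finsupp.mapDomain_add, Finsupp.mapDomain_single]; abel
    rw [h3]
    simp only [Finsupp.add_apply, Finsupp.single_eq_same]
    push_cast
    simp only [Nat.succPNat_coe, Nat.succ_eq_add_one] at h
    push_cast at h
    linear_combination (-MvPowerSeries.coeff
      (m + Finsupp.single (b, l.succPNat) 1 + e.mapDomain fun l => (b, l)) f) * h

/-- In characteristic zero `d + 1` is invertible, so the equation is a recursion that determines
every coefficient from the constant one. -/
theorem IsFlow.eq [CharZero K] {b : Side} {ε : K} {F G : PowerSeries (Fn K)} (hF : IsFlow b ε F)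
    (hG : IsFlow b ε G) (h : PowerSeries.coeff 0 F = PowerSeries.coeff 0 G) : F = G := by
  ext1 d
  induction d using Nat.strong_induction_on with
  | _ d ih =>
    rcases d with _ | d
    · exact h
    · have h1 := hF d
      rw [Finset.sum_congr rfl (g := fun p => MvPowerSeries.pderiv K ((b, p.1.succPNat) : Var)
        (PowerSeries.coeff p.2 G))
        (fun p hp => by rw [ih p.2 (by have := mem_antidiagonal.mp hp; omega)]), ← hG d] at h1
      have h2 : ((d : Fn K) + 1) = MvPowerSeries.C ((d : K) + 1) := by simp
      have h3 : ((d : K) + 1) ≠ 0 := by exact_mod_cast d.succ_ne_zero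
      rw [h2] at h1
      have h4 := congrArg (fun x => MvPowerSeries.C ((d : K) + 1)⁻¹ * x) h1
      simp only [← mul_assoc, ← map_mul, inv_mul_cancel₀ h3, map_one, one_mul] at h4
      exact h4

theorem IsFlow.add {b : Side} {ε : K} {F G : PowerSeries (Fn K)} (hF : IsFlow b ε F)
    (hG : IsFlow b ε G) : IsFlow b ε (F + G) := by
  intro d
  simp only [map_add, Finset.sum_add_distrib, mul_add, hF d, hG d]

theorem sum_antidiagonal_mul_fst {R : Type*} [CommRing R] (a : ℕ → ℕ → R) (c : ℕ → R) (d : ℕ) :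
    ∑ p ∈ antidiagonal d, ∑ q ∈ antidiagonal p.2, a p.1 q.1 * c q.2 =
      ∑ p ∈ antidiagonal d, (∑ q ∈ antidiagonal p.1, a q.1 q.2) * c p.2 := by
  simp only [Finset.sum_mul, Finset.sum_sigma']
  refine Finset.sum_nbij' (fun x => ⟨(x.1.1 + x.2.1, x.2.2), (x.1.1, x.2.1)⟩)
    (fun x => ⟨(x.2.1, x.2.2 + x.1.2), (x.2.2, x.1.2)⟩) ?_ ?_ ?_ ?_ ?_
  all_goals
    rintro ⟨⟨i, j⟩, ⟨k, l⟩⟩ h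
    simp only [Finset.mem_sigma, mem_antidiagonal] at h ⊢
    try obtain ⟨h1, h2⟩ := h
    try subst h2
    try subst h1
    try simp [add_assoc]

theorem sum_antidiagonal_mul_snd {R : Type*} [CommRing R] (a : ℕ → ℕ → R) (c : ℕ → R) (d : ℕ) :
    ∑ p ∈ antidiagonal d, ∑ q ∈ antidiagonal p.2, c q.1 * a p.1 q.2 =
      ∑ p ∈ antidiagonal d, c p.1 * ∑ q ∈ antidiagonal p.2, a q.1 q.2 := by
  have := sum_antidiagonal_mul_fst a c d
  rw [← Finset.Nat.sum_antidiagonal_swap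
    (f := fun p : ℕ × ℕ => c p.1 * ∑ q ∈ antidiagonal p.2, a q.1 q.2)]
  simp only [Prod.fst_swap, Prod.snd_swap]
  simp only [mul_comm (c _) (∑ q ∈ _, _)]
  rw [← this]
  refine Finset.sum_congr rfl fun p _ => ?_
  rw [← Finset.Nat.sum_antidiagonal_swap]
  exact Finset.sum_congr rfl fun q _ => mul_comm _ _

/-- Both `∂/∂T` and `∑ T^{l-1} ∂/∂x_l` are derivations. The two preceding convolution lemmas regroup
the triple sums coming from the Leibniz rule. -/
theorem IsFlow.mul {b : Side} {ε : K} {F G : PowerSeries (Fn K)} (hF : IsFlow b ε F)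
    (hG : IsFlow b ε G) : IsFlow b ε (F * G) := by
  intro d
  have h0 : ((d : Fn K) + 1) * PowerSeries.coeff (d + 1) (F * G) =
      PowerSeries.coeff d (PowerSeries.derivative (Fn K) (F * G)) := by
    rw [PowerSeries.coeff_derivative, mul_comm]
  have hF' : ∀ k, PowerSeries.coeff k (PowerSeries.derivative (Fn K) F) =
      MvPowerSeries.C ε * ∑ p ∈ antidiagonal k,
      MvPowerSeries.pderiv K ((b, p.1.succPNat) : Var) (PowerSeries.coeff p.2 F) := fun k => by
    rw [PowerSeries.coeff_derivative, mul_comm, hF k]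
  have hG' : ∀ k, PowerSeries.coeff k (PowerSeries.derivative (Fn K) G) =
      MvPowerSeries.C ε * ∑ p ∈ antidiagonal k,
      MvPowerSeries.pderiv K ((b, p.1.succPNat) : Var) (PowerSeries.coeff p.2 G) := fun k => by
    rw [PowerSeries.coeff_derivative, mul_comm, hG k]
  rw [h0, Derivation.leibniz, smul_eq_mul, smul_eq_mul, mul_comm G, map_add, PowerSeries.coeff_mul,
    PowerSeries.coeff_mul]
  simp only [hF', hG', PowerSeries.coeff_mul, map_sum, Derivation.leibniz, smul_eq_mul,
    Finset.sum_add_distrib]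
  have e1 := sum_antidiagonal_mul_fst (fun l k => MvPowerSeries.pderiv K ((b, l.succPNat) : Var)
    (PowerSeries.coeff k F)) (fun k => PowerSeries.coeff k G) d
  have e2 := sum_antidiagonal_mul_snd (fun l k => MvPowerSeries.pderiv K ((b, l.succPNat) : Var)
    (PowerSeries.coeff k G)) (fun k => PowerSeries.coeff k F) d
  rw [e2, mul_add]
  congr 1
  · rw [Finset.mul_sum]
    exact Finset.sum_congr rfl fun p _ => by ring
  · simp only [mul_comm (PowerSeries.coeff _ G)]
    rw [e1, Finset.mul_sum]
    exact Finset.sum_congr rfl fun p _ => by ring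

theorem isFlow_one (b : Side) (ε : K) : IsFlow b ε 1 := by
  intro d
  simp only [PowerSeries.coeff_one]
  rw [Finset.sum_eq_zero]
  · simp
  · intro p _
    split_ifs <;> simp

theorem isFlow_zero (b : Side) (ε : K) : IsFlow b ε 0 := by
  intro d; simp

variable [CharZero K]

/-- The shift `f ↦ f(x + ε[T])` as a ring homomorphism. -/
def shiftHom (b : Side) (ε : K) : Fn K →+* PowerSeries (Fn K) where
  toFun := shiftSeries b ε
  map_one' := (isFlow_shiftSeries b ε 1).eq (isFlow_one b ε) (by simp [coeff_zero_shiftSeries])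
  map_zero' := (isFlow_shiftSeries b ε 0).eq (isFlow_zero b ε) (by simp [coeff_zero_shiftSeries])
  map_add' f g := (isFlow_shiftSeries b ε _).eq
    ((isFlow_shiftSeries b ε f).add (isFlow_shiftSeries b ε g))
    (by simp only [map_add, coeff_zero_shiftSeries])
  map_mul' f g := (isFlow_shiftSeries b ε _).eq
    ((isFlow_shiftSeries b ε f).mul (isFlow_shiftSeries b ε g)) (by
      simp [PowerSeries.coeff_mul, -PowerSeries.coeff_zero_eq_constantCoeff,
        coeff_zero_shiftSeries])

theorem isFlow_shiftHom (b : Side) (ε : K) (f : Fn K) : IsFlow b ε (shiftHom b ε f) :=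
  isFlow_shiftSeries b ε f

theorem coeff_zero_shiftHom (b : Side) (ε : K) (f : Fn K) :
    PowerSeries.coeff 0 (shiftHom b ε f) = f := coeff_zero_shiftSeries b ε f

end

section

open Finset.HasAntidiagonal
open Finset (range)

variable {K : Type} [Field K]

/-! ### Laurent series -/

namespace Laurent

theorem ext {f g : Laurent K} (h : ∀ d, f.coeff d = g.coeff d) : f = g :=
  HahnSeries.ext (funext h)

@[simp] theorem coeff_zero (d : ℤ) : (0 : Laurent K).coeff d = 0 := rfl

@[simp] theorem coeff_add (f g : Laurent K) (d : ℤ) :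
    (f + g).coeff d = f.coeff d + g.coeff d := rfl

/-- The coefficient of `T^d` as an additive map. -/
def coeffHom (d : ℤ) : Laurent K →+ K where
  toFun f := f.coeff d
  map_zero' := rfl
  map_add' _ _ := rfl

@[simp] theorem coeff_sub (f g : Laurent K) (d : ℤ) :
    (f - g).coeff d = f.coeff d - g.coeff d := map_sub (coeffHom d) f g

@[simp] theorem coeff_sum {ι : Type*} (s : Finset ι) (f : ι → Laurent K) (d : ℤ) :
    (∑ i ∈ s, f i).coeff d = ∑ i ∈ s, (f i).coeff d := map_sum (coeffHom d) f s

theorem coeff_single (k : ℤ) (a : K) (d : ℤ) :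
    (single k a).coeff d = if d = k then a else 0 := by
  change (HahnSeries.single k a).coeff d = _
  rw [HahnSeries.coeff_single]
  split_ifs <;> rfl

theorem coeff_single_mul (k : ℤ) (a : K) (f : Laurent K) (d : ℤ) :
    (single k a * f).coeff d = a * f.coeff (d - k) := by
  have := HahnSeries.coeff_single_mul_add (Γ := ℤ) (r := a) (x := f) (a := d - k) (b := k)
  rw [sub_add_cancel] at this
  exact this

theorem const_eq_single (a : K) : const a = single 0 a := rfl

theorem coeff_const_mul (a : K) (f : Laurent K) (d : ℤ) :
    (const a * f).coeff d = a * f.coeff d := by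
  rw [const_eq_single, coeff_single_mul, sub_zero]

theorem single_mul_single (k l : ℤ) (a b : K) :
    single k a * single l b = single (k + l) (a * b) :=
  HahnSeries.single_mul_single (Γ := ℤ) (R := K)

theorem single_zero_one : (single 0 1 : Laurent K) = 1 := rfl

theorem single_ne_zero (k : ℤ) : (single k 1 : Laurent K) ≠ 0 := by
  intro h
  have := congrArg (fun f => f.coeff k) h
  simp [coeff_single] at this

theorem single_zpow (k : ℤ) : (single k 1 : Laurent K) = single 1 1 ^ k := by
  have hn : ∀ n : ℕ, (single (n : ℤ) 1 : Laurent K) = single 1 1 ^ n := by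
    intro n
    induction n with
    | zero => simp [single_zero_one]
    | succ n ih => rw [pow_succ, ← ih, single_mul_single]; simp
  obtain ⟨n, rfl | rfl⟩ := k.eq_nat_or_neg
  · rw [hn, zpow_natCast]
  · rw [zpow_neg, zpow_natCast, ← hn]
    refine eq_inv_of_mul_eq_one_left ?_
    rw [single_mul_single]; simp [single_zero_one]

theorem coeff_ofPowerSeries_natCast (F : PowerSeries K) (d : ℕ) :
    (ofPowerSeries F).coeff (d : ℤ) = PowerSeries.coeff d F :=
  HahnSeries.ofPowerSeries_apply_coeff F d

theorem coeff_ofPowerSeries_of_neg (F : PowerSeries K) {d : ℤ} (hd : d < 0) :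
    (ofPowerSeries F).coeff d = 0 := by
  change (HahnSeries.ofPowerSeries ℤ K F).coeff d = 0
  rw [HahnSeries.ofPowerSeries_apply]
  refine HahnSeries.embDomain_of_notMem_range ?_
  rintro ⟨n, hn⟩
  simp at hn
  omega

theorem ofPowerSeries_injective : Function.Injective (ofPowerSeries (K := K)) :=
  HahnSeries.ofPowerSeries_injective

theorem ofPowerSeries_C (a : K) : ofPowerSeries (PowerSeries.C a) = const a :=
  HahnSeries.ofPowerSeries_C a

theorem ofPowerSeries_X : ofPowerSeries (PowerSeries.X : PowerSeries K) = single 1 1 :=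
  HahnSeries.ofPowerSeries_X

theorem _root_.HahnSeries.coeff_mul_of_lt {f g : HahnSeries ℤ K} {a b : ℤ}
    (hf : ∀ d < a, f.coeff d = 0) (hg : ∀ d < b, g.coeff d = 0) {d : ℤ} (hd : d < a + b) :
    (f * g).coeff d = 0 := by
  rw [HahnSeries.coeff_mul]
  refine Finset.sum_eq_zero fun p hp => ?_
  rw [Finset.mem_antidiagonal] at hp
  obtain ⟨h1, h2, h3⟩ := hp
  exfalso
  have h1' : a ≤ p.1 := by by_contra h; exact h1 (hf _ (not_le.mp h))
  have h2' : b ≤ p.2 := by by_contra h; exact h2 (hg _ (not_le.mp h))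
  omega

theorem coeff_mul_of_lt {f g : Laurent K} {a b : ℤ} (hf : ∀ d < a, f.coeff d = 0)
    (hg : ∀ d < b, g.coeff d = 0) {d : ℤ} (hd : d < a + b) : (f * g).coeff d = 0 :=
  HahnSeries.coeff_mul_of_lt hf hg hd

theorem bddBelow_support_coeff (f : Laurent K) : BddBelow (Function.support f.coeff) := by
  change BddBelow (HahnSeries.support (Γ := ℤ) (R := K) f)
  by_cases h : f = 0
  · subst h
    change BddBelow (HahnSeries.support (0 : HahnSeries ℤ K))
    simp
  · refine ⟨HahnSeries.order (Γ := ℤ) (R := K) f, ?_⟩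
    intro d hd
    exact HahnSeries.order_le_of_coeff_ne_zero hd

theorem laurent_coeff (f : Laurent K) : laurent f.coeff = f :=
  ext fun d => coeff_laurent f.bddBelow_support_coeff d

instance [CharZero K] : CharZero (Laurent K) :=
  charZero_of_injective_ringHom (f := (const : K →+* Laurent K)) (RingHom.injective _)

end Laurent

/-! ### Interchanging the times and a spectral parameter -/

theorem coeff_lift (f : Fn K) (m : Var →₀ ℕ) :
    MvPowerSeries.coeff m (lift f) = Laurent.const (MvPowerSeries.coeff m f) :=
  MvPowerSeries.coeff_map _ _ _

/-- A power series in `T` whose coefficients are functions of the times, seen as a function of the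
times with coefficients in `K((T))`. -/
def transpose : PowerSeries (Fn K) →+* Fn (Laurent K) where
  toFun F := mkFn fun m => Laurent.ofPowerSeries <| PowerSeries.mk fun d =>
    MvPowerSeries.coeff m (PowerSeries.coeff d F)
  map_zero' := by
    ext m
    simp [coeff_mkFn, show (PowerSeries.mk fun _ : ℕ => (0 : K)) = 0 from rfl]
  map_one' := by
    classical
    ext m
    rw [coeff_mkFn, MvPowerSeries.coeff_one, ← map_one (Laurent.ofPowerSeries (K := K)),
      ← map_zero (Laurent.ofPowerSeries (K := K)), ← apply_ite]
    congr 1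
    ext d
    rw [PowerSeries.coeff_mk, PowerSeries.coeff_one]
    split_ifs <;> simp_all [MvPowerSeries.coeff_one, PowerSeries.coeff_one]
  map_add' F G := by
    ext m
    rw [map_add]
    simp only [coeff_mkFn, ← map_add]
    rfl
  map_mul' F G := by
    classical
    ext m
    simp only [MvPowerSeries.coeff_mul, coeff_mkFn, ← map_mul, ← map_sum]
    congr 1
    ext d
    simp only [PowerSeries.coeff_mk, map_sum, PowerSeries.coeff_mul, MvPowerSeries.coeff_mul]
    rw [Finset.sum_comm]

theorem coeff_transpose (F : PowerSeries (Fn K)) (m : Var →₀ ℕ) :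
    MvPowerSeries.coeff m (transpose F) = Laurent.ofPowerSeries (PowerSeries.mk fun d =>
      MvPowerSeries.coeff m (PowerSeries.coeff d F)) := rfl

theorem transpose_injective : Function.Injective (transpose (K := K)) := by
  intro F G h
  ext d m
  have h1 := congrArg (MvPowerSeries.coeff m) h
  rw [coeff_transpose, coeff_transpose] at h1
  have h2 := congrArg (PowerSeries.coeff d) (Laurent.ofPowerSeries_injective h1)
  simpa using h2

theorem transpose_C (f : Fn K) : transpose (PowerSeries.C f) = lift f := by
  ext m
  rw [coeff_transpose, coeff_lift, ← Laurent.ofPowerSeries_C]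
  congr 1
  ext d
  rw [PowerSeries.coeff_mk, PowerSeries.coeff_C, PowerSeries.coeff_C]
  split_ifs <;> simp

theorem transpose_X : transpose (PowerSeries.X : PowerSeries (Fn K)) =
    MvPowerSeries.C (Laurent.single 1 1) := by
  classical
  ext m
  rw [coeff_transpose, MvPowerSeries.coeff_C, ← Laurent.ofPowerSeries_X,
      ← map_zero (Laurent.ofPowerSeries (K := K)), ← apply_ite]
  congr 1
  ext d
  rw [PowerSeries.coeff_mk, PowerSeries.coeff_X]
  split_ifs <;> simp_all [MvPowerSeries.coeff_one, PowerSeries.coeff_X]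

theorem lift_C (a : K) : lift (MvPowerSeries.C a) = MvPowerSeries.C (Laurent.const a) :=
  MvPowerSeries.map_C _ _

/-! ### Naturality of the shifts -/

/-- The equation involves only sums, derivatives and one constant. Multiplicativity of `ρ` is not
required, so that `ρ` may itself be a partial derivative. -/
theorem IsFlow.map_addHom {K' : Type} [Field K'] {b : Side} {ε : K} {ε' : K'}
    {F : PowerSeries (Fn K)} (hF : IsFlow b ε F) (ρ : Fn K →+ Fn K')
    (hρ : ∀ v f, ρ (MvPowerSeries.pderiv K v f) = MvPowerSeries.pderiv K' v (ρ f))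
    (hε : ∀ f, ρ (MvPowerSeries.C ε * f) = MvPowerSeries.C ε' * ρ f) :
    IsFlow b ε' (PowerSeries.mk fun d => ρ (PowerSeries.coeff d F)) := by
  intro d
  have h := congrArg ρ (hF d)
  rw [hε, map_sum, ← Nat.cast_succ, ← nsmul_eq_mul, map_nsmul, nsmul_eq_mul, Nat.cast_succ] at h
  simp only [PowerSeries.coeff_mk, h, hρ]

/-- A map commutes with the derivatives with respect to the times. -/
def IsDHom {K' : Type} [Field K'] (ρ : Fn K →+* Fn K') : Prop :=
  ∀ v f, ρ (MvPowerSeries.pderiv K v f) = MvPowerSeries.pderiv K' v (ρ f)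

theorem IsDHom.comp {K' K'' : Type} [Field K'] [Field K''] {ρ : Fn K →+* Fn K'}
    {ρ' : Fn K' →+* Fn K''} (h' : IsDHom ρ') (h : IsDHom ρ) : IsDHom (ρ'.comp ρ) := by
  intro v f
  simp [h v f, h' v]

theorem isDHom_lift : IsDHom (lift (K := K)) := by
  intro v f
  ext m
  simp [coeff_lift, MvPowerSeries.coeff_pderiv]

theorem pderiv_transpose (v : Var) (F : PowerSeries (Fn K)) :
    MvPowerSeries.pderiv (Laurent K) v (transpose F) =
      transpose (PowerSeries.mk fun d => MvPowerSeries.pderiv K v (PowerSeries.coeff d F)) := by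
  ext m
  rw [MvPowerSeries.coeff_pderiv, coeff_transpose, coeff_transpose]
  have : ((m v : Laurent K) + 1) = Laurent.ofPowerSeries (PowerSeries.C ((m v : K) + 1)) := by
    simp
  rw [this, ← map_mul]
  congr 1
  ext d
  simp [MvPowerSeries.coeff_pderiv, -map_add]

variable [CharZero K]

/-- Both sides are flows with the same initial value. This naturality allows shifts in several
parameters to be interchanged. -/
theorem map_shiftHom {K' : Type} [Field K'] [CharZero K'] (b : Side) {ε : K} {ε' : K'}
    (ρ : Fn K →+* Fn K') (hρ : IsDHom ρ) (hε : ρ (MvPowerSeries.C ε) = MvPowerSeries.C ε')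
    (f : Fn K) : PowerSeries.map ρ (shiftHom b ε f) = shiftHom b ε' (ρ f) := by
  have h := (isFlow_shiftHom b ε f).map_addHom ρ.toAddMonoidHom hρ (ε' := ε') (fun f => by
    change ρ _ = _ * ρ f
    rw [map_mul, hε])
  refine IsFlow.eq (show IsFlow b ε' (PowerSeries.map ρ (shiftHom b ε f)) from ?_)
    (isFlow_shiftHom b ε' (ρ f)) ?_
  · convert h using 1
    ext1 d
    rw [PowerSeries.coeff_mk, PowerSeries.coeff_map]
    rfl
  rw [coeff_zero_shiftHom]
  simpa [-PowerSeries.coeff_zero_eq_constantCoeff] using congrArg ρ (coeff_zero_shiftHom b ε f)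

theorem pderiv_coeff_shiftHom (b : Side) (ε : K) (f : Fn K) (v : Var) (d : ℕ) :
    MvPowerSeries.pderiv K v (PowerSeries.coeff d (shiftHom b ε f)) =
      PowerSeries.coeff d (shiftHom b ε (MvPowerSeries.pderiv K v f)) := by
  have h := (isFlow_shiftHom b ε f).map_addHom (ε' := ε)
    (MvPowerSeries.pderiv K v).toLinearMap.toAddMonoidHom (fun w f => by
      ext m
      classical
      by_cases hvw : v = w
      · subst hvw; rfl
      · simp [MvPowerSeries.coeff_pderiv, hvw, Ne.symm hvw,
          add_right_comm]
        ring) (fun f => by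
      ext m
      simp [MvPowerSeries.coeff_pderiv])
  have h2 := IsFlow.eq h (isFlow_shiftHom b ε (MvPowerSeries.pderiv K v f)) (by
    rw [coeff_zero_shiftHom, PowerSeries.coeff_mk, coeff_zero_shiftHom]; rfl)
  rw [← h2, PowerSeries.coeff_mk]; rfl

theorem shiftFn_eq_transpose (b : Side) (ε : K) (f : Fn K) :
    shiftFn b ε f = transpose (shiftHom b ε f) := by
  ext m
  rw [coeff_transpose]
  change Laurent.ofPowerSeries _ = _
  congr 1
  ext d
  rw [PowerSeries.coeff_mk, PowerSeries.coeff_mk]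
  change _ = MvPowerSeries.coeff m (PowerSeries.coeff d (shiftSeries b ε f))
  rw [shiftSeries, PowerSeries.coeff_mk, coeff_mkFn]
  rfl

/-- The shift as a ring homomorphism to functions with coefficients in `K((T))`. -/
def shiftRingHom (b : Side) (ε : K) : Fn K →+* Fn (Laurent K) := transpose.comp (shiftHom b ε)

theorem shiftFn_eq (b : Side) (ε : K) (f : Fn K) : shiftFn b ε f = shiftRingHom b ε f :=
  shiftFn_eq_transpose b ε f

theorem isDHom_shiftRingHom (b : Side) (ε : K) : IsDHom (shiftRingHom b ε) := by
  intro v f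
  change transpose _ = MvPowerSeries.pderiv _ v (transpose _)
  rw [pderiv_transpose]
  congr 1
  ext1 d
  rw [PowerSeries.coeff_mk, pderiv_coeff_shiftHom]

theorem shiftHom_C (b : Side) (ε : K) (a : K) :
    shiftHom b ε (MvPowerSeries.C a) = PowerSeries.C (MvPowerSeries.C a) := by
  refine IsFlow.eq (isFlow_shiftHom _ _ _) (b := b) (ε := ε) ?_ ?_
  · intro d
    simp only [PowerSeries.coeff_C]
    rw [Finset.sum_eq_zero]
    · simp
    · intro p _
      split_ifs <;> simp
  · rw [coeff_zero_shiftHom, PowerSeries.coeff_zero_C]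

theorem shiftRingHom_C (b : Side) (ε : K) (a : K) :
    shiftRingHom b ε (MvPowerSeries.C a) = MvPowerSeries.C (Laurent.const a) := by
  change transpose (shiftHom b ε _) = _
  rw [shiftHom_C, transpose_C, lift_C]

/-! ### Composition of two shifts with equal parameters -/

/-- Equating the two parameters of a double power series. -/
def diagonal (R : Type*) [CommRing R] : PowerSeries (PowerSeries R) →+* PowerSeries R where
  toFun F := PowerSeries.mk fun n => ∑ p ∈ antidiagonal n,
    PowerSeries.coeff p.1 (PowerSeries.coeff p.2 F)
  map_zero' := by ext; simp
  map_one' := by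
    ext n
    rw [PowerSeries.coeff_mk, PowerSeries.coeff_one, Finset.sum_eq_single (n, 0)]
    · simp [PowerSeries.coeff_one]
    · rintro ⟨i, j⟩ hp hne
      rw [PowerSeries.coeff_one, if_neg, map_zero]
      rintro rfl
      exact hne (by simpa using hp)
    · intro h; simp at h
  map_add' F G := by ext n; simp [Finset.sum_add_distrib]
  map_mul' F G := by
    ext n
    simp only [PowerSeries.coeff_mul, PowerSeries.coeff_mk, map_sum, Finset.sum_mul_sum]
    simp only [Finset.sum_sigma']
    refine Finset.sum_nbij' (fun x => ⟨(x.2.2.1 + x.2.1.1, x.2.2.2 + x.2.1.2),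
        (x.2.2.1, x.2.1.1), (x.2.2.2, x.2.1.2)⟩)
      (fun x => ⟨(x.2.1.1 + x.2.2.1, x.2.1.2 + x.2.2.2),
        (x.2.1.2, x.2.2.2), (x.2.1.1, x.2.2.1)⟩) ?_ ?_ ?_ ?_ ?_
    all_goals
      rintro ⟨⟨i, j⟩, ⟨k, l⟩, ⟨p, q⟩⟩ h
      simp only [Finset.mem_sigma, mem_antidiagonal] at h ⊢
      try obtain ⟨h1, h2, h3⟩ := h
      try subst h2
      try subst h3
      try subst h1
      try simp [add_comm, add_left_comm]

theorem coeff_diagonal {R : Type*} [CommRing R] (F : PowerSeries (PowerSeries R)) (n : ℕ) :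
    PowerSeries.coeff n (diagonal R F) = ∑ p ∈ antidiagonal n,
      PowerSeries.coeff p.1 (PowerSeries.coeff p.2 F) :=
  PowerSeries.coeff_mk n fun n => ∑ p ∈ antidiagonal n,
    PowerSeries.coeff p.1 (PowerSeries.coeff p.2 F)

theorem diagonal_C {R : Type*} [CommRing R] (F : PowerSeries R) :
    diagonal R (PowerSeries.C F) = F := by
  ext n
  rw [coeff_diagonal, Finset.sum_eq_single (n, 0)]
  · simp
  · rintro ⟨i, j⟩ hp hne
    rw [PowerSeries.coeff_C, if_neg, map_zero]
    rintro rfl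
    exact hne (by simpa using hp)
  · intro h; simp at h

theorem diagonal_X {R : Type*} [CommRing R] :
    diagonal R PowerSeries.X = PowerSeries.X := by
  ext n
  rw [coeff_diagonal]
  rcases n with _ | n
  · simp
  · rw [Finset.sum_eq_single (n, 1)]
    · simp [PowerSeries.coeff_X, PowerSeries.coeff_one]
    · rintro ⟨i, j⟩ hp hne
      rw [PowerSeries.coeff_X, if_neg, map_zero]
      rintro rfl
      exact hne (by simpa using hp)
    · intro h; simp at h

/-- The shifts by `[T]` and `-[T]` are inverse to each other. -/
theorem diagonal_map_shiftHom_neg (b : Side) (ε : K) (f : Fn K) :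
    diagonal (Fn K) (PowerSeries.map (shiftHom b ε) (shiftHom b (-ε) f)) = PowerSeries.C f := by
  -- The `T`-derivative of `f(x - ε[T] + ε[T])` vanishes: the two occurrences of `T` contribute
  -- opposite sums of `∂/∂x_l`.
  have key : ∀ n : ℕ, ((n : Fn K) + 1) * PowerSeries.coeff (n + 1)
      (diagonal (Fn K) (PowerSeries.map (shiftHom b ε) (shiftHom b (-ε) f))) = 0 := by
    intro n
    set D : ℕ → Fn K → Fn K := fun a f => PowerSeries.coeff a (shiftHom b ε f) with hD
    have hDs : ∀ (a : ℕ) (s : Finset (ℕ × ℕ)) (g : ℕ × ℕ → Fn K),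
        D a (∑ p ∈ s, g p) = ∑ p ∈ s, D a (g p) := by intro a s g; simp [hD]
    have hDC : ∀ (a : ℕ) (c : K) (g : Fn K), D a (MvPowerSeries.C c * g) =
        MvPowerSeries.C c * D a g := by
      intro a c g; simp [hD, shiftHom_C]
    have hDn : ∀ (a n : ℕ) (g : Fn K), D a (((n : Fn K) + 1) * g) = ((n : Fn K) + 1) * D a g := by
      intro a n g
      have : ((n : Fn K) + 1) = MvPowerSeries.C ((n : K) + 1) := by simp
      rw [this, hDC]
    set E : ℕ → Fn K := fun a => PowerSeries.coeff a (shiftHom b (-ε) f) with hE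
    have h1 : ∀ (a : ℕ) (g : Fn K), ((a : Fn K) + 1) * D (a + 1) g =
        MvPowerSeries.C ε * ∑ p ∈ antidiagonal a,
        MvPowerSeries.pderiv K ((b, p.1.succPNat) : Var) (D p.2 g) :=
      fun a g => isFlow_shiftHom b ε g a
    have h2 : ∀ a c : ℕ, ((c : Fn K) + 1) * D a (E (c + 1)) = -(MvPowerSeries.C ε *
        ∑ p ∈ antidiagonal c,
          MvPowerSeries.pderiv K ((b, p.1.succPNat) : Var) (D a (E p.2))) := by
      intro a c
      rw [← hDn, isFlow_shiftHom b (-ε) f c, hDC, hDs, map_neg, neg_mul]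
      simp only [hD, hE, pderiv_coeff_shiftHom]
    have h3 : PowerSeries.coeff (n + 1)
        (diagonal (Fn K) (PowerSeries.map (shiftHom b ε) (shiftHom b (-ε) f))) =
        ∑ p ∈ antidiagonal (n + 1), D p.1 (E p.2) := by
      rw [coeff_diagonal]; simp [hD, hE]
    rw [h3, Finset.mul_sum]
    -- The total degree `n + 1` splits into the degrees in the two parameters, which is the chain
    -- rule along the diagonal.
    have h4 : ∀ p ∈ antidiagonal (n + 1), ((n : Fn K) + 1) * D p.1 (E p.2) =
        (p.1 : Fn K) * D p.1 (E p.2) + (p.2 : Fn K) * D p.1 (E p.2) := by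
      intro p hp
      rw [← add_mul]
      rw [← Nat.cast_add, mem_antidiagonal.mp hp, Nat.cast_succ]
    rw [Finset.sum_congr rfl h4, Finset.sum_add_distrib, Finset.Nat.sum_antidiagonal_succ,
      Finset.Nat.sum_antidiagonal_succ' (f := fun p => (p.2 : Fn K) * D p.1 (E p.2))]
    simp only [Nat.cast_zero, zero_mul, zero_add, Nat.cast_succ, h1, h2]
    rw [Finset.sum_neg_distrib, ← sub_eq_add_neg, sub_eq_zero, ← Finset.mul_sum, ← Finset.mul_sum]
    congr 1
    simp only [Finset.sum_sigma']
    refine Finset.sum_nbij' (fun x => ⟨(x.2.2, x.2.1 + x.1.2), (x.2.1, x.1.2)⟩)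
      (fun x => ⟨(x.2.1 + x.1.1, x.2.2), (x.2.1, x.1.1)⟩) ?_ ?_ ?_ ?_ ?_
    all_goals
      rintro ⟨⟨i, j⟩, ⟨k, l⟩⟩ h
      simp only [Finset.mem_sigma, mem_antidiagonal] at h ⊢
      try obtain ⟨h1, h2⟩ := h
      try subst h2
      try subst h1
      try simp [add_assoc, add_left_comm]
  ext1 n
  rcases n with _ | n
  · rw [coeff_diagonal]
    simp [-PowerSeries.coeff_zero_eq_constantCoeff, coeff_zero_shiftHom]
  · have h := key n
    have h2 : ((n : Fn K) + 1) ≠ 0 := by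
      have : ((n : Fn K) + 1) = MvPowerSeries.C ((n : K) + 1) := by simp
      rw [this]
      intro h0
      have := congrArg MvPowerSeries.constantCoeff h0
      simp at this
      exact absurd this (by exact_mod_cast n.succ_ne_zero)
    rw [PowerSeries.coeff_C, if_neg n.succ_ne_zero]
    exact (mul_eq_zero.mp h).resolve_left h2

/-- Substituting `x + ε[T]` for `x` in the coefficients of a series in `T`. -/
def shiftSubst (b : Side) (ε : K) : PowerSeries (Fn K) →+* Fn (Laurent K) :=
  transpose.comp ((diagonal (Fn K)).comp (PowerSeries.map (shiftHom b ε)))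

theorem shiftSubst_C (b : Side) (ε : K) (f : Fn K) :
    shiftSubst b ε (PowerSeries.C f) = shiftRingHom b ε f := by
  simp [shiftSubst, shiftRingHom, diagonal_C]

theorem shiftSubst_X (b : Side) (ε : K) :
    shiftSubst b ε PowerSeries.X = MvPowerSeries.C (Laurent.single 1 1) := by
  simp [shiftSubst, diagonal_X, transpose_X]

theorem shiftSubst_shiftHom_neg (b : Side) (ε : K) (f : Fn K) :
    shiftSubst b ε (shiftHom b (-ε) f) = lift f := by
  simp only [shiftSubst, RingHom.comp_apply]
  rw [diagonal_map_shiftHom_neg, transpose_C]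

end

section

open Finset.HasAntidiagonal
open Finset (range)

variable {K : Type} [Field K]

/-! ### Shifted dressing operators -/

/-- A pair of rows of two matrices. -/
abbrev RowPair (K : Type) : Type := (ℤ → Fn K) × (ℤ → Fn K)

/-- The operator `∂/∂x_l` on rows of the wave matrices, where the first wave matrix carries the
exponential factor `e^{ξ(x,Λ)}`. -/
def rowDeriv (b : Side) (l : ℕ+) (m : RowPair K) : RowPair K :=
  (fun j => MvPowerSeries.pderiv K ((b, l) : Var) (m.1 j) + m.1 (j - ((l : ℕ) : ℤ)),
    fun j => MvPowerSeries.pderiv K ((b, l) : Var) (m.2 j))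

theorem rowDeriv_zero (b : Side) (l : ℕ+) : rowDeriv b l (0 : RowPair K) = 0 := by
  ext <;> simp [rowDeriv]

theorem rowDeriv_add (b : Side) (l : ℕ+) (m m' : RowPair K) :
    rowDeriv b l (m + m') = rowDeriv b l m + rowDeriv b l m' := by
  refine Prod.ext (funext fun j => ?_) (funext fun j => ?_)
  · simp only [rowDeriv, Prod.fst_add, Pi.add_apply, map_add]; ring
  · simp only [rowDeriv, Prod.snd_add, Pi.add_apply, map_add]

theorem rowDeriv_smul (b : Side) (l : ℕ+) (f : Fn K) (m : RowPair K) :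
    rowDeriv b l (f • m) =
      MvPowerSeries.pderiv K ((b, l) : Var) f • m + f • rowDeriv b l m := by
  refine Prod.ext (funext fun j => ?_) (funext fun j => ?_)
  · simp only [rowDeriv, Prod.fst_add, Pi.add_apply, Prod.smul_fst, Pi.smul_apply, smul_eq_mul,
      Derivation.leibniz]; ring
  · simp only [rowDeriv, Prod.snd_add, Pi.add_apply, Prod.smul_snd, Pi.smul_apply, smul_eq_mul,
      Derivation.leibniz]; ring

/-- The span of the rows of index at least `i` of a pair of matrices. -/
def rowSpan (P O : Mat K) (i : ℤ) : Submodule (Fn K) (RowPair K) :=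
  Submodule.span (Fn K) (Set.range fun k : ℕ => ((P (i + k), O (i + k)) : RowPair K))

theorem rowSpan_anti (P O : Mat K) (i : ℤ) (k : ℕ) : rowSpan P O (i + k) ≤ rowSpan P O i := by
  refine Submodule.span_mono ?_
  rintro _ ⟨l, rfl⟩
  exact ⟨k + l, by simp [add_assoc]⟩

/-- `rowDeriv` satisfies a Leibniz rule over functions, so stability of the span need only be
checked on the generating rows. -/
theorem rowDeriv_mem_rowSpan {P O : Mat K} {b : Side} {l : ℕ+}
    (h : ∀ i, rowDeriv b l (P i, O i) ∈ rowSpan P O i) {i : ℤ} {m : RowPair K}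
    (hm : m ∈ rowSpan P O i) : rowDeriv b l m ∈ rowSpan P O i := by
  induction hm using Submodule.span_induction with
  | mem x hx =>
    obtain ⟨k, rfl⟩ := hx
    exact rowSpan_anti P O i k (h _)
  | zero => rw [rowDeriv_zero]; exact Submodule.zero_mem _
  | add x y _ _ hx hy => rw [rowDeriv_add]; exact Submodule.add_mem _ hx hy
  | smul f x hx' hx =>
    rw [rowDeriv_smul]
    exact Submodule.add_mem _ (Submodule.smul_mem _ _ hx') (Submodule.smul_mem _ _ hx)

/-- The vanishing condition on the first component alone bounds the rows that occur, and the same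
two coefficients then serve for the second component. -/
theorem eq_of_mem_rowSpan {P O : Mat K} (hP : ∀ i j, i < j → P i j = 0) (hu : ∀ i, IsUnit (P i i))
    {i : ℤ} {m : RowPair K} (hm : m ∈ rowSpan P O i) (h0 : ∀ j, i + 1 < j → m.1 j = 0) :
    ∃ α β : Fn K, (∀ j, m.1 j = α * P i j + β * P (i + 1) j) ∧
      ∀ j, m.2 j = α * O i j + β * O (i + 1) j := by
  obtain ⟨c, hc⟩ := (Finsupp.mem_span_range_iff_exists_finsupp).mp hm
  have h1 : ∀ j, m.1 j = ∑ k ∈ c.support, c k * P (i + k) j := by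
    intro j
    rw [← hc, Finsupp.sum, Prod.fst_sum, Finset.sum_apply]; rfl
  have h2 : ∀ j, m.2 j = ∑ k ∈ c.support, c k * O (i + k) j := by
    intro j
    rw [← hc, Finsupp.sum, Prod.snd_sum, Finset.sum_apply]; rfl
  have hs : c.support ⊆ range 2 := by
    by_contra hne
    obtain ⟨k0, hk0, hk0'⟩ := Finset.not_subset.mp hne
    obtain ⟨k, hk, hmax⟩ := c.support.exists_max_image id ⟨k0, hk0⟩
    have h2k : 2 ≤ k := by
      have := hmax k0 hk0
      simp at hk0' this
      omega
    -- Column `i + k` of `P` meets, among the rows that occur, only the topmost index `k`, through a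
    -- unit diagonal entry; for `k ≥ 2` this entry of `m` is zero.
    have h := h1 (i + k)
    rw [h0 _ (by omega), Finset.sum_eq_single k] at h
    · have := (hu (i + k)).mul_left_eq_zero.mp h.symm
      exact (Finsupp.mem_support_iff.mp hk) this
    · intro l hl hlk
      have := hmax l hl
      simp only [id] at this
      rw [hP _ _ (by omega), mul_zero]
    · intro h; exact absurd hk h
  refine ⟨c 0, c 1, fun j => ?_, fun j => ?_⟩
  · rw [h1, Finset.sum_subset hs (fun k _ hk => by simp [Finsupp.notMem_support_iff.mp hk])]
    simp [Finset.sum_range_succ]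
  · rw [h2, Finset.sum_subset hs (fun k _ hk => by simp [Finsupp.notMem_support_iff.mp hk])]
    simp [Finset.sum_range_succ]

variable [CharZero K]

/-- The coefficients of `σ(P)(1 - TΛ)`, where `σ` is the shift by `-[T]`. -/
def shiftRow (b : Side) (P : ℤ → Fn K) (j : ℤ) : PowerSeries (Fn K) :=
  shiftHom b (-1) (P j) - PowerSeries.X * shiftHom b (-1) (P (j - 1))

/-- This is the flow equation of the shift conjugated by `e^{ξ(x,Λ)}`: `∂/∂x_l` becomes `∂/∂x_l +
Λ^l`, and the shift of the exponential leaves the factor `1 - TΛ`. -/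
theorem coeff_succ_shiftRow (b : Side) (P : ℤ → Fn K) (j : ℤ) (d : ℕ) :
    ((d : Fn K) + 1) * PowerSeries.coeff (d + 1) (shiftRow b P j) =
      -∑ p ∈ antidiagonal d, (MvPowerSeries.pderiv K ((b, p.1.succPNat) : Var)
        (PowerSeries.coeff p.2 (shiftRow b P j)) +
          PowerSeries.coeff p.2 (shiftRow b P (j - (((p.1.succPNat : ℕ+) : ℕ) : ℤ)))) := by
  set D : ℕ → ℤ → Fn K := fun a j => PowerSeries.coeff a (shiftHom b (-1) (P j)) with hD
  have hflow : ∀ (n : ℕ) (j : ℤ), ((n : Fn K) + 1) * D (n + 1) j = -∑ p ∈ antidiagonal n,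
      MvPowerSeries.pderiv K ((b, p.1.succPNat) : Var) (D p.2 j) := by
    intro n j
    have := isFlow_shiftHom b (-1) (P j) n
    rw [map_neg, map_one, neg_one_mul] at this
    exact this
  have hz : ∀ j, PowerSeries.coeff 0 (shiftRow b P j) = D 0 j := by
    intro j
    rw [shiftRow, map_sub, PowerSeries.coeff_zero_X_mul, sub_zero]
  have hs : ∀ n j, PowerSeries.coeff (n + 1) (shiftRow b P j) = D (n + 1) j - D n (j - 1) := by
    intro n j
    rw [shiftRow, map_sub, PowerSeries.coeff_succ_X_mul]
  -- This is `(1 - TΛ) ∑_{l ≥ 1} T^{l-1} Λ^l = Λ`, read off coefficient by coefficient.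
  have htel : ∀ (n : ℕ) (j : ℤ), ∑ p ∈ antidiagonal n, PowerSeries.coeff p.2
      (shiftRow b P (j - (((p.1.succPNat : ℕ+) : ℕ) : ℤ))) = D n (j - 1) := by
    intro n
    induction n with
    | zero => intro j; simp [hz, -PowerSeries.coeff_zero_eq_constantCoeff]
    | succ n ih =>
      intro j
      rw [Finset.Nat.sum_antidiagonal_succ, hs]
      have := ih (j - 1)
      have e : ∀ p ∈ antidiagonal n, PowerSeries.coeff p.2
          (shiftRow b P (j - ((((p.1 + 1).succPNat : ℕ+) : ℕ) : ℤ))) =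
          PowerSeries.coeff p.2 (shiftRow b P (j - 1 - (((p.1.succPNat : ℕ+) : ℕ) : ℤ))) := by
        intro p _
        congr 2
        simp only [Nat.succPNat_coe]
        push_cast; ring
      rw [Finset.sum_congr rfl e, this]
      simp
  rw [Finset.sum_add_distrib, htel, hs, mul_sub, hflow]
  rcases d with _ | d
  · simp [hz, -PowerSeries.coeff_zero_eq_constantCoeff]; ring
  · have e2 := hflow d (j - 1)
    rw [Finset.Nat.sum_antidiagonal_succ', Finset.Nat.sum_antidiagonal_succ']
    simp only [hs, hz, map_sub, Finset.sum_sub_distrib]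
    push_cast
    linear_combination -e2

/-- The flow equation writes coefficient `d + 1`, up to the scalar `-1/(d+1)`, as a sum of
`rowDeriv` of earlier coefficients, and the span is stable under `rowDeriv`. -/
theorem shiftRow_mem_rowSpan {P O : Mat K} {b : Side}
    (h : ∀ l i, rowDeriv b l (P i, O i) ∈ rowSpan P O i) (i : ℤ) (d : ℕ) :
    ((fun j => PowerSeries.coeff d (shiftRow b (P i) j),
      fun j => PowerSeries.coeff d (shiftHom b (-1) (O i j))) : RowPair K) ∈ rowSpan P O i := by
  induction d using Nat.strong_induction_on with
  | _ d ih =>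
    rcases d with _ | d
    · have : ((fun j => PowerSeries.coeff 0 (shiftRow b (P i) j),
          fun j => PowerSeries.coeff 0 (shiftHom b (-1) (O i j))) : RowPair K) = (P i, O i) := by
        refine Prod.ext (funext fun j => ?_) (funext fun j => ?_)
        · simp only [shiftRow, map_sub, PowerSeries.coeff_zero_X_mul, coeff_zero_shiftHom, sub_zero]
        · simp only [coeff_zero_shiftHom]
      rw [this]
      exact Submodule.subset_span ⟨0, by simp⟩
    · have hu : MvPowerSeries.C ((d : K) + 1)⁻¹ * ((d : Fn K) + 1) = 1 := by
        have h1 : ((d : Fn K) + 1) = MvPowerSeries.C ((d : K) + 1) := by simp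
        have h2 : ((d : K) + 1) ≠ 0 := by exact_mod_cast d.succ_ne_zero
        rw [h1, ← map_mul, inv_mul_cancel₀ h2, map_one]
      have key : ((fun j => PowerSeries.coeff (d + 1) (shiftRow b (P i) j),
          fun j => PowerSeries.coeff (d + 1) (shiftHom b (-1) (O i j))) : RowPair K) =
          (-MvPowerSeries.C ((d : K) + 1)⁻¹ : Fn K) • ∑ p ∈ antidiagonal d,
            rowDeriv b p.1.succPNat ((fun j => PowerSeries.coeff p.2 (shiftRow b (P i) j),
              fun j => PowerSeries.coeff p.2 (shiftHom b (-1) (O i j))) : RowPair K) := by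
        refine Prod.ext (funext fun j => ?_) (funext fun j => ?_)
        · rw [Prod.smul_fst, Pi.smul_apply, Prod.fst_sum, Finset.sum_apply, smul_eq_mul]
          have := coeff_succ_shiftRow b (P i) j d
          simp only [rowDeriv]
          linear_combination MvPowerSeries.C ((d : K) + 1)⁻¹ * this -
            hu * PowerSeries.coeff (d + 1) (shiftRow b (P i) j)
        · rw [Prod.smul_snd, Pi.smul_apply, Prod.snd_sum, Finset.sum_apply, smul_eq_mul]
          have := isFlow_shiftHom b (-1) (O i j) d
          rw [map_neg, map_one] at this
          simp only [rowDeriv]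
          linear_combination MvPowerSeries.C ((d : K) + 1)⁻¹ * this -
            hu * PowerSeries.coeff (d + 1) (shiftHom b (-1) (O i j))
      rw [key]
      refine Submodule.smul_mem _ _ (Submodule.sum_mem _ fun p hp => ?_)
      have := mem_antidiagonal.mp hp
      exact rowDeriv_mem_rowSpan (h _) (ih p.2 (by omega))

/-- Multiplication by `1 - TΛ` extends a lower triangular row by one column only, so the shifted row
involves rows `i` and `i + 1` and no others. This two-term relation is the source of all Fay
identities below. -/
theorem exists_shift_rows {P O : Mat K} {b : Side} (hP : ∀ i j, i < j → P i j = 0)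
    (hu : ∀ i, IsUnit (P i i)) (h : ∀ l i, rowDeriv b l (P i, O i) ∈ rowSpan P O i) (i : ℤ) :
    ∃ a c : PowerSeries (Fn K),
      (∀ j, shiftHom b (-1) (P i j) - PowerSeries.X * shiftHom b (-1) (P i (j - 1)) =
        a * PowerSeries.C (P i j) + c * PowerSeries.C (P (i + 1) j)) ∧
      ∀ j, shiftHom b (-1) (O i j) =
        a * PowerSeries.C (O i j) + c * PowerSeries.C (O (i + 1) j) := by
  have h1 : ∀ d, ∃ α β : Fn K, (∀ j, PowerSeries.coeff d (shiftRow b (P i) j) =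
      α * P i j + β * P (i + 1) j) ∧ ∀ j, PowerSeries.coeff d (shiftHom b (-1) (O i j)) =
      α * O i j + β * O (i + 1) j := by
    intro d
    refine eq_of_mem_rowSpan hP hu (shiftRow_mem_rowSpan h i d) fun j hj => ?_
    simp only [shiftRow]
    rw [hP i j (by omega), hP i (j - 1) (by omega)]
    simp
  choose α β h2 h3 using h1
  refine ⟨PowerSeries.mk α, PowerSeries.mk β, fun j => ?_, fun j => ?_⟩
  · ext1 d
    rw [map_add, PowerSeries.coeff_mul_C, PowerSeries.coeff_mul_C, PowerSeries.coeff_mk,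
      PowerSeries.coeff_mk]
    exact h2 d j
  · ext1 d
    rw [map_add, PowerSeries.coeff_mul_C, PowerSeries.coeff_mul_C, PowerSeries.coeff_mk,
      PowerSeries.coeff_mk]
    exact h3 d j

/-! ### Fay identities -/

/-- The difference Fay identities for a family of functions, in the parameters
`T = PowerSeries.C PowerSeries.X` and `U = PowerSeries.X`. -/
structure IsFay (b b' : Side) (g : ℤ → Fn K) : Prop where
  same : ∀ i, (PowerSeries.X - PowerSeries.C PowerSeries.X) *
      PowerSeries.map (shiftHom b (-1)) (shiftHom b (-1) (g i)) *
        PowerSeries.C (PowerSeries.C (g (i + 1))) =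
      PowerSeries.X * PowerSeries.C (shiftHom b (-1) (g (i + 1))) *
        PowerSeries.map PowerSeries.C (shiftHom b (-1) (g i)) -
      PowerSeries.C PowerSeries.X * PowerSeries.C (shiftHom b (-1) (g i)) *
        PowerSeries.map PowerSeries.C (shiftHom b (-1) (g (i + 1)))
  mixed : ∀ i, PowerSeries.map (shiftHom b (-1)) (shiftHom b' (-1) (g (i + 1))) *
        PowerSeries.C (PowerSeries.C (g (i + 1))) =
      PowerSeries.C (shiftHom b (-1) (g (i + 1))) *
        PowerSeries.map PowerSeries.C (shiftHom b' (-1) (g (i + 1))) -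
      PowerSeries.C PowerSeries.X * PowerSeries.X * PowerSeries.C (shiftHom b (-1) (g i)) *
        PowerSeries.map PowerSeries.C (shiftHom b' (-1) (g (i + 1 + 1)))

/-- The two identities are the `P` and `O` components of the two-term row relation, written as
generating series in a second parameter `U`, once `a` and `c` have been eliminated. The auxiliary
`h` is the denominator of the wave functions. -/
theorem isFay_of_rows {P O : Mat K} {b b' : Side} {g h : ℤ → Fn K}
    (hP : ∀ i j, i < j → P i j = 0) (hu : ∀ i, IsUnit (P i i)) (hO : ∀ i j, j < i → O i j = 0)
    (hder : ∀ l i, rowDeriv b l (P i, O i) ∈ rowSpan P O i)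
    (hPg : ∀ i (d : ℕ), P i (i - d) * h i = PowerSeries.coeff d (shiftHom b (-1) (g i)))
    (hOg : ∀ i (d : ℕ), O i (i + d) * h i = PowerSeries.coeff d (shiftHom b' (-1) (g (i + 1)))) :
    IsFay b b' g := by
  choose a c h1 h2 using exists_shift_rows hP hu hder
  set p : ℤ → PowerSeries (Fn K) := fun i => PowerSeries.mk fun d => P i (i - d) with hp
  set o : ℤ → PowerSeries (Fn K) := fun i => PowerSeries.mk fun d => O i (i + d) with ho
  have hpg : ∀ i, p i * PowerSeries.C (h i) = shiftHom b (-1) (g i) := by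
    intro i; ext1 d; rw [PowerSeries.coeff_mul_C, ← hPg, PowerSeries.coeff_mk]
  have hog : ∀ i, o i * PowerSeries.C (h i) = shiftHom b' (-1) (g (i + 1)) := by
    intro i; ext1 d; rw [PowerSeries.coeff_mul_C, ← hOg, PowerSeries.coeff_mk]
  have hP0 : ∀ i, P i i * h i = g i := by
    intro i; have := hPg i 0; rw [coeff_zero_shiftHom] at this; simpa using this
  have hO0 : ∀ i, O i i * h i = g (i + 1) := by
    intro i; have := hOg i 0; rw [coeff_zero_shiftHom] at this; simpa using this
  -- Row `i + 1` of the upper triangular `O` vanishes in column `i`, which isolates `a`.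
  have ha : ∀ i, a i * PowerSeries.C (g (i + 1)) * shiftHom b (-1) (h i) =
      shiftHom b (-1) (g (i + 1)) * PowerSeries.C (h i) := by
    intro i
    have := h2 i i
    rw [hO (i + 1) i (by omega), map_zero, mul_zero, add_zero] at this
    rw [← hO0 i, map_mul, map_mul, this]; ring
  -- Row `i` of the lower triangular `P` vanishes in column `i + 1`, which isolates `c`.
  have hc : ∀ i, c i * PowerSeries.C (g (i + 1)) * shiftHom b (-1) (h i) =
      -(PowerSeries.X * shiftHom b (-1) (g i) * PowerSeries.C (h (i + 1))) := by
    intro i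
    have := h1 i (i + 1)
    rw [hP i (i + 1) (by omega), map_zero, map_zero, mul_zero, zero_add, zero_sub,
      add_sub_cancel_right] at this
    rw [← hP0 i, ← hP0 (i + 1), map_mul, map_mul]
    linear_combination (-PowerSeries.C (h (i + 1)) * shiftHom b (-1) (h i)) * this
  -- Column `j` is paired with `U^{i+1-j}`. The extra power of `U` accommodates column `i + 1` and
  -- turns `1 - TΛ` into `U - T`.
  have hF : ∀ i, (PowerSeries.X - PowerSeries.C PowerSeries.X) *
      PowerSeries.map (shiftHom b (-1)) (p i) =
      PowerSeries.X * PowerSeries.C (a i) * PowerSeries.map PowerSeries.C (p i) +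
        PowerSeries.C (c i) * PowerSeries.map PowerSeries.C (p (i + 1)) := by
    intro i
    ext1 d
    rw [sub_mul, map_sub, map_add, mul_assoc, PowerSeries.coeff_C_mul, PowerSeries.coeff_C_mul]
    rcases d with _ | d
    · rw [PowerSeries.coeff_zero_X_mul, PowerSeries.coeff_zero_X_mul, PowerSeries.coeff_map,
        PowerSeries.coeff_map]
      have := h1 i (i + 1)
      rw [hP i (i + 1) (by omega), map_zero, map_zero, mul_zero, zero_add, zero_sub,
        add_sub_cancel_right] at this
      simpa [hp, -PowerSeries.coeff_zero_eq_constantCoeff] using this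
    · rw [PowerSeries.coeff_succ_X_mul, PowerSeries.coeff_succ_X_mul, PowerSeries.coeff_C_mul]
      simp only [PowerSeries.coeff_map, hp, PowerSeries.coeff_mk]
      have := h1 i (i - d)
      have e1 : i - ((d + 1 : ℕ) : ℤ) = i - d - 1 := by push_cast; ring
      have e2 : i + 1 - ((d + 1 : ℕ) : ℤ) = i - d := by push_cast; ring
      rw [e1, e2, this]
  -- Here column `j` is paired with `U^{j-i}`, so row `i + 1` enters with an additional factor `U`.
  have hM : ∀ i, PowerSeries.map (shiftHom b (-1)) (o i) =
      PowerSeries.C (a i) * PowerSeries.map PowerSeries.C (o i) +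
        PowerSeries.X * PowerSeries.C (c i) * PowerSeries.map PowerSeries.C (o (i + 1)) := by
    intro i
    ext1 d
    rw [map_add, mul_assoc, PowerSeries.coeff_C_mul]
    rcases d with _ | d
    · rw [PowerSeries.coeff_zero_X_mul, PowerSeries.coeff_map, PowerSeries.coeff_map]
      have := h2 i i
      rw [hO (i + 1) i (by omega), map_zero, mul_zero] at this
      simpa [ho, -PowerSeries.coeff_zero_eq_constantCoeff] using this
    · rw [PowerSeries.coeff_succ_X_mul, PowerSeries.coeff_C_mul]
      simp only [PowerSeries.coeff_map, ho, PowerSeries.coeff_mk]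
      have := h2 i (i + ((d + 1 : ℕ) : ℤ))
      have e2 : i + 1 + (d : ℤ) = i + ((d + 1 : ℕ) : ℤ) := by push_cast; ring
      rw [e2, this]
  have hs : ∀ (σ : Fn K →+* PowerSeries (Fn K)) (F : PowerSeries (Fn K)) (f : Fn K),
      PowerSeries.map σ (F * PowerSeries.C f) = PowerSeries.map σ F * PowerSeries.C (σ f) := by
    intro σ F f
    rw [map_mul, PowerSeries.map_C]
  refine ⟨fun i => ?_, fun i => ?_⟩
  · have k1 := hs (shiftHom b (-1)) (p i) (h i)
    have k2 := hs PowerSeries.C (p i) (h i)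
    have k3 := hs PowerSeries.C (p (i + 1)) (h (i + 1))
    rw [hpg] at k1 k2 k3
    have e1 := congrArg (PowerSeries.C (R := PowerSeries (Fn K))) (ha i)
    have e2 := congrArg (PowerSeries.C (R := PowerSeries (Fn K))) (hc i)
    simp only [map_mul, map_neg] at e1 e2
    linear_combination (PowerSeries.X - PowerSeries.C PowerSeries.X) *
        PowerSeries.C (PowerSeries.C (g (i + 1))) * k1 +
      PowerSeries.C (shiftHom b (-1) (h i)) * PowerSeries.C (PowerSeries.C (g (i + 1))) * hF i +
      PowerSeries.X * PowerSeries.map PowerSeries.C (p i) * e1 +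
      PowerSeries.map PowerSeries.C (p (i + 1)) * e2 -
      PowerSeries.X * PowerSeries.C (shiftHom b (-1) (g (i + 1))) * k2 +
      PowerSeries.C PowerSeries.X * PowerSeries.C (shiftHom b (-1) (g i)) * k3
  · have k1 := hs (shiftHom b (-1)) (o i) (h i)
    have k2 := hs PowerSeries.C (o i) (h i)
    have k3 := hs PowerSeries.C (o (i + 1)) (h (i + 1))
    rw [hog] at k1 k2 k3
    have e1 := congrArg (PowerSeries.C (R := PowerSeries (Fn K))) (ha i)
    have e2 := congrArg (PowerSeries.C (R := PowerSeries (Fn K))) (hc i)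
    simp only [map_mul, map_neg] at e1 e2
    linear_combination PowerSeries.C (PowerSeries.C (g (i + 1))) * k1 +
      PowerSeries.C (shiftHom b (-1) (h i)) * PowerSeries.C (PowerSeries.C (g (i + 1))) * hM i +
      PowerSeries.map PowerSeries.C (o i) * e1 +
      PowerSeries.X * PowerSeries.map PowerSeries.C (o (i + 1)) * e2 -
      PowerSeries.C (shiftHom b (-1) (g (i + 1))) * k2 +
      PowerSeries.X * PowerSeries.C PowerSeries.X * PowerSeries.C (shiftHom b (-1) (g i)) * k3

end

section

open Finset.HasAntidiagonal
open Finset (range)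

variable {K : Type} [Field K]

/-! ### Products of triangular matrices -/

theorem coeff_mulMat (A B : Mat K) (i j : ℤ) (m : Var →₀ ℕ) :
    MvPowerSeries.coeff m (mulMat A B i j) = ∑ᶠ k : ℤ, MvPowerSeries.coeff m (A i k * B k j) := rfl

theorem mulMat_eq_sum {A B : Mat K} {i j : ℤ} {s : Finset ℤ}
    (h : ∀ k, k ∉ s → A i k * B k j = 0) : mulMat A B i j = ∑ k ∈ s, A i k * B k j := by
  ext m
  rw [coeff_mulMat, map_sum]
  refine finsum_eq_sum_of_support_subset _ fun k hk => ?_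
  by_contra hks
  refine hk ?_
  change MvPowerSeries.coeff m (A i k * B k j) = 0
  rw [h k hks, map_zero]

/-- The entries `P_{ij}` with `j > i + a` vanish. -/
def LowerBy (a : ℤ) (P : Mat K) : Prop := ∀ i j : ℤ, i + a < j → P i j = 0

theorem LowerBy.mulMat_eq_sum {a b : ℤ} {A B : Mat K} (hA : LowerBy a A) (hB : LowerBy b B)
    {i j : ℤ} {s : Finset ℤ} (hs : Finset.Icc (j - b) (i + a) ⊆ s) :
    mulMat A B i j = ∑ k ∈ s, A i k * B k j := by
  refine TodaLattice.mulMat_eq_sum fun k hk => ?_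
  by_cases h1 : i + a < k
  · rw [hA _ _ h1, zero_mul]
  · rw [hB _ _ (by_contra fun h2 => hk (hs (Finset.mem_Icc.mpr ⟨by omega, by omega⟩))), mul_zero]

theorem LowerBy.mulMat {a b : ℤ} {A B : Mat K} (hA : LowerBy a A) (hB : LowerBy b B) :
    LowerBy (a + b) (mulMat A B) := by
  intro i j hij
  rw [hA.mulMat_eq_sum hB (s := ∅) (by rw [Finset.Icc_eq_empty (by omega)])]
  simp

/-- For matrices bounded above the diagonal, every sum involved can be taken over one finite window
`s`, and associativity becomes an interchange of finite sums. -/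
theorem LowerBy.mulMat_assoc {a b c : ℤ} {A B C : Mat K} (hA : LowerBy a A) (hB : LowerBy b B)
    (hC : LowerBy c C) :
    TodaLattice.mulMat (TodaLattice.mulMat A B) C =
      TodaLattice.mulMat A (TodaLattice.mulMat B C) := by
  ext i j : 2
  set s := Finset.Icc (min (j - c) (j - c - b)) (max (i + a) (i + a + b)) with hs
  have h1 : ∀ l, j - c ≤ l → TodaLattice.mulMat A B i l = ∑ k ∈ s, A i k * B k l := fun l hl =>
    hA.mulMat_eq_sum hB (by intro k hk; simp [hs] at hk ⊢; omega)
  have h2 : ∀ l, l ≤ i + a → TodaLattice.mulMat B C l j = ∑ k ∈ s, B l k * C k j := fun l hl =>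
    hB.mulMat_eq_sum hC (by intro k hk; simp [hs] at hk ⊢; omega)
  rw [(hA.mulMat hB).mulMat_eq_sum hC (s := s) (by intro k hk; simp [hs] at hk ⊢; omega),
    hA.mulMat_eq_sum (hB.mulMat hC) (s := s) (by intro k hk; simp [hs] at hk ⊢; omega)]
  have e1 : ∀ k ∈ s, TodaLattice.mulMat A B i k * C k j = ∑ l ∈ s, A i l * B l k * C k j := by
    intro k _
    by_cases hk : j - c ≤ k
    · rw [h1 k hk, Finset.sum_mul]
    · rw [hC k j (by omega)]; simp
  have e2 : ∀ k ∈ s, A i k * TodaLattice.mulMat B C k j = ∑ l ∈ s, A i k * B k l * C l j := by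
    intro k _
    by_cases hk : k ≤ i + a
    · rw [h2 k hk, Finset.mul_sum]; simp only [mul_assoc]
    · rw [hA i k (by omega)]; simp
  rw [Finset.sum_congr rfl e1, Finset.sum_congr rfl e2, Finset.sum_comm]

theorem lowerBy_shiftMat (k : ℤ) : LowerBy k (shiftMat k : Mat K) := by
  intro i j h
  rw [shiftMat, if_neg (by omega)]

theorem mulMat_shiftMat (P : Mat K) (l i j : ℤ) : mulMat P (shiftMat l) i j = P i (j - l) := by
  rw [mulMat_eq_sum (s := {j - l})]
  · simp [shiftMat]
  · intro k hk
    rw [shiftMat, if_neg, mul_zero]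
    intro h
    exact hk (by rw [Finset.mem_singleton]; omega)

theorem mulMat_one (P : Mat K) : mulMat P 1 = P := by
  have : (1 : Mat K) = shiftMat 0 := by
    ext i j : 2
    rw [shiftMat, Matrix.one_apply]
    by_cases h : i = j
    · subst h; simp
    · rw [if_neg h, if_neg (by omega)]
  ext i j : 2
  rw [this, mulMat_shiftMat, sub_zero]

/-! ### Reflection of indices, and the hierarchy as stability of row spans -/

/-- The matrix `(P_{-i,-j})`. -/
def reflect (P : Mat K) : Mat K := fun i j => P (-i) (-j)

theorem reflect_mulMat (A B : Mat K) : reflect (mulMat A B) = mulMat (reflect A) (reflect B) := by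
  ext i j m
  change ∑ᶠ k : ℤ, MvPowerSeries.coeff m (A (-i) k * B k (-j)) =
    ∑ᶠ k : ℤ, MvPowerSeries.coeff m (A (-i) (-k) * B (-k) (-j))
  exact (finsum_comp_equiv (Equiv.neg ℤ)
    (f := fun k => MvPowerSeries.coeff m (A (-i) k * B k (-j)))).symm

theorem reflect_one : reflect (1 : Mat K) = 1 := by
  ext i j : 2
  simp [reflect, Matrix.one_apply]

theorem reflect_shiftMat (k : ℤ) : reflect (shiftMat k : Mat K) = shiftMat (-k) := by
  ext i j : 2
  simp only [reflect, shiftMat]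
  split_ifs <;> first | rfl | omega

/-- The entries `P_{ik}` with `k < i + t`. -/
def partBelow (t : ℤ) (P : Mat K) : Mat K := fun i k => if k < i + t then P i k else 0

/-- The entries `P_{ik}` with `k ≥ i + t`. -/
def partFrom (t : ℤ) (P : Mat K) : Mat K := fun i k => if i + t ≤ k then P i k else 0

/-- Since `PΛ^l = LP`, adding `PΛ^l` to `∂P = -L_{below} P` leaves `L_{from} P`, while `∂O =
L_{from} O`. Both components are thus multiplied on the left by the same matrix, whose row `i` lives
on columns from `i + t` to `i + l`. The parameter `t` records on which side of the splitting the
diagonal falls. -/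
theorem rowDeriv_mem_of_lax {P Pinv O : Mat K} {b : Side} {l : ℕ+} {t : ℕ}
    (hP : LowerBy 0 P) (hPinv : LowerBy 0 Pinv) (hinv : mulMat Pinv P = 1)
    (hdP : dMat (b, l) P = -mulMat (partBelow t
      (mulMat (mulMat P (shiftMat ((l : ℕ) : ℤ))) Pinv)) P)
    (hdO : dMat (b, l) O = mulMat (partFrom t
      (mulMat (mulMat P (shiftMat ((l : ℕ) : ℤ))) Pinv)) O) (i : ℤ) :
    rowDeriv b l (P i, O i) ∈ rowSpan P O i := by
  set L := mulMat (mulMat P (shiftMat ((l : ℕ) : ℤ))) Pinv with hL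
  have hPs := hP.mulMat (lowerBy_shiftMat (K := K) ((l : ℕ) : ℤ))
  have hLl : LowerBy ((l : ℕ) : ℤ) L := by
    have := hPs.mulMat hPinv
    rwa [zero_add, add_zero] at this
  have hLP : ∀ j, mulMat L P i j = P i (j - ((l : ℕ) : ℤ)) := by
    intro j
    rw [hL, hPs.mulMat_assoc hPinv hP, hinv, mulMat_one, mulMat_shiftMat]
  have hb : LowerBy ((l : ℕ) : ℤ) (partBelow t L) := by
    intro i j hij
    rw [partBelow, hLl i j hij, ite_self]
  have key : rowDeriv b l (P i, O i) =
      ∑ k ∈ Finset.Icc (i + (t : ℤ)) (i + ((l : ℕ) : ℤ)), L i k • ((P k, O k) : RowPair K) := by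
    refine Prod.ext (funext fun j => ?_) (funext fun j => ?_)
    · rw [Prod.fst_sum, Finset.sum_apply]
      set s := Finset.Icc (min j (i + t)) (i + ((l : ℕ) : ℤ)) with hs
      have h1 : MvPowerSeries.pderiv K ((b, l) : Var) (P i j) =
          -∑ k ∈ s, partBelow t L i k * P k j := by
        rw [← hb.mulMat_eq_sum hP (s := s) (by intro k hk; simp [hs] at hk ⊢; omega)]
        exact congrFun (congrFun hdP i) j
      have h2 : P i (j - ((l : ℕ) : ℤ)) = ∑ k ∈ s, L i k * P k j := by
        rw [← hLP, hLl.mulMat_eq_sum hP (s := s) (by intro k hk; simp [hs] at hk ⊢; omega)]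
      change MvPowerSeries.pderiv K ((b, l) : Var) (P i j) + P i (j - ((l : ℕ) : ℤ)) = _
      rw [h1, h2, neg_add_eq_sub, ← Finset.sum_sub_distrib]
      symm
      refine Finset.sum_subset_zero_on_sdiff (by intro k hk; simp [hs] at hk ⊢; omega) ?_ ?_
      · intro k hk
        simp only [hs, Finset.mem_sdiff, Finset.mem_Icc] at hk
        rw [partBelow, if_pos (by omega), sub_self]
      · intro k hk
        simp only [Finset.mem_Icc] at hk
        rw [partBelow, if_neg (by omega), zero_mul, sub_zero]
        rfl
    · rw [Prod.snd_sum, Finset.sum_apply]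
      have h1 : MvPowerSeries.pderiv K ((b, l) : Var) (O i j) =
          mulMat (partFrom t L) O i j := congrFun (congrFun hdO i) j
      change MvPowerSeries.pderiv K ((b, l) : Var) (O i j) = _
      rw [h1, mulMat_eq_sum (s := Finset.Icc (i + (t : ℤ)) (i + ((l : ℕ) : ℤ)))]
      · refine Finset.sum_congr rfl fun k hk => ?_
        rw [partFrom, if_pos (Finset.mem_Icc.mp hk).1]
        rfl
      · intro k hk
        rw [partFrom]
        split_ifs with h
        · rw [hLl i k (by by_contra h'; exact hk (Finset.mem_Icc.mpr ⟨h, by omega⟩)), zero_mul]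
        · rw [zero_mul]
  rw [key]
  refine Submodule.sum_mem _ fun k hk => Submodule.smul_mem _ _ ?_
  rw [Finset.mem_Icc] at hk
  refine Submodule.subset_span ⟨(k - i).toNat, ?_⟩
  have h : i + ((k - i).toNat : ℤ) = k := by omega
  change ((P (i + ((k - i).toNat : ℤ)), O (i + ((k - i).toNat : ℤ))) : RowPair K) = (P k, O k)
  rw [h]

namespace Solution

variable (D : Solution)

theorem lowerPart_zero : lowerPart (0 : Mat K) = 0 := by
  ext i j : 2; simp [lowerPart]

theorem upperPart_zero : upperPart (0 : Mat K) = 0 := by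
  ext i j : 2; simp [upperPart]

theorem mulMat_neg (A B : Mat K) : mulMat (-A) B = -mulMat A B := by
  ext i j m
  rw [coeff_mulMat]
  change _ = -(MvPowerSeries.coeff m (mulMat A B i j))
  rw [coeff_mulMat, ← finsum_neg_distrib]
  exact finsum_congr fun k => by rw [← map_neg, ← neg_mul]; rfl

theorem rowDeriv_mem_x (l : ℕ+) (i : ℤ) :
    rowDeriv Side.x l (D.S₁ i, D.S₂ i) ∈ rowSpan D.S₁ D.S₂ i := by
  refine rowDeriv_mem_of_lax (t := 0) (Pinv := D.S₁inv)
    (fun i j h => D.S₁_lower i j (by omega)) (fun i j h => D.S₁inv_lower i j (by omega))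
    D.S₁_inv_mul ?_ ?_ i
  · rw [D.deriv_x₁, minusPart, lowerPart_zero, sub_zero]
    congr 2
    ext i j : 2
    simp [partBelow, lowerPart]
  · rw [D.deriv_x₂, minusPart, upperPart_zero, zero_sub, mulMat_neg, neg_neg]
    congr 2
    ext i j : 2
    simp [partFrom, upperPart]

/-- Reflection makes `S₂` lower triangular and turns `Λ^{-l}` into `Λ^l`. The diagonal of `L₂^l`
belongs to the upper part, which becomes the part below, whence `t = 1` instead of `0`. -/
theorem rowDeriv_mem_y (l : ℕ+) (i : ℤ) :
    rowDeriv Side.y l (reflect D.S₂ i, reflect D.S₁ i) ∈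
      rowSpan (reflect D.S₂) (reflect D.S₁) i := by
  have hL : mulMat (mulMat (reflect D.S₂) (shiftMat ((l : ℕ) : ℤ))) (reflect D.S₂inv) =
      reflect (mulMat (mulMat D.S₂ (shiftMat (-((l : ℕ) : ℤ)))) D.S₂inv) := by
    rw [reflect_mulMat, reflect_mulMat, reflect_shiftMat, neg_neg]
  refine rowDeriv_mem_of_lax (P := reflect D.S₂) (O := reflect D.S₁) (t := 1)
    (Pinv := reflect D.S₂inv)
    (fun i j h => D.S₂_upper _ _ (by omega)) (fun i j h => D.S₂inv_upper _ _ (by omega))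
    (by rw [← reflect_mulMat, D.S₂_inv_mul, reflect_one]) ?_ ?_ i
  · have h := congrArg reflect (D.deriv_y₂ l)
    simp only [minusPart] at h
    rw [upperPart_zero, sub_zero] at h
    rw [hL]
    refine h.trans ?_
    change -reflect (mulMat _ _) = _
    rw [reflect_mulMat]
    congr 2
    ext i j : 2
    simp only [partBelow, upperPart, reflect]
    split_ifs <;> first | rfl | (push_cast at *; omega)
  · have h := congrArg reflect (D.deriv_y₁ l)
    simp only [minusPart] at h
    rw [lowerPart_zero, zero_sub, mulMat_neg, neg_neg, reflect_mulMat] at h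
    rw [hL]
    refine h.trans ?_
    congr 1
    ext i j : 2
    simp only [partFrom, lowerPart, reflect]
    split_ifs <;> first | rfl | (push_cast at *; omega)

end Solution

end

section

open Finset.HasAntidiagonal
open Finset (range)

variable {K : Type} [Field K]

/-! ### Exponentials -/

/-- The weight of a monomial, where `x_l` and `y_l` have weight `l`. -/
def wtVar (m : Var →₀ ℕ) : ℕ := m.sum fun v a => (v.2 : ℕ) * a

theorem wtVar_add (m m' : Var →₀ ℕ) : wtVar (m + m') = wtVar m + wtVar m' :=
  Finsupp.sum_add_index' (by simp) (by intros; ring)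

theorem wtVar_zero : wtVar 0 = 0 := rfl

/-- The coefficients of `e^{ε ∑_l x_l}`. -/
def expCoeff (b : Side) (ε : K) (m : Var →₀ ℕ) : K :=
  m.prod fun v a => (if v.1 = b then ε else 0) ^ a / (a.factorial : K)

theorem Laurent.single_pow (k : ℤ) (a : K) (n : ℕ) :
    (Laurent.single k a) ^ n = Laurent.single (k * n) (a ^ n) := by
  induction n with
  | zero => simp [Laurent.single_zero_one]
  | succ n ih => rw [pow_succ, ih, Laurent.single_mul_single, pow_succ]; congr 1; push_cast; ring

theorem Laurent.single_zero_right (k : ℤ) : (Laurent.single k 0 : Laurent K) = 0 :=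
  Laurent.ext fun d => by rw [Laurent.coeff_single]; simp

theorem Laurent.single_div_natCast (k : ℤ) (a : K) (n : ℕ) :
    Laurent.single k a / (n : Laurent K) = Laurent.single k (a / (n : K)) := by
  rw [div_eq_mul_inv, div_eq_mul_inv, ← map_natCast (Laurent.const (K := K)), ← map_inv₀,
    Laurent.const_eq_single, Laurent.single_mul_single, add_zero]

theorem Laurent.prod_single {ι : Type*} (s : Finset ι) (k : ι → ℤ) (a : ι → K) :
    ∏ i ∈ s, Laurent.single (k i) (a i) = Laurent.single (∑ i ∈ s, k i) (∏ i ∈ s, a i) := by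
  classical
  induction s using Finset.induction_on with
  | empty => simp [Laurent.single_zero_one]
  | insert i s hi ih =>
    rw [Finset.prod_insert hi, Finset.sum_insert hi, Finset.prod_insert hi, ih,
      Laurent.single_mul_single]

theorem coeff_expLin (u : Var → K) (m : Var →₀ ℕ) :
    MvPowerSeries.coeff m (expLin u) = m.prod fun v a => u v ^ a / (a.factorial : K) := rfl

/-- Weighted homogeneity: a monomial of weight `w` occurs with the single power `T^{sw}`. -/
theorem coeff_expXi (b : Side) (ε : K) (s : ℤ) (m : Var →₀ ℕ) :
    MvPowerSeries.coeff m (expXi b ε s) = Laurent.single (s * wtVar m) (expCoeff b ε m) := by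
  rw [expXi, coeff_expLin, Finsupp.prod, wtVar, expCoeff, Finsupp.sum, Finsupp.prod,
    Nat.cast_sum, Finset.mul_sum, ← Laurent.prod_single]
  refine Finset.prod_congr rfl fun v hv => ?_
  rw [← Laurent.single_div_natCast]
  congr 1
  split_ifs with h
  · rw [Laurent.single_pow]; congr 1; push_cast; ring
  · rw [zero_pow (Finsupp.mem_support_iff.mp hv), zero_pow (Finsupp.mem_support_iff.mp hv),
      Laurent.single_zero_right]

theorem pderiv_expLin [CharZero K] (u : Var → K) (v : Var) :
    MvPowerSeries.pderiv K v (expLin u) = MvPowerSeries.C (u v) * expLin u := by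
  classical
  ext m
  rw [MvPowerSeries.coeff_pderiv, MvPowerSeries.coeff_C_mul, coeff_expLin, coeff_expLin]
  set s := insert v m.support
  have hv : v ∈ s := Finset.mem_insert_self _ _
  have h1 : (m + Finsupp.single v 1).support ⊆ s := by
    refine Finsupp.support_add.trans ?_
    intro k hk
    rcases Finset.mem_union.mp hk with h | h
    · exact Finset.mem_insert_of_mem h
    · rw [Finset.mem_singleton.mp (Finsupp.support_single_subset h)]; exact hv
  rw [Finsupp.prod_of_support_subset _ h1 _ (by simp),
    Finsupp.prod_of_support_subset _ (Finset.subset_insert v _) _ (by simp),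
    ← Finset.mul_prod_erase s _ hv, ← Finset.mul_prod_erase s _ hv]
  have h3 : ∀ k ∈ s.erase v, u k ^ (m + Finsupp.single v 1 : Var →₀ ℕ) k /
      (((m + Finsupp.single v 1 : Var →₀ ℕ) k).factorial : K) =
      u k ^ m k / ((m k).factorial : K) := by
    intro k hk
    have hkv : k ≠ v := Finset.ne_of_mem_erase hk
    simp [hkv.symm]
  rw [Finset.prod_congr rfl h3]
  have hf : ((m v).factorial : K) ≠ 0 := by exact_mod_cast (m v).factorial_ne_zero
  have hm : ((m v : K) + 1) ≠ 0 := by exact_mod_cast (m v).succ_ne_zero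
  simp only [Finsupp.add_apply, Finsupp.single_eq_same, Nat.factorial_succ]
  push_cast
  field_simp
  ring

theorem constantCoeff_expLin (u : Var → K) :
    MvPowerSeries.constantCoeff (expLin u) = 1 := by
  rw [← MvPowerSeries.coeff_zero_eq_constantCoeff_apply, coeff_expLin, Finsupp.prod_zero_index]

theorem expLin_mul_expLin_neg [CharZero K] (u : Var → K) : expLin u * expLin (-u) = 1 := by
  refine MvPowerSeries.pderiv.ext (fun v => ?_) ?_
  · rw [Derivation.leibniz, pderiv_expLin, pderiv_expLin]
    simp only [smul_eq_mul, Pi.neg_apply, map_neg, Derivation.map_one_eq_zero]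
    ring
  · rw [map_mul, constantCoeff_expLin, constantCoeff_expLin, map_one, mul_one]

theorem Laurent.neg_single (k : ℤ) (a : K) : -Laurent.single k a = Laurent.single k (-a) := by
  refine eq_comm.mp (eq_neg_of_add_eq_zero_left (Laurent.ext fun d => ?_))
  rw [Laurent.coeff_add, Laurent.coeff_single, Laurent.coeff_single]
  split_ifs <;> simp

theorem expXi_mul_neg [CharZero K] (b : Side) (ε : K) (s : ℤ) :
    expXi b ε s * expXi b (-ε) s = 1 := by
  rw [expXi, expXi, ← expLin_mul_expLin_neg]
  congr 2
  ext v
  simp only [Pi.neg_apply]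
  split_ifs
  · rw [Laurent.neg_single]
  · rw [neg_zero]

/-! ### Wave functions and their amplitudes -/

theorem seriesPos_eq {w : ℤ → Fn K} {F : Fn (Laurent K)}
    (h : ∀ m d, (MvPowerSeries.coeff m F).coeff d = MvPowerSeries.coeff m (w d)) :
    seriesPos w = F := by
  ext m
  change laurent _ = _
  rw [← Laurent.laurent_coeff (MvPowerSeries.coeff m F)]
  congr 1
  exact funext fun d => (h m d).symm

theorem seriesNeg_eq_seriesPos (w : ℤ → Fn K) : seriesNeg w = seriesPos fun k => w (-k) := rfl

theorem coeff_coeff_transpose (F : PowerSeries (Fn K)) (m : Var →₀ ℕ) {a : ℤ → Fn K}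
    (ha : ∀ e < 0, a e = 0) (haF : ∀ d : ℕ, PowerSeries.coeff d F = a d) (d : ℤ) :
    (MvPowerSeries.coeff m (transpose F)).coeff d = MvPowerSeries.coeff m (a d) := by
  rw [coeff_transpose]
  rcases lt_or_ge d 0 with h | h
  · rw [Laurent.coeff_ofPowerSeries_of_neg _ h, ha d h, map_zero]
  · lift d to ℕ using h
    rw [Laurent.coeff_ofPowerSeries_natCast, PowerSeries.coeff_mk, haF]

/-- The common core of the four factorizations of wave functions into power of `T`, amplitude and
exponential. In `hw` a monomial of weight `w` of the exponential moves the index by `w`, which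
matches its factor `T^{-w}`. -/
theorem seriesPos_eq_transpose_mul_expXi {a w : ℤ → Fn K} {b : Side} {ε : K}
    (ha : ∀ e < 0, a e = 0)
    (hw : ∀ t m, MvPowerSeries.coeff m (w t) = ∑ p ∈ antidiagonal m,
      MvPowerSeries.coeff p.1 (a (t + wtVar p.2)) * expCoeff b ε p.2) (c : ℤ) :
    seriesPos (fun k => w (k - c)) = MvPowerSeries.C (Laurent.single c 1) *
      (transpose (PowerSeries.mk fun d => a d) * expXi b ε (-1)) := by
  classical
  refine seriesPos_eq fun m d => ?_
  rw [MvPowerSeries.coeff_C_mul, Laurent.coeff_single_mul, one_mul, hw, MvPowerSeries.coeff_mul,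
    Laurent.coeff_sum]
  refine Finset.sum_congr rfl fun p _ => ?_
  rw [coeff_expXi, mul_comm, Laurent.coeff_single_mul,
    coeff_coeff_transpose _ _ ha (fun d => PowerSeries.coeff_mk _ _), mul_comm]
  congr 3
  ring

theorem expMat_apply (b : Side) (ε : K) (s i j : ℤ) (m : Var →₀ ℕ) :
    MvPowerSeries.coeff m (expMat b ε s i j) =
      if j - i = s * wtVar m then expCoeff b ε m else 0 := by
  change (MvPowerSeries.coeff m (expXi b ε s)).coeff (j - i) = _
  rw [coeff_expXi, Laurent.coeff_single]

theorem coeff_mulMat_expMat (P : Mat K) (b : Side) (ε : K) (s i j : ℤ) (m : Var →₀ ℕ) :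
    MvPowerSeries.coeff m (mulMat P (expMat b ε s) i j) = ∑ p ∈ antidiagonal m,
      MvPowerSeries.coeff p.1 (P i (j - s * wtVar p.2)) * expCoeff b ε p.2 := by
  classical
  rw [coeff_mulMat]
  simp only [MvPowerSeries.coeff_mul, expMat_apply]
  have hz : ∀ p : (Var →₀ ℕ) × (Var →₀ ℕ), ∀ k, k ≠ j - s * wtVar p.2 →
      MvPowerSeries.coeff p.1 (P i k) *
        (if j - k = s * wtVar p.2 then expCoeff b ε p.2 else 0) = 0 := by
    intro p k hk
    rw [if_neg (by intro h; exact hk (by rw [← h]; ring)), mul_zero]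
  rw [finsum_sum_comm]
  · refine Finset.sum_congr rfl fun p _ => ?_
    rw [finsum_eq_single _ (j - s * wtVar p.2) (hz p), if_pos (by ring)]
  · intro p _
    refine (Set.finite_singleton (j - s * (wtVar p.2 : ℤ))).subset fun k hk => ?_
    by_contra hne
    exact hk (hz p k hne)

theorem coeff_expMat_mulMat (P : Mat K) (b : Side) (ε : K) (s i j : ℤ) (m : Var →₀ ℕ) :
    MvPowerSeries.coeff m (mulMat (expMat b ε s) P i j) = ∑ p ∈ antidiagonal m,
      MvPowerSeries.coeff p.1 (P (i + s * wtVar p.2) j) * expCoeff b ε p.2 := by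
  classical
  rw [coeff_mulMat]
  simp only [mul_comm (expMat b ε s i _), MvPowerSeries.coeff_mul, expMat_apply]
  have hz : ∀ p : (Var →₀ ℕ) × (Var →₀ ℕ), ∀ k, k ≠ i + s * wtVar p.2 →
      MvPowerSeries.coeff p.1 (P k j) *
        (if k - i = s * wtVar p.2 then expCoeff b ε p.2 else 0) = 0 := by
    intro p k hk
    rw [if_neg (by intro h; exact hk (by rw [← h]; ring)), mul_zero]
  rw [finsum_sum_comm]
  · refine Finset.sum_congr rfl fun p _ => ?_
    rw [finsum_eq_single _ (i + s * wtVar p.2) (hz p), if_pos (by ring)]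
  · intro p _
    refine (Set.finite_singleton (i + s * (wtVar p.2 : ℤ))).subset fun k hk => ?_
    by_contra hne
    exact hk (hz p k hne)

theorem const_expCoeff (b : Side) (ε : K) (m : Var →₀ ℕ) :
    Laurent.const (expCoeff b ε m) = expCoeff b (Laurent.const ε) m := by
  rw [expCoeff, expCoeff, map_finsuppProd]
  refine Finsupp.prod_congr fun v _ => ?_
  rw [map_div₀, map_pow, map_natCast]
  split_ifs <;> simp

theorem liftMat_mulMat_expMat (P : Mat K) (b : Side) (ε : K) (s : ℤ) :
    liftMat (mulMat P (expMat b ε s)) = mulMat (liftMat P) (expMat b (Laurent.const ε) s) := by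
  ext i j m
  change MvPowerSeries.coeff m (lift _) = _
  rw [coeff_lift, coeff_mulMat_expMat, coeff_mulMat_expMat, map_sum]
  refine Finset.sum_congr rfl fun p _ => ?_
  rw [map_mul, const_expCoeff, ← coeff_lift]
  rfl

theorem liftMat_expMat_mulMat (P : Mat K) (b : Side) (ε : K) (s : ℤ) :
    liftMat (mulMat (expMat b ε s) P) = mulMat (expMat b (Laurent.const ε) s) (liftMat P) := by
  ext i j m
  change MvPowerSeries.coeff m (lift _) = _
  rw [coeff_lift, coeff_expMat_mulMat, coeff_expMat_mulMat, map_sum]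
  refine Finset.sum_congr rfl fun p _ => ?_
  rw [map_mul, const_expCoeff, ← coeff_lift]
  rfl

theorem psi₁_mulMat_expMat {P : Mat K} (hP : ∀ i j, i < j → P i j = 0) (b : Side) (ε : K) (n : ℤ) :
    psi₁ (mulMat P (expMat b ε 1)) n = MvPowerSeries.C (Laurent.single (-n) 1) *
      (transpose (PowerSeries.mk fun d => P n (n - d)) * expXi b ε (-1)) := by
  rw [psi₁, seriesNeg_eq_seriesPos]
  rw [← seriesPos_eq_transpose_mul_expXi (a := fun e => P n (n - e))
    (w := fun t => mulMat P (expMat b ε 1) n (n - t)) (fun e he => hP _ _ (by omega))]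
  · congr 1
    exact funext fun k => by congr 1; ring
  · intro t m
    rw [coeff_mulMat_expMat]
    refine Finset.sum_congr rfl fun p _ => ?_
    congr 3; ring

theorem psi₂_mulMat_expMat {P : Mat K} (hP : ∀ i j, j < i → P i j = 0) (b : Side) (ε : K) (n : ℤ) :
    psi₂ (mulMat P (expMat b ε (-1))) n = MvPowerSeries.C (Laurent.single n 1) *
      (transpose (PowerSeries.mk fun d => P n (n + d)) * expXi b ε (-1)) := by
  rw [psi₂]
  rw [← seriesPos_eq_transpose_mul_expXi (a := fun e => P n (n + e))
    (w := fun t => mulMat P (expMat b ε (-1)) n (n + t)) (fun e he => hP _ _ (by omega))]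
  · congr 1
    exact funext fun k => by congr 1; ring
  · intro t m
    rw [coeff_mulMat_expMat]
    refine Finset.sum_congr rfl fun p _ => ?_
    congr 3; ring

theorem psi₁Star_expMat_mulMat {P : Mat K} (hP : ∀ i j, i < j → P i j = 0) (b : Side) (ε : K)
    (n : ℤ) :
    psi₁Star (mulMat (expMat b ε 1) P) n = MvPowerSeries.C (Laurent.single n 1) *
      (transpose (PowerSeries.mk fun d => P (n + d) n) * expXi b ε (-1)) := by
  rw [psi₁Star]
  rw [← seriesPos_eq_transpose_mul_expXi (a := fun e => P (n + e) n)
    (w := fun t => mulMat (expMat b ε 1) P (n + t) n) (fun e he => hP _ _ (by omega))]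
  · congr 1
    exact funext fun k => by congr 1; ring
  · intro t m
    rw [coeff_expMat_mulMat]
    refine Finset.sum_congr rfl fun p _ => ?_
    congr 3; ring

theorem psi₂Star_expMat_mulMat {P : Mat K} (hP : ∀ i j, j < i → P i j = 0) (b : Side) (ε : K)
    (n : ℤ) :
    psi₂Star (mulMat (expMat b ε (-1)) P) n = MvPowerSeries.C (Laurent.single (-n) 1) *
      (transpose (PowerSeries.mk fun d => P (n - d) n) * expXi b ε (-1)) := by
  rw [psi₂Star, seriesNeg_eq_seriesPos]
  rw [← seriesPos_eq_transpose_mul_expXi (a := fun e => P (n - e) n)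
    (w := fun t => mulMat (expMat b ε (-1)) P (n - t) n) (fun e he => hP _ _ (by omega))]
  · congr 1
    exact funext fun k => by congr 1; ring
  · intro t m
    rw [coeff_expMat_mulMat]
    refine Finset.sum_congr rfl fun p _ => ?_
    congr 3; ring

end

section

open Finset.HasAntidiagonal
open Finset (range)

variable {K : Type} [Field K]

/-! ### Shifts of exponentials -/

/-- The function `E` is an exponential `e^{κ ∑_l c^l x_l}` up to a factor independent of
the `x_l`. -/
def IsExp (b : Side) (κ c : K) (E : Fn K) : Prop :=
  ∀ l : ℕ+, MvPowerSeries.pderiv K ((b, l) : Var) E = MvPowerSeries.C (κ * c ^ (l : ℕ)) * E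

theorem IsExp.lift {b : Side} {κ c : K} {E : Fn K} (h : IsExp b κ c E) :
    IsExp b (Laurent.const κ) (Laurent.const c) (TodaLattice.lift E) := by
  intro l
  rw [← isDHom_lift, h l, map_mul, lift_C, map_mul, map_pow]

theorem pderiv_lift_eq_zero {v : Var} {E : Fn K} (hE : MvPowerSeries.pderiv K v E = 0) :
    MvPowerSeries.pderiv (Laurent K) v (lift E) = 0 := by
  rw [← isDHom_lift, hE, map_zero]

section Exponentials

variable [CharZero K]

theorem shiftHom_of_pderiv_eq_zero (b : Side) (ε : K) {E : Fn K}
    (hE : ∀ l : ℕ+, MvPowerSeries.pderiv K ((b, l) : Var) E = 0) :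
    shiftHom b ε E = PowerSeries.C E := by
  refine IsFlow.eq (isFlow_shiftHom _ _ _) (b := b) (ε := ε) ?_ ?_
  · intro d
    simp only [PowerSeries.coeff_C]
    rw [Finset.sum_eq_zero]
    · simp
    · intro p _
      split_ifs <;> simp [hE]
  · rw [coeff_zero_shiftHom, PowerSeries.coeff_zero_C]

/-- The shift multiplies `E` by `exp(-∑ c^l T^l / l) = 1 - cT`. Instead of summing the logarithm,
the right-hand side is checked to satisfy the flow equation. -/
theorem shiftHom_of_isExp (b : Side) {ε κ : K} (hεκ : ε * κ = -1) (c : K) {E : Fn K}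
    (hE : IsExp b κ c E) :
    shiftHom b ε E = PowerSeries.C E *
      (1 - PowerSeries.C (MvPowerSeries.C c) * PowerSeries.X) := by
  have h0 : ∀ d, PowerSeries.coeff d (PowerSeries.C E *
      (1 - PowerSeries.C (MvPowerSeries.C c) * PowerSeries.X)) =
      if d = 0 then E else if d = 1 then -(MvPowerSeries.C c * E) else 0 := by
    intro d
    rw [PowerSeries.coeff_C_mul, map_sub, PowerSeries.coeff_one, PowerSeries.coeff_C_mul,
      PowerSeries.coeff_X]
    rcases d with _ | _ | d <;> simp [mul_comm]
  refine IsFlow.eq (isFlow_shiftHom _ _ _) (b := b) (ε := ε) ?_ ?_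
  · have hC : MvPowerSeries.C ε * MvPowerSeries.C κ = (-1 : Fn K) := by
      rw [← map_mul, hεκ, map_neg, map_one]
    intro d
    simp only [h0]
    rcases d with _ | d
    · simp [hE _]
      linear_combination (-MvPowerSeries.C c * E) * hC
    · rw [Finset.Nat.sum_antidiagonal_succ']
      rcases d with _ | d
      · simp
        right
        rw [hE _, hE _]
        simp only [Nat.succPNat_coe, map_mul, map_pow, Nat.succ_eq_add_one]
        ring
      · rw [Finset.Nat.sum_antidiagonal_succ', Finset.sum_eq_zero]
        · simp
          right
          rw [hE _, hE _]
          simp only [Nat.succPNat_coe, map_mul, map_pow, Nat.succ_eq_add_one]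
          ring
        · intro p _
          simp
  · rw [coeff_zero_shiftHom, h0, if_pos rfl]

theorem pderiv_expXi_of_ne {b b' : Side} (h : b ≠ b') (ε : K) (s : ℤ) (l : ℕ+) :
    MvPowerSeries.pderiv (Laurent K) ((b', l) : Var) (expXi b ε s) = 0 := by
  rw [expXi, pderiv_expLin, if_neg (fun h' => h h'.symm), map_zero, zero_mul]

theorem isExp_expXi (b : Side) (ε : K) :
    IsExp b (Laurent.const ε) (Laurent.single (-1) 1) (expXi b ε (-1)) := by
  intro l
  rw [expXi, pderiv_expLin, if_pos rfl, Laurent.single_pow, Laurent.const_eq_single,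
    Laurent.single_mul_single, zero_add, one_pow, mul_one]

theorem shiftRingHom_of_pderiv_eq_zero (b : Side) (ε : K) {E : Fn K}
    (hE : ∀ l : ℕ+, MvPowerSeries.pderiv K ((b, l) : Var) E = 0) :
    shiftRingHom b ε E = lift E := by
  change transpose (shiftHom b ε _) = _
  rw [shiftHom_of_pderiv_eq_zero _ _ hE, transpose_C]

/-- `1 - c T` as a scalar. -/
def oneSub (c : K) : Laurent K := 1 - Laurent.const c * Laurent.single 1 1

theorem shiftRingHom_of_isExp (b : Side) {ε κ : K} (h : ε * κ = -1) {c : K} {E : Fn K}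
    (hE : IsExp b κ c E) :
    shiftRingHom b ε E = lift E * MvPowerSeries.C (oneSub c) := by
  change transpose (shiftHom b ε _) = _
  rw [shiftHom_of_isExp b h c hE, map_mul, map_sub, map_mul, map_one,
    transpose_C, transpose_C, transpose_X, lift_C, oneSub, map_sub, map_one, map_mul]

/-- With the opposite sign the factor would be `1/(1 - cT)`. It is obtained by applying the previous
lemma to the inverse exponential. -/
theorem shiftRingHom_expXi_self (b : Side) {ε : K} {ε' : Laurent K}
    (h : ε' * Laurent.const ε = 1) :
    shiftRingHom b ε' (expXi b ε (-1)) * MvPowerSeries.C (oneSub (Laurent.single (-1) 1)) =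
      lift (expXi b ε (-1)) := by
  have h1 := congrArg (shiftRingHom b ε') (expXi_mul_neg b ε (-1))
  have h2 := congrArg lift (expXi_mul_neg b ε (-1))
  rw [map_mul, map_one, shiftRingHom_of_isExp b (by rw [map_neg, mul_neg, h])
    (isExp_expXi b (-ε))] at h1
  rw [map_mul, map_one] at h2
  linear_combination lift (expXi b ε (-1)) * h1 - shiftRingHom b ε' (expXi b ε (-1)) *
    MvPowerSeries.C (oneSub (Laurent.single (-1) 1)) * h2

end Exponentials

/-! ### Telescoping sums -/

/-- The coefficient of each monomial of weight `w` is a Laurent series of order at least `c - w`. -/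
def OrdGe (c : ℤ) (F : Fn (Laurent K)) : Prop :=
  ∀ m d, d < c - wtVar m → (MvPowerSeries.coeff m F).coeff d = 0

theorem OrdGe.mul {c c' : ℤ} {F G : Fn (Laurent K)} (hF : OrdGe c F) (hG : OrdGe c' G) :
    OrdGe (c + c') (F * G) := by
  classical
  intro m d hd
  rw [MvPowerSeries.coeff_mul, Laurent.coeff_sum]
  refine Finset.sum_eq_zero fun p hp => ?_
  have hw := wtVar_add p.1 p.2
  rw [mem_antidiagonal.mp hp] at hw
  exact Laurent.coeff_mul_of_lt (hF p.1) (hG p.2) (by rw [hw] at hd; push_cast at hd; linarith)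

theorem ordGe_C_single (k : ℤ) (a : K) : OrdGe k (MvPowerSeries.C (Laurent.single k a)) := by
  classical
  intro m d hd
  rw [MvPowerSeries.coeff_C]
  split_ifs with h
  · rw [Laurent.coeff_single, if_neg (by subst h; rw [wtVar_zero] at hd; push_cast at hd; omega)]
  · rfl

theorem ordGe_transpose (F : PowerSeries (Fn K)) : OrdGe 0 (transpose F) := by
  intro m d hd
  rw [coeff_transpose, Laurent.coeff_ofPowerSeries_of_neg _ (by omega)]

theorem ordGe_lift (f : Fn K) : OrdGe 0 (lift f) := by
  rw [← transpose_C]; exact ordGe_transpose _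

theorem ordGe_shiftRingHom [CharZero K] (b : Side) (ε : K) (f : Fn K) :
    OrdGe 0 (shiftRingHom b ε f) := ordGe_transpose _

theorem ordGe_expXi (b : Side) (ε : K) : OrdGe 0 (expXi b ε (-1)) := by
  intro m d hd
  rw [coeff_expXi, Laurent.coeff_single, if_neg (by omega)]

theorem oneSub_eq_ofPowerSeries (c : K) :
    oneSub c = Laurent.ofPowerSeries (1 - PowerSeries.C c * PowerSeries.X) := by
  rw [oneSub, map_sub, map_one, map_mul, Laurent.ofPowerSeries_C, Laurent.ofPowerSeries_X]

theorem oneSub_mul_inv (c : K) :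
    oneSub c * Laurent.ofPowerSeries (1 - PowerSeries.C c * PowerSeries.X)⁻¹ = 1 := by
  rw [oneSub_eq_ofPowerSeries, ← map_mul, PowerSeries.mul_inv_cancel _ (by simp), map_one]

theorem oneSub_ne_zero (c : K) : oneSub c ≠ 0 := by
  intro h
  have := oneSub_mul_inv c
  rw [h, zero_mul] at this
  exact zero_ne_one this

theorem transpose_map_C (p : PowerSeries K) :
    transpose (PowerSeries.map MvPowerSeries.C p) = MvPowerSeries.C (Laurent.ofPowerSeries p) := by
  classical
  ext m
  rw [coeff_transpose, MvPowerSeries.coeff_C, ← map_zero (Laurent.ofPowerSeries (K := K)),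
    ← apply_ite]
  congr 1
  ext d
  rw [PowerSeries.coeff_mk, PowerSeries.coeff_map, MvPowerSeries.coeff_C]
  split_ifs <;> simp

theorem ordGe_C_oneSub_inv (c : K) : OrdGe 0 (MvPowerSeries.C (oneSub c)⁻¹) := by
  rw [inv_eq_of_mul_eq_one_right (oneSub_mul_inv c), ← transpose_map_C]
  exact ordGe_transpose _

theorem sum_Ico_int_sub {M : Type*} [AddCommGroup M] (Z : ℤ → M) {a n : ℤ} (h : a ≤ n) :
    ∑ k ∈ Finset.Ico a n, (Z (k + 1) - Z k) = Z n - Z a := by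
  induction n, h using Int.leInduction with
  | base => simp
  | succ n hn ih =>
    rw [← Finset.insert_Ico_right_eq_Ico_add_one hn,
      Finset.sum_insert (by simp), ih]
    abel

/-- For a fixed monomial and a fixed power of `T`, the terms with `k` very negative vanish by `hw`,
so the sum is finite and telescopes. The lower boundary term does not contribute either, since `hF`
pushes its order in `T` beyond the power considered. -/
theorem seriesPos_eq_of_telescoping {G : ℤ → Fn K} {w : ℤ → ℤ → Fn K}
    (hw : ∀ (k t : ℤ) m, t + k + wtVar m < 0 → MvPowerSeries.coeff m (w k t) = 0)
    {Z : ℤ → Fn (Laurent K)} {c : ℤ} (hZ : ∀ k, Z (k + 1) - Z k = lift (G k) * seriesPos (w k))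
    (hF : ∀ k, OrdGe (c - k) (Z k)) {n : ℤ} {v : ℤ → Fn K}
    (hv : ∀ t m, MvPowerSeries.coeff m (v t) =
      ∑ᶠ k : ℤ, MvPowerSeries.coeff m ((if k < n then G k else 0) * w k t)) :
    seriesPos v = Z n := by
  classical
  refine seriesPos_eq fun m d => ?_
  have hcoeff : ∀ k, (MvPowerSeries.coeff m (lift (G k) * seriesPos (w k))).coeff d =
      MvPowerSeries.coeff m (G k * w k d) := by
    intro k
    rw [MvPowerSeries.coeff_mul, MvPowerSeries.coeff_mul, Laurent.coeff_sum]
    refine Finset.sum_congr rfl fun p _ => ?_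
    rw [coeff_lift, Laurent.coeff_const_mul]
    congr 1
    refine coeff_laurent ⟨-k - wtVar p.2, fun t ht => ?_⟩ d
    by_contra h
    exact ht (hw k t p.2 (by omega))
  -- The second bound kills the terms below `a`; the third puts `d` below the order of `Z a`.
  set a := min n (min (-d - wtVar m) (c - d - wtVar m - 1)) with ha
  have hzero : ∀ k, k < a → MvPowerSeries.coeff m (G k * w k d) = 0 := by
    intro k hk
    rw [MvPowerSeries.coeff_mul]
    refine Finset.sum_eq_zero fun p hp => ?_
    have h1 := wtVar_add p.1 p.2
    rw [mem_antidiagonal.mp hp] at h1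
    rw [hw k d p.2 (by omega), mul_zero]
  have hfin : ∑ᶠ k : ℤ, MvPowerSeries.coeff m ((if k < n then G k else 0) * w k d) =
      ∑ k ∈ Finset.Ico a n, MvPowerSeries.coeff m (G k * w k d) := by
    rw [finsum_eq_sum_of_support_subset (s := Finset.Ico a n)]
    · refine Finset.sum_congr rfl fun k hk => ?_
      rw [if_pos (Finset.mem_Ico.mp hk).2]
    · intro k hk
      rw [Finset.coe_Ico, Set.mem_Ico]
      by_contra hne
      refine hk ?_
      change MvPowerSeries.coeff m ((if k < n then G k else 0) * w k d) = 0
      split_ifs with hkn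
      · exact hzero k (by omega)
      · rw [zero_mul, map_zero]
  rw [hv, hfin, ← Finset.sum_congr rfl fun k _ => hcoeff k]
  simp only [← hZ]
  rw [← Laurent.coeff_sum, ← map_sum, sum_Ico_int_sub Z (by omega), map_sub, Laurent.coeff_sub,
    hF a m d (by omega), sub_zero]

theorem psi₁_mulMat_lowerPart {A W : Mat K} {n : ℤ}
    (hW : ∀ (k j : ℤ) m, k + wtVar m < j → MvPowerSeries.coeff m (W k j) = 0)
    {Z : ℤ → Fn (Laurent K)} {c : ℤ} (hZ : ∀ k, Z (k + 1) - Z k = lift (A n k) * psi₁ W k)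
    (hF : ∀ k, OrdGe (c - k) (Z k)) : psi₁ (mulMat (lowerPart A) W) n = Z n := by
  rw [psi₁, seriesNeg_eq_seriesPos]
  exact seriesPos_eq_of_telescoping (G := A n) (w := fun k t => W k (-t))
    (fun k t m h => hW k (-t) m (by omega)) hZ hF fun t m => rfl

/-- The substitution `k ↦ -k` reduces this to sums bounded above. The upper part contains the
diagonal, so `k ≥ n` becomes `-k < 1 - n`. -/
theorem psi₂_mulMat_upperPart {A W : Mat K} {n : ℤ}
    (hW : ∀ (k j : ℤ) m, j + wtVar m < k → MvPowerSeries.coeff m (W k j) = 0)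
    {Z : ℤ → Fn (Laurent K)} {c : ℤ} (hZ : ∀ k, Z k - Z (k + 1) = lift (A n k) * psi₂ W k)
    (hF : ∀ k, OrdGe (c + k) (Z k)) : psi₂ (mulMat (upperPart A) W) n = Z n := by
  have key := seriesPos_eq_of_telescoping (G := fun k => A n (-k)) (w := fun k t => W (-k) t)
    (Z := fun k => Z (1 - k)) (c := c + 1) (n := 1 - n)
    (v := fun j => mulMat (upperPart A) W n j)
    (fun k t m h => hW (-k) t m (by omega)) (fun k => ?_) (fun k => ?_) fun t m => ?_
  · rw [psi₂, key]; congr 1; ring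
  · have := hZ (-k)
    rw [show 1 - (k + 1) = -k by ring, show 1 - k = -k + 1 by ring]
    exact this
  · have := hF (1 - k)
    rwa [show c + (1 - k) = c + 1 - k by ring] at this
  · rw [coeff_mulMat, ← finsum_comp_equiv (Equiv.neg ℤ)]
    refine finsum_congr fun k => ?_
    simp only [Equiv.neg_apply, upperPart]
    congr 2
    split_ifs <;> first | rfl | omega

end

section

variable {K : Type} [Field K] [CharZero K]

/-! ### Tau functions and dressing operators -/

/-- The dressing operators are expressed through the tau functions, coefficient by coefficient. -/
structure IsAmplitude (S₁ S₁inv S₂ S₂inv : Mat K) (τ : ℤ → Fn K) : Prop where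
  isUnit : ∀ s, IsUnit (τ s)
  lower₁ : ∀ i j : ℤ, i < j → S₁ i j = 0
  lower₁inv : ∀ i j : ℤ, i < j → S₁inv i j = 0
  upper₂ : ∀ i j : ℤ, j < i → S₂ i j = 0
  upper₂inv : ∀ i j : ℤ, j < i → S₂inv i j = 0
  amp₁ : ∀ n : ℤ, (PowerSeries.mk fun d => S₁ n (n - d)) * PowerSeries.C (τ n) =
    shiftHom Side.x (-1) (τ n)
  amp₂ : ∀ n : ℤ, (PowerSeries.mk fun d => S₂ n (n + d)) * PowerSeries.C (τ n) =
    shiftHom Side.y (-1) (τ (n + 1))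
  amp₁inv : ∀ n : ℤ, (PowerSeries.mk fun d => S₁inv (n + d) n) * PowerSeries.C (τ (n + 1)) =
    shiftHom Side.x 1 (τ (n + 1))
  amp₂inv : ∀ n : ℤ, (PowerSeries.mk fun d => S₂inv (n - d) n) * PowerSeries.C (τ (n + 1)) =
    shiftHom Side.y 1 (τ n)

/-- The power of `T` and the exponential are units and cancel, leaving an identity of series in `T`
with function coefficients; no Laurent extension remains. -/
theorem mul_C_eq_shiftHom_of_wave {F : PowerSeries (Fn K)} {g h : Fn K} (hh : IsUnit h)
    {b b' : Side} {ε ε' : K} {c : ℤ} {s : ℤ}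
    (H : MvPowerSeries.C (Laurent.single c 1) * (transpose F * expXi b' ε' s) =
      (Laurent.single c 1 : Laurent K) • (shiftFn b ε g * (lift h)⁻¹ * expXi b' ε' s)) :
    F * PowerSeries.C h = shiftHom b ε g := by
  refine transpose_injective ?_
  rw [map_mul, transpose_C, ← shiftFn_eq_transpose]
  rw [MvPowerSeries.smul_eq_C_mul] at H
  have hc : MvPowerSeries.C (Laurent.single (-c) 1) * MvPowerSeries.C (Laurent.single c 1) =
      (1 : Fn (Laurent K)) := by
    rw [← map_mul, Laurent.single_mul_single, neg_add_cancel, mul_one, Laurent.single_zero_one,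
      map_one]
  have hE := expXi_mul_neg b' ε' s
  have hh' : lift h * (lift h)⁻¹ = 1 := by
    refine MvPowerSeries.mul_inv_cancel _ ?_
    have := (hh.map lift).map (MvPowerSeries.constantCoeff (σ := Var) (R := Laurent K))
    exact this.ne_zero
  set e := expXi b' ε' s
  set e' := expXi b' (-ε') s
  set u := MvPowerSeries.C (σ := Var) (Laurent.single c 1 : Laurent K)
  set u' := MvPowerSeries.C (σ := Var) (Laurent.single (-c) 1 : Laurent K)
  linear_combination (u' * e' * lift h) * H + (-(transpose F * e * e' * lift h) +
      shiftFn b ε g * (lift h)⁻¹ * e * e' * lift h) * hc +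
    (-(transpose F * lift h) + shiftFn b ε g * (lift h)⁻¹ * lift h) * hE + shiftFn b ε g * hh'

theorem Solution.IsTau.isAmplitude {D : Solution} {τ : ℤ → Fn ℂ} (hτ : D.IsTau τ) :
    IsAmplitude D.S₁ D.S₁inv D.S₂ D.S₂inv τ where
  isUnit := hτ.isUnit
  lower₁ := D.S₁_lower
  lower₁inv := D.S₁inv_lower
  upper₂ := D.S₂_upper
  upper₂inv := D.S₂inv_upper
  amp₁ n := mul_C_eq_shiftHom_of_wave (hτ.isUnit n)
    ((psi₁_mulMat_expMat D.S₁_lower Side.x 1 n).symm.trans (hτ.psi₁_eq n))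
  amp₂ n := mul_C_eq_shiftHom_of_wave (hτ.isUnit n)
    ((psi₂_mulMat_expMat D.S₂_upper Side.y 1 n).symm.trans (hτ.psi₂_eq n))
  amp₁inv n := mul_C_eq_shiftHom_of_wave (hτ.isUnit (n + 1))
    ((psi₁Star_expMat_mulMat D.S₁inv_lower Side.x (-1) n).symm.trans (hτ.psi₁Star_eq n))
  amp₂inv n := mul_C_eq_shiftHom_of_wave (hτ.isUnit (n + 1))
    ((psi₂Star_expMat_mulMat D.S₂inv_upper Side.y (-1) n).symm.trans (hτ.psi₂Star_eq n))

theorem map_lift_shiftHom (b : Side) (ε : K) (f : Fn K) :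
    PowerSeries.map lift (shiftHom b ε f) = shiftHom b (Laurent.const ε) (lift f) :=
  map_shiftHom b lift isDHom_lift (lift_C ε) f

theorem map_lift_mul_C {a : ℕ → Fn K} {h g : Fn K} {b : Side} {ε : K}
    (H : PowerSeries.mk a * PowerSeries.C h = shiftHom b ε g) :
    (PowerSeries.mk fun d => lift (a d)) * PowerSeries.C (lift h) =
      shiftHom b (Laurent.const ε) (lift g) := by
  rw [← map_lift_shiftHom, ← H, map_mul, PowerSeries.map_C]
  rfl

/-- Naturality of the shift lets the tau-function formulas be reused over the fields containing `μ`
and `λ`, where the later parameters are adjoined. -/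
theorem IsAmplitude.lift {S₁ S₁inv S₂ S₂inv : Mat K} {τ : ℤ → Fn K}
    (h : IsAmplitude S₁ S₁inv S₂ S₂inv τ) :
    IsAmplitude (liftMat S₁) (liftMat S₁inv) (liftMat S₂) (liftMat S₂inv)
      fun s => TodaLattice.lift (τ s) where
  isUnit s := (h.isUnit s).map _
  lower₁ i j hij := by rw [liftMat, h.lower₁ i j hij, map_zero]
  lower₁inv i j hij := by rw [liftMat, h.lower₁inv i j hij, map_zero]
  upper₂ i j hij := by rw [liftMat, h.upper₂ i j hij, map_zero]
  upper₂inv i j hij := by rw [liftMat, h.upper₂inv i j hij, map_zero]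
  amp₁ n := by
    have e := map_lift_mul_C (h.amp₁ n)
    simp only [map_neg, map_one] at e
    exact e
  amp₂ n := by
    have e := map_lift_mul_C (h.amp₂ n)
    simp only [map_neg, map_one] at e
    exact e
  amp₁inv n := by
    have e := map_lift_mul_C (h.amp₁inv n)
    simp only [map_one] at e
    exact e
  amp₂inv n := by
    have e := map_lift_mul_C (h.amp₂inv n)
    simp only [map_one] at e
    exact e

namespace IsAmplitude

variable {S₁ S₁inv S₂ S₂inv : Mat K} {τ : ℤ → Fn K}

theorem psi₁_mul (h : IsAmplitude S₁ S₁inv S₂ S₂inv τ) (n : ℤ) :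
    psi₁ (mulMat S₁ (expMat Side.x 1 1)) n * TodaLattice.lift (τ n) =
      MvPowerSeries.C (Laurent.single (-n) 1) *
        (shiftRingHom Side.x (-1) (τ n) * expXi Side.x 1 (-1)) := by
  have e := congrArg transpose (h.amp₁ n)
  rw [map_mul, transpose_C] at e
  rw [psi₁_mulMat_expMat h.lower₁]
  change _ = _ * (transpose _ * _)
  rw [← e]; ring

theorem psi₂_mul (h : IsAmplitude S₁ S₁inv S₂ S₂inv τ) (n : ℤ) :
    psi₂ (mulMat S₂ (expMat Side.y 1 (-1))) n * TodaLattice.lift (τ n) =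
      MvPowerSeries.C (Laurent.single n 1) *
        (shiftRingHom Side.y (-1) (τ (n + 1)) * expXi Side.y 1 (-1)) := by
  have e := congrArg transpose (h.amp₂ n)
  rw [map_mul, transpose_C] at e
  rw [psi₂_mulMat_expMat h.upper₂]
  change _ = _ * (transpose _ * _)
  rw [← e]; ring

theorem psi₁Star_mul (h : IsAmplitude S₁ S₁inv S₂ S₂inv τ) (n : ℤ) :
    psi₁Star (mulMat (expMat Side.x (-1) 1) S₁inv) n * TodaLattice.lift (τ (n + 1)) =
      MvPowerSeries.C (Laurent.single n 1) *
        (shiftRingHom Side.x 1 (τ (n + 1)) * expXi Side.x (-1) (-1)) := by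
  have e := congrArg transpose (h.amp₁inv n)
  rw [map_mul, transpose_C] at e
  rw [psi₁Star_expMat_mulMat h.lower₁inv]
  change _ = _ * (transpose _ * _)
  rw [← e]; ring

theorem psi₂Star_mul (h : IsAmplitude S₁ S₁inv S₂ S₂inv τ) (n : ℤ) :
    psi₂Star (mulMat (expMat Side.y (-1) (-1)) S₂inv) n * TodaLattice.lift (τ (n + 1)) =
      MvPowerSeries.C (Laurent.single (-n) 1) *
        (shiftRingHom Side.y 1 (τ n) * expXi Side.y (-1) (-1)) := by
  have e := congrArg transpose (h.amp₂inv n)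
  rw [map_mul, transpose_C] at e
  rw [psi₂Star_expMat_mulMat h.upper₂inv]
  change _ = _ * (transpose _ * _)
  rw [← e]; ring

end IsAmplitude

theorem Solution.IsTau.isFay_x {D : Solution} {τ : ℤ → Fn ℂ} (hτ : D.IsTau τ) :
    IsFay Side.x Side.y τ := by
  have h := hτ.isAmplitude
  refine isFay_of_rows (P := D.S₁) (O := D.S₂) (h := τ) D.S₁_lower
    (fun i => by rw [D.S₁_diag]; exact isUnit_one) D.S₂_upper D.rowDeriv_mem_x
    (fun i d => ?_) (fun i d => ?_)
  · rw [← h.amp₁ i, PowerSeries.coeff_mul_C, PowerSeries.coeff_mk]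
  · rw [← h.amp₂ i, PowerSeries.coeff_mul_C, PowerSeries.coeff_mk]

/-- Row `i` of the reflected `S₂` is row `-i`, whose wave function is a ratio with numerator
`τ(-i+1)` and denominator `τ(-i)`. This accounts for the index `1 - i`. -/
theorem Solution.IsTau.isFay_y {D : Solution} {τ : ℤ → Fn ℂ} (hτ : D.IsTau τ) :
    IsFay Side.y Side.x fun i => τ (1 - i) := by
  have h := hτ.isAmplitude
  have h2 : ∀ (i : ℤ) (d : ℕ), reflect D.S₂ i (i - d) * τ (-i) =
      PowerSeries.coeff d (shiftHom Side.y (-1) (τ (1 - i))) := by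
    intro i d
    have e := congrArg (PowerSeries.coeff d) (h.amp₂ (-i))
    rw [PowerSeries.coeff_mul_C, PowerSeries.coeff_mk, show -i + 1 = 1 - i by ring] at e
    rw [← e, reflect, show -(i - (d : ℤ)) = -i + d by ring]
  refine isFay_of_rows (P := reflect D.S₂) (O := reflect D.S₁) (h := fun i => τ (-i))
    (fun i j hij => D.S₂_upper _ _ (by omega)) (fun i => ?_)
    (fun i j hij => D.S₁_lower _ _ (by omega)) D.rowDeriv_mem_y h2 (fun i d => ?_)
  · have e := h2 i 0
    rw [coeff_zero_shiftHom, Nat.cast_zero, sub_zero] at e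
    exact isUnit_of_mul_isUnit_left (e ▸ hτ.isUnit (1 - i))
  · have e := congrArg (PowerSeries.coeff d) (h.amp₁ (-i))
    rw [PowerSeries.coeff_mul_C, PowerSeries.coeff_mk] at e
    rw [show 1 - (i + 1) = -i by ring, ← e, reflect, show -(i + (d : ℤ)) = -i - d by ring]

/-! ### Fay identities with spectral parameters -/

section Transport

variable {K' : Type} [Field K'] [CharZero K'] {b b' : Side} {g : ℤ → Fn K}

theorem transpose_map_map_shiftHom {φ : Fn K →+* PowerSeries (Fn K)}
    {ρ : PowerSeries (Fn K) →+* Fn K'} (h : IsDHom (ρ.comp φ)) (b : Side) (f : Fn K) :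
    transpose (PowerSeries.map ρ (PowerSeries.map φ (shiftHom b (-1) f))) =
      shiftRingHom b (-1) (ρ (φ f)) := by
  have e := map_shiftHom b (ε := (-1 : K)) (ε' := (-1 : K')) (ρ.comp φ) h (by simp) f
  rw [PowerSeries.map_comp] at e
  exact congrArg transpose e

theorem shiftSubst_map_map_shiftHom {φ : Fn K →+* PowerSeries (Fn K)}
    {ρ : PowerSeries (Fn K) →+* Fn K'} (h : IsDHom (ρ.comp φ)) (b : Side) (f : Fn K) :
    shiftSubst b 1 (PowerSeries.map ρ (PowerSeries.map φ (shiftHom b (-1) f))) =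
      lift (ρ (φ f)) := by
  have e := map_shiftHom b (ε := (-1 : K)) (ε' := (-1 : K')) (ρ.comp φ) h (by simp) f
  rw [PowerSeries.map_comp] at e
  exact (congrArg (shiftSubst b 1) e).trans (shiftSubst_shiftHom_neg b 1 _)

theorem IsFay.transport_same (hg : IsFay b b' g) {ρ : PowerSeries (Fn K) →+* Fn K'}
    (h₁ : IsDHom (ρ.comp (shiftHom b (-1)))) (h₂ : IsDHom (ρ.comp PowerSeries.C)) (i : ℤ) :
    (MvPowerSeries.C (Laurent.single 1 1) - lift (ρ PowerSeries.X)) *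
      shiftRingHom b (-1) (ρ (shiftHom b (-1) (g i))) * lift (ρ (PowerSeries.C (g (i + 1)))) =
    MvPowerSeries.C (Laurent.single 1 1) * lift (ρ (shiftHom b (-1) (g (i + 1)))) *
      shiftRingHom b (-1) (ρ (PowerSeries.C (g i))) -
    lift (ρ PowerSeries.X) * lift (ρ (shiftHom b (-1) (g i))) *
      shiftRingHom b (-1) (ρ (PowerSeries.C (g (i + 1)))) := by
  have e := congrArg (fun F => transpose (PowerSeries.map ρ F)) (hg.same i)
  simpa only [map_sub, map_mul, PowerSeries.map_C, PowerSeries.map_X, transpose_C, transpose_X,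
    transpose_map_map_shiftHom h₁, transpose_map_map_shiftHom h₂] using e

theorem IsFay.transport_mixed (hg : IsFay b b' g) {ρ : PowerSeries (Fn K) →+* Fn K'}
    (h₁ : IsDHom (ρ.comp (shiftHom b (-1)))) (h₂ : IsDHom (ρ.comp PowerSeries.C)) (i : ℤ) :
    shiftRingHom b' (-1) (ρ (shiftHom b (-1) (g (i + 1)))) *
      lift (ρ (PowerSeries.C (g (i + 1)))) =
    lift (ρ (shiftHom b (-1) (g (i + 1)))) *
      shiftRingHom b' (-1) (ρ (PowerSeries.C (g (i + 1)))) -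
    lift (ρ PowerSeries.X) * MvPowerSeries.C (Laurent.single 1 1) *
      lift (ρ (shiftHom b (-1) (g i))) *
      shiftRingHom b' (-1) (ρ (PowerSeries.C (g (i + 1 + 1)))) := by
  have e := congrArg (fun F => transpose (PowerSeries.map ρ F)) (hg.mixed i)
  simpa only [map_sub, map_mul, PowerSeries.map_C, PowerSeries.map_X, transpose_C, transpose_X,
    transpose_map_map_shiftHom h₁, transpose_map_map_shiftHom h₂] using e

/-- The outer parameter `U` becomes the new variable `T`, and the times are simultaneously
translated by `[T]`. Every shift by `-[U]` is thereby undone. -/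
theorem IsFay.transport_shifted (hg : IsFay b b' g) {ρ : PowerSeries (Fn K) →+* Fn K'}
    (h₁ : IsDHom (ρ.comp (shiftHom b (-1)))) (h₂ : IsDHom (ρ.comp PowerSeries.C)) (i : ℤ) :
    (MvPowerSeries.C (Laurent.single 1 1) - shiftRingHom b 1 (ρ PowerSeries.X)) *
      lift (ρ (shiftHom b (-1) (g i))) * shiftRingHom b 1 (ρ (PowerSeries.C (g (i + 1)))) =
    MvPowerSeries.C (Laurent.single 1 1) * shiftRingHom b 1 (ρ (shiftHom b (-1) (g (i + 1)))) *
      lift (ρ (PowerSeries.C (g i))) -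
    shiftRingHom b 1 (ρ PowerSeries.X) * shiftRingHom b 1 (ρ (shiftHom b (-1) (g i))) *
      lift (ρ (PowerSeries.C (g (i + 1)))) := by
  have e := congrArg (fun F => shiftSubst b 1 (PowerSeries.map ρ F)) (hg.same i)
  simpa only [map_sub, map_mul, PowerSeries.map_C, PowerSeries.map_X, shiftSubst_C, shiftSubst_X,
    shiftSubst_map_map_shiftHom h₁, shiftSubst_map_map_shiftHom h₂] using e

end Transport

end

section

/-! ### The parameters `λ`, `μ`, `z` as scalars -/

theorem mu_zpow (k : ℤ) : mu ^ k = Laurent.const (Laurent.single (-k) 1) := by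
  rw [mu, ← map_zpow₀, Laurent.single_zpow (-1), Laurent.single_zpow (-k), ← zpow_mul]
  congr 2; ring

theorem lam_zpow (k : ℤ) : lam ^ k = Laurent.single (-k) 1 := by
  rw [lam, Laurent.single_zpow (-1), Laurent.single_zpow (-k), ← zpow_mul]
  congr 1; ring

theorem lam_inv : lam⁻¹ = Laurent.single 1 1 := by
  have := lam_zpow (-1)
  rwa [zpow_neg_one, neg_neg] at this

theorem mu_inv : mu⁻¹ = Laurent.const (Laurent.single 1 1) := by
  have := mu_zpow (-1)
  rwa [zpow_neg_one, neg_neg] at this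

theorem lam_ne_zero : lam ≠ 0 := Laurent.single_ne_zero (-1)

theorem mu_ne_zero : mu ≠ 0 := by
  have := (map_ne_zero (Laurent.const (K := Laurent ℂ))).mpr
    (Laurent.single_ne_zero (K := ℂ) (-1))
  exact this

/-- A constant of `ℂ((μ⁻¹))((λ⁻¹))` as a function. -/
def scal (a : Klm) : Fn Klmz := MvPowerSeries.C (Laurent.const a)

theorem scal_mul (a c : Klm) : scal (a * c) = scal a * scal c := by
  rw [scal, map_mul, map_mul]; rfl

theorem scal_one : scal 1 = 1 := by rw [scal, map_one, map_one]

theorem lift_C_eq_scal (a : Klm) : lift (MvPowerSeries.C a) = scal a := lift_C a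

theorem shiftRingHom_C_eq_scal (b : Side) (ε a : Klm) :
    shiftRingHom b ε (MvPowerSeries.C a) = scal a := shiftRingHom_C b ε a

theorem ordGe_scal (a : Klm) : OrdGe 0 (scal a) := by
  rw [← lift_C_eq_scal]; exact ordGe_lift _

/-- The variable `T` of `ℂ((μ⁻¹))((λ⁻¹))((T))` as a function. -/
def varT : Fn Klmz := MvPowerSeries.C (Laurent.single 1 1)

/-- The power `T^k`. -/
def powT (k : ℤ) : Fn Klmz := MvPowerSeries.C (Laurent.single k 1)

theorem powT_add_one (k : ℤ) : powT (k + 1) = powT k * varT := by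
  rw [powT, powT, varT, ← map_mul, Laurent.single_mul_single, mul_one]

/-- The scalar `1 / (1 - λT)`. -/
def invOneSubLam : Fn Klmz := MvPowerSeries.C (oneSub lam)⁻¹

theorem invOneSubLam_mul : invOneSubLam * (1 - scal lam * varT) = 1 := by
  rw [invOneSubLam, scal, varT, ← map_mul, ← map_one (MvPowerSeries.C (σ := Var)), ← map_sub,
    ← map_mul]
  congr 1
  exact inv_mul_cancel₀ (oneSub_ne_zero lam)

/-- The scalar `1 / (1 - μ/λ)`. -/
def invOneSubMuLam : Fn Klmz := scal (oneSub (Laurent.single (-1) 1))⁻¹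

theorem invOneSubMuLam_mul : invOneSubMuLam * (1 - scal mu * scal lam⁻¹) = 1 := by
  have h : (1 : Fn Klmz) - scal mu * scal lam⁻¹ = scal (oneSub (Laurent.single (-1) 1)) := by
    rw [← scal_one, ← scal_mul, scal, scal, ← map_sub, ← map_sub, lam_inv]; rfl
  rw [h, invOneSubMuLam, ← scal_mul, inv_mul_cancel₀ (oneSub_ne_zero _), scal_one]

theorem scal_mu_mul_inv : scal mu * scal mu⁻¹ = 1 := by
  rw [← scal_mul, mul_inv_cancel₀ mu_ne_zero, scal_one]

theorem scal_lam_mul_inv : scal lam * scal lam⁻¹ = 1 := by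
  rw [← scal_mul, mul_inv_cancel₀ lam_ne_zero, scal_one]

/-! ### Shifts by several parameters -/

/-- `f(x)`. -/
def sh : Fn ℂ →+* Fn Klmz := (lift.comp lift).comp lift

/-- `f(x - [μ⁻¹])`. -/
def shM (b : Side) : Fn ℂ →+* Fn Klmz := (lift.comp lift).comp (shiftRingHom b (-1))

/-- `f(x + [λ⁻¹])`. -/
def shL (b : Side) : Fn ℂ →+* Fn Klmz := (lift.comp (shiftRingHom b 1)).comp lift

/-- `f(x + [λ⁻¹] - [μ⁻¹])`. -/
def shLM (b : Side) : Fn ℂ →+* Fn Klmz := (lift.comp (shiftRingHom b 1)).comp (shiftRingHom b (-1))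

/-- `f(x - [T])`, with the shift in the times of side `b'`. -/
def shZ (b' : Side) : Fn ℂ →+* Fn Klmz := ((shiftRingHom b' (-1)).comp lift).comp lift

/-- `f(x + [λ⁻¹] - [T])`, with the last shift in the times of side `b'`. -/
def shLZ (b b' : Side) : Fn ℂ →+* Fn Klmz :=
  ((shiftRingHom b' (-1)).comp (shiftRingHom b 1)).comp lift

/-- `f(x + [λ⁻¹] - [μ⁻¹] - [T])`, with the last shift in the times of side `b'`. -/
def shLMZ (b b' : Side) : Fn ℂ →+* Fn Klmz :=
  ((shiftRingHom b' (-1)).comp (shiftRingHom b 1)).comp (shiftRingHom b (-1))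

section Fay

variable {b b' : Side} {g : ℤ → Fn ℂ}

/-- Substitution of `μ⁻¹` for the parameter, followed by the shift by `[λ⁻¹]`. -/
def substMu (b : Side) : PowerSeries (Fn ℂ) →+* Fn Klm := (shiftRingHom b 1).comp transpose

/-- Substitution of `λ⁻¹` for the parameter, followed by the shift by `[λ⁻¹]`. -/
def substLam (b : Side) : PowerSeries (Fn ℂ) →+* Fn Klm :=
  (shiftSubst b 1).comp (PowerSeries.map lift)

theorem transpose_comp_C : (transpose (K := ℂ)).comp PowerSeries.C = lift :=
  RingHom.ext transpose_C

theorem isDHom_substMu_shift : IsDHom ((substMu b).comp (shiftHom b (-1))) := by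
  have : (substMu b).comp (shiftHom b (-1)) =
      (shiftRingHom b 1).comp (shiftRingHom b (-1)) := RingHom.ext fun f => rfl
  rw [this]
  exact (isDHom_shiftRingHom b 1).comp (isDHom_shiftRingHom b (-1))

theorem isDHom_substMu_C : IsDHom ((substMu b).comp PowerSeries.C) := by
  rw [substMu, RingHom.comp_assoc, transpose_comp_C]
  exact (isDHom_shiftRingHom b 1).comp isDHom_lift

theorem substMu_X : substMu b PowerSeries.X = MvPowerSeries.C mu⁻¹ := by
  rw [substMu, RingHom.comp_apply, transpose_X, shiftRingHom_C, mu_inv]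

theorem substMu_shift (f : Fn ℂ) :
    substMu b (shiftHom b (-1) f) = shiftRingHom b 1 (shiftRingHom b (-1) f) := rfl

theorem substMu_C (f : Fn ℂ) :
    substMu b (PowerSeries.C f) = shiftRingHom b 1 (lift f) := by
  rw [substMu, RingHom.comp_apply, transpose_C]

theorem substLam_shift (f : Fn ℂ) : substLam b (shiftHom b (-1) f) = lift (lift f) := by
  rw [substLam, RingHom.comp_apply, map_lift_shiftHom, map_neg, map_one, shiftSubst_shiftHom_neg]

theorem substLam_C (f : Fn ℂ) : substLam b (PowerSeries.C f) = shiftRingHom b 1 (lift f) := by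
  rw [substLam, RingHom.comp_apply, PowerSeries.map_C, shiftSubst_C]

theorem substLam_X : substLam b PowerSeries.X = MvPowerSeries.C lam⁻¹ := by
  rw [substLam, RingHom.comp_apply, PowerSeries.map_X, shiftSubst_X, lam_inv]

theorem isDHom_substLam_shift : IsDHom ((substLam b).comp (shiftHom b (-1))) := by
  have : (substLam b).comp (shiftHom b (-1)) = lift.comp lift := RingHom.ext substLam_shift
  rw [this]
  exact isDHom_lift.comp isDHom_lift

theorem isDHom_substLam_C : IsDHom ((substLam b).comp PowerSeries.C) := by
  have : (substLam b).comp PowerSeries.C = (shiftRingHom b 1).comp lift := RingHom.ext substLam_C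
  rw [this]
  exact (isDHom_shiftRingHom b 1).comp isDHom_lift

/-- The two parameters are `μ⁻¹` and `T`, and the whole identity is translated by `[λ⁻¹]` so that
`shL b (g (i + 1))` appears as the common factor. -/
theorem IsFay.mu_z (hg : IsFay b b' g) (i : ℤ) :
    (varT - scal mu⁻¹) * shLMZ b b (g i) * shL b (g (i + 1)) =
      varT * shLM b (g (i + 1)) * shLZ b b (g i) -
        scal mu⁻¹ * shLM b (g i) * shLZ b b (g (i + 1)) := by
  have e := hg.transport_same (ρ := substMu b) isDHom_substMu_shift isDHom_substMu_C i
  simp only [substMu_X, substMu_shift, substMu_C, lift_C_eq_scal] at e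
  exact e

/-- Here the first parameter is `λ⁻¹` itself, so translation by `[λ⁻¹]` cancels the shift by
`-[λ⁻¹]`. -/
theorem IsFay.lam_z (hg : IsFay b b' g) (i : ℤ) :
    (varT - scal lam⁻¹) * shZ b (g i) * shL b (g (i + 1)) =
      varT * sh (g (i + 1)) * shLZ b b (g i) - scal lam⁻¹ * sh (g i) * shLZ b b (g (i + 1)) := by
  have e := hg.transport_same (ρ := substLam b) isDHom_substLam_shift isDHom_substLam_C i
  simp only [substLam_X, substLam_shift, substLam_C, lift_C_eq_scal] at e
  exact e

theorem IsFay.mixed_mu_z (hg : IsFay b b' g) (i : ℤ) :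
    shLMZ b b' (g (i + 1)) * shL b (g (i + 1)) =
      shLM b (g (i + 1)) * shLZ b b' (g (i + 1)) -
        scal mu⁻¹ * varT * shLM b (g i) * shLZ b b' (g (i + 1 + 1)) := by
  have e := hg.transport_mixed (ρ := substMu b) isDHom_substMu_shift isDHom_substMu_C i
  simp only [substMu_X, substMu_shift, substMu_C, lift_C_eq_scal] at e
  exact e

theorem IsFay.mixed_lam_z (hg : IsFay b b' g) (i : ℤ) :
    shZ b' (g (i + 1)) * shL b (g (i + 1)) =
      sh (g (i + 1)) * shLZ b b' (g (i + 1)) -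
        scal lam⁻¹ * varT * sh (g i) * shLZ b b' (g (i + 1 + 1)) := by
  have e := hg.transport_mixed (ρ := substLam b) isDHom_substLam_shift isDHom_substLam_C i
  simp only [substLam_X, substLam_shift, substLam_C, lift_C_eq_scal] at e
  exact e

theorem IsFay.lam_mu (hg : IsFay b b' g) (i : ℤ) :
    (scal lam⁻¹ - scal mu⁻¹) * shM b (g i) * shL b (g (i + 1)) =
      scal lam⁻¹ * shLM b (g (i + 1)) * sh (g i) -
        scal mu⁻¹ * shLM b (g i) * sh (g (i + 1)) := by
  have hC : IsDHom ((transpose (K := ℂ)).comp PowerSeries.C) := by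
    rw [transpose_comp_C]; exact isDHom_lift
  have e := congrArg lift
    (hg.transport_shifted (ρ := transpose) (isDHom_shiftRingHom b (-1)) hC i)
  simp only [transpose_C, transpose_X, map_mul, map_sub, shiftRingHom_C, ← lam_inv, ← mu_inv,
    lift_C_eq_scal] at e
  exact e

theorem shL_ne_zero (hu : ∀ i, IsUnit (g i)) (i : ℤ) : shL b (g i) ≠ 0 :=
  ((hu i).map (shL b)).ne_zero

/-- The three-term Fay identity. -/
theorem IsFay.three_term (hg : IsFay b b' g) (hu : ∀ i, IsUnit (g i)) (i : ℤ) :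
    (scal mu⁻¹ - scal lam⁻¹) * varT * shM b (g i) * shLZ b b (g i) =
      scal lam⁻¹ * (scal mu⁻¹ - varT) * shLMZ b b (g i) * sh (g i) -
        scal mu⁻¹ * (scal lam⁻¹ - varT) * shLM b (g i) * shZ b (g i) := by
  -- The two-parameter identities in `(λ, μ)`, `(μ, z)` and `(λ, z)` all contain the factor `shL b
  -- (g (i + 1))`. Multiplied by it, the claim is a linear combination of them.
  refine mul_right_cancel₀ (shL_ne_zero (b := b) hu (i + 1)) ?_
  linear_combination (-varT * shLZ b b (g i)) * hg.lam_mu i +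
    (scal lam⁻¹ * sh (g i)) * hg.mu_z i - (scal mu⁻¹ * shLM b (g i)) * hg.lam_z i

theorem IsFay.three_term_succ (hg : IsFay b b' g) (hu : ∀ i, IsUnit (g i)) (i : ℤ) :
    (scal mu⁻¹ - scal lam⁻¹) * shM b (g i) * shLZ b b (g (i + 1)) =
      (scal mu⁻¹ - varT) * shLMZ b b (g i) * sh (g (i + 1)) -
        (scal lam⁻¹ - varT) * shLM b (g (i + 1)) * shZ b (g i) := by
  refine mul_right_cancel₀ (shL_ne_zero (b := b) hu (i + 1)) ?_
  linear_combination (-shLZ b b (g (i + 1))) * hg.lam_mu i +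
    sh (g (i + 1)) * hg.mu_z i - shLM b (g (i + 1)) * hg.lam_z i

/-- The same elimination, with the mixed identities supplying the two relations that involve `z`. -/
theorem IsFay.three_term_mixed (hg : IsFay b b' g) (hu : ∀ i, IsUnit (g i)) (i : ℤ) :
    -(scal mu⁻¹ - scal lam⁻¹) * shM b (g i) * shLZ b b' (g (i + 1)) =
      scal lam⁻¹ * shLMZ b b' (g (i + 1)) * sh (g i) -
        scal mu⁻¹ * shLM b (g i) * shZ b' (g (i + 1)) := by
  refine mul_right_cancel₀ (shL_ne_zero (b := b) hu (i + 1)) ?_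
  linear_combination shLZ b b' (g (i + 1)) * hg.lam_mu i -
    scal lam⁻¹ * sh (g i) * hg.mixed_mu_z i + scal mu⁻¹ * shLM b (g i) * hg.mixed_lam_z i

theorem IsFay.three_term_mixed_succ (hg : IsFay b b' g) (hu : ∀ i, IsUnit (g i)) (i : ℤ) :
    -(scal mu⁻¹ - scal lam⁻¹) * varT * shM b (g i) * shLZ b b' (g (i + 1 + 1)) =
      shLMZ b b' (g (i + 1)) * sh (g (i + 1)) - shLM b (g (i + 1)) * shZ b' (g (i + 1)) := by
  refine mul_right_cancel₀ (shL_ne_zero (b := b) hu (i + 1)) ?_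
  linear_combination varT * shLZ b b' (g (i + 1 + 1)) * hg.lam_mu i -
    sh (g (i + 1)) * hg.mixed_mu_z i + shLM b (g (i + 1)) * hg.mixed_lam_z i

end Fay

/-! ### The vertex operator and its shifts -/

/-- `e^{ξ(x,μ)}`. -/
def expMu (b : Side) : Fn Klmz := lift (lift (expXi b 1 (-1)))

/-- `e^{-ξ(x,λ)}`. -/
def expLam (b : Side) : Fn Klmz := lift (expXi b (-1) (-1))

/-- The value `e^{ξ(x+[λ⁻¹],μ)} = e^{ξ(x,μ)} / (1 - μ/λ)` separates the scalar singular factor from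
the exponential. -/
theorem vertexOp_eq (b : Side) (f : Fn ℂ) : vertexOp b f =
    MvPowerSeries.C lam⁻¹ * (lift (expXi b 1 (-1)) *
      MvPowerSeries.C (oneSub (Laurent.single (-1) 1))⁻¹ * expXi b (-1) (-1) *
        shiftRingHom b 1 (shiftRingHom b (-1) f)) := by
  have h := shiftRingHom_expXi_self (K := ℂ) b (ε := 1) (ε' := 1) (by simp)
  have h2 : MvPowerSeries.C (oneSub (Laurent.single (-1) (1 : ℂ))) *
      MvPowerSeries.C (oneSub (Laurent.single (-1) (1 : ℂ)))⁻¹ = (1 : Fn Klm) := by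
    rw [← map_mul, mul_inv_cancel₀ (oneSub_ne_zero _), map_one]
  have h3 : shiftRingHom b 1 (expXi b 1 (-1)) = lift (expXi b (1 : ℂ) (-1)) *
      MvPowerSeries.C (oneSub (Laurent.single (-1) 1))⁻¹ := by
    rw [← h, mul_assoc, h2, mul_one]
  rw [vertexOp, MvPowerSeries.smul_eq_C_mul, shiftFn_eq, shiftFn_eq, shiftFn_eq, h3]

theorem lift_vertexOp (b : Side) (f : Fn ℂ) : lift (vertexOp b f) =
    scal lam⁻¹ * (expMu b * invOneSubMuLam * expLam b * shLM b f) := by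
  rw [vertexOp_eq]
  simp only [map_mul, lift_C_eq_scal]
  rfl

theorem shiftRingHom_vertexOp_of_ne {b b' : Side} (h : b ≠ b') (f : Fn ℂ) :
    shiftRingHom b' (-1) (vertexOp b f) =
      scal lam⁻¹ * (expMu b * invOneSubMuLam * expLam b * shLMZ b b' f) := by
  rw [vertexOp_eq]
  simp only [map_mul, shiftRingHom_C_eq_scal]
  rw [shiftRingHom_of_pderiv_eq_zero b' (-1) (E := expXi b (-1) (-1))
    fun l => pderiv_expXi_of_ne h _ _ l,
    shiftRingHom_of_pderiv_eq_zero b' (-1) (E := lift (expXi b 1 (-1)))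
    fun l => pderiv_lift_eq_zero (pderiv_expXi_of_ne h _ _ l)]
  rfl

/-- Compared with a shift in the other family of times, the two exponentials produce the extra
factors `1 - μT` and `1/(1 - λT)`. -/
theorem shiftRingHom_vertexOp_self (b : Side) (f : Fn ℂ) :
    shiftRingHom b (-1) (vertexOp b f) =
      scal lam⁻¹ * (expMu b * (1 - scal mu * varT) * invOneSubMuLam *
        (expLam b * invOneSubLam) * shLMZ b b f) := by
  have h1 : shiftRingHom b (-1) (lift (expXi b (1 : ℂ) (-1))) =
      expMu b * (1 - scal mu * varT) := by
    rw [shiftRingHom_of_isExp b (ε := (-1 : Klm)) (by simp) (isExp_expXi b (1 : ℂ)).lift]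
    congr 1
    rw [oneSub, map_sub, map_mul, map_one]
    rfl
  have h2 : shiftRingHom b (-1) (expXi b (-1 : Laurent ℂ) (-1)) = expLam b * invOneSubLam := by
    have e := shiftRingHom_expXi_self (K := Laurent ℂ) b (ε := -1) (ε' := -1) (by simp)
    have e2 : MvPowerSeries.C (oneSub (Laurent.single (-1) (1 : Laurent ℂ))) * invOneSubLam =
        (1 : Fn Klmz) := by
      rw [invOneSubLam, ← map_mul]
      exact (congrArg _ (mul_inv_cancel₀ (oneSub_ne_zero lam))).trans (map_one _)
    rw [expLam, ← e, mul_assoc, e2, mul_one]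
  rw [vertexOp_eq]
  simp only [map_mul, shiftRingHom_C_eq_scal]
  rw [h1, h2]
  rfl

end

section

/-! ### Closed forms of the wave functions -/

/-- `1 / τ`. -/
def invTau (f : Fn ℂ) : Fn Klmz := lift (lift (lift f))⁻¹

/-- `1 / τ(x - [T])`, with the shift in the times of side `b`. -/
def invTauZ (b : Side) (f : Fn ℂ) : Fn Klmz := shiftRingHom b (-1) (lift (lift f))⁻¹

/-- `e^{ξ(x,z)}`, where `z = T⁻¹`. -/
def expZ (b : Side) : Fn Klmz := expXi b 1 (-1)

theorem lift_lift_mul_inv {f : Fn ℂ} (hf : IsUnit f) :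
    lift (lift f) * (lift (lift f))⁻¹ = (1 : Fn Klm) :=
  MvPowerSeries.mul_inv_cancel _ <|
    ((hf.map (lift (K := ℂ))).map (lift (K := Laurent ℂ))).map
      (MvPowerSeries.constantCoeff (R := Klm)) |>.ne_zero

theorem sh_mul_invTau {f : Fn ℂ} (hf : IsUnit f) : sh f * invTau f = 1 := by
  have h := congrArg lift (lift_lift_mul_inv hf)
  rwa [map_mul, map_one] at h

theorem shZ_mul_invTauZ (b : Side) {f : Fn ℂ} (hf : IsUnit f) : shZ b f * invTauZ b f = 1 := by
  have h := congrArg (shiftRingHom b (-1)) (lift_lift_mul_inv hf)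
  rwa [map_mul, map_one] at h

theorem scal_div_zpow (a c : Klm) (k : ℤ) :
    scal ((a / c) ^ k) = scal (a ^ k) * scal (c ^ (-k)) := by
  rw [← scal_mul, div_zpow, zpow_neg, div_eq_mul_inv]

theorem scal_zpow_add_one {a : Klm} (ha : a ≠ 0) (k : ℤ) :
    scal (a ^ (k + 1)) = scal (a ^ k) * scal a := by
  rw [← scal_mul, zpow_add_one₀ ha]

theorem eq_mul_invTau {F G : Fn Klmz} {t : Fn ℂ} (ht : IsUnit t) (h : F * sh t = G) :
    F = G * invTau t := by
  rw [← h, mul_assoc, sh_mul_invTau ht, mul_one]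

namespace Solution

variable {D : Solution} {τ : ℤ → Fn ℂ}

theorem liftMat_liftMat_W₁ (D : Solution) : liftMat (liftMat D.W₁) =
    mulMat (liftMat (liftMat D.S₁)) (expMat Side.x 1 1) := by
  rw [W₁, liftMat_mulMat_expMat, liftMat_mulMat_expMat, map_one, map_one]

theorem liftMat_liftMat_W₂ (D : Solution) : liftMat (liftMat D.W₂) =
    mulMat (liftMat (liftMat D.S₂)) (expMat Side.y 1 (-1)) := by
  rw [W₂, liftMat_mulMat_expMat, liftMat_mulMat_expMat, map_one, map_one]

theorem liftMat_W₁inv (D : Solution) : liftMat D.W₁inv =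
    mulMat (expMat Side.x (-1) 1) (liftMat D.S₁inv) := by
  rw [W₁inv, liftMat_expMat_mulMat, map_neg, map_one]

theorem liftMat_W₂inv (D : Solution) : liftMat D.W₂inv =
    mulMat (expMat Side.y (-1) (-1)) (liftMat D.S₂inv) := by
  rw [W₂inv, liftMat_expMat_mulMat, map_neg, map_one]

theorem IsTau.psi₁_mu (hτ : D.IsTau τ) (n : ℤ) : lift (lift (psi₁ D.W₁ n)) =
    scal (mu ^ n) * (shM Side.x (τ n) * expMu Side.x) * invTau (τ n) := by
  refine eq_mul_invTau (hτ.isUnit n) ?_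
  have e := congrArg lift (congrArg lift (hτ.isAmplitude.psi₁_mul n))
  simp only [map_mul, lift_C, ← mu_zpow] at e
  exact e

theorem IsTau.psi₂_mu (hτ : D.IsTau τ) (n : ℤ) : lift (lift (psi₂ D.W₂ n)) =
    scal (mu ^ (-n)) * (shM Side.y (τ (n + 1)) * expMu Side.y) * invTau (τ n) := by
  refine eq_mul_invTau (hτ.isUnit n) ?_
  have e := congrArg lift (congrArg lift (hτ.isAmplitude.psi₂_mul n))
  have h := mu_zpow (-n)
  rw [neg_neg] at h
  simp only [map_mul, lift_C, ← h] at e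
  exact e

theorem IsTau.psi₁Star_lam (hτ : D.IsTau τ) (n : ℤ) : lift (psi₁Star (liftMat D.W₁inv) n) =
    scal (lam ^ (-n)) * (shL Side.x (τ (n + 1)) * expLam Side.x) * invTau (τ (n + 1)) := by
  refine eq_mul_invTau (hτ.isUnit (n + 1)) ?_
  have e := congrArg lift (hτ.isAmplitude.lift.psi₁Star_mul n)
  have h := lam_zpow (-n)
  rw [neg_neg] at h
  rw [liftMat_W₁inv]
  simp only [map_mul, lift_C_eq_scal, ← h] at e
  exact e

theorem IsTau.psi₂Star_lam (hτ : D.IsTau τ) (n : ℤ) : lift (psi₂Star (liftMat D.W₂inv) n) =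
    scal (lam ^ n) * (shL Side.y (τ n) * expLam Side.y) * invTau (τ (n + 1)) := by
  refine eq_mul_invTau (hτ.isUnit (n + 1)) ?_
  have e := congrArg lift (hτ.isAmplitude.lift.psi₂Star_mul n)
  rw [liftMat_W₂inv]
  simp only [map_mul, lift_C_eq_scal, ← lam_zpow] at e
  exact e

theorem IsTau.Psi₁_eq (hτ : D.IsTau τ) (n : ℤ) : D.Psi₁ n =
    powT (-n) * (shZ Side.x (τ n) * expZ Side.x) * invTau (τ n) := by
  refine eq_mul_invTau (hτ.isUnit n) ?_
  rw [Psi₁, liftMat_liftMat_W₁]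
  exact hτ.isAmplitude.lift.lift.psi₁_mul n

theorem IsTau.Psi₂_eq (hτ : D.IsTau τ) (n : ℤ) : D.Psi₂ n =
    powT n * (shZ Side.y (τ (n + 1)) * expZ Side.y) * invTau (τ n) := by
  refine eq_mul_invTau (hτ.isUnit n) ?_
  rw [Psi₂, liftMat_liftMat_W₂]
  exact hτ.isAmplitude.lift.lift.psi₂_mul n

theorem lift_gen₁ (D : Solution) (n k : ℤ) : lift (D.gen₁ n k) =
    scal lam⁻¹ * (lift (lift (psi₁ D.W₁ n)) * lift (psi₁Star (liftMat D.W₁inv) k)) := by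
  rw [gen₁, MvPowerSeries.smul_eq_C_mul, map_mul, map_mul, lift_C_eq_scal]

theorem lift_gen₂ (D : Solution) (n k : ℤ) : lift (D.gen₂ n k) =
    scal lam⁻¹ * (lift (lift (psi₂ D.W₂ n)) * lift (psi₂Star (liftMat D.W₂inv) k)) := by
  rw [gen₂, MvPowerSeries.smul_eq_C_mul, map_mul, map_mul, lift_C_eq_scal]

theorem coeff_liftMat_liftMat_W₁ (D : Solution) (k j : ℤ) (m : Var →₀ ℕ) (h : k + wtVar m < j) :
    MvPowerSeries.coeff m (liftMat (liftMat D.W₁) k j) = 0 := by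
  rw [liftMat_liftMat_W₁, coeff_mulMat_expMat]
  refine Finset.sum_eq_zero fun p hp => ?_
  have hw := wtVar_add p.1 p.2
  rw [Finset.HasAntidiagonal.mem_antidiagonal.mp hp] at hw
  rw [liftMat, liftMat, D.S₁_lower _ _ (by omega)]
  simp

theorem coeff_liftMat_liftMat_W₂ (D : Solution) (k j : ℤ) (m : Var →₀ ℕ) (h : j + wtVar m < k) :
    MvPowerSeries.coeff m (liftMat (liftMat D.W₂) k j) = 0 := by
  rw [liftMat_liftMat_W₂, coeff_mulMat_expMat]
  refine Finset.sum_eq_zero fun p hp => ?_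
  have hw := wtVar_add p.1 p.2
  rw [Finset.HasAntidiagonal.mem_antidiagonal.mp hp] at hw
  rw [liftMat, liftMat, D.S₂_upper _ _ (by omega)]
  simp

end Solution

/-! ### Summation of the squared eigenfunction flows -/

theorem isUnit_powT (k : ℤ) : IsUnit (powT k) := by
  refine IsUnit.of_mul_eq_one (powT (-k)) ?_
  rw [powT, powT, ← map_mul, Laurent.single_mul_single, add_neg_cancel, mul_one,
    Laurent.single_zero_one, map_one]

theorem isUnit_expZ (b : Side) : IsUnit (expZ b) :=
  IsUnit.of_mul_eq_one _ (expXi_mul_neg b (1 : Klm) (-1))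

theorem OrdGe.mul_of_zero {K : Type} [Field K] {c : ℤ} {F G : Fn (Laurent K)} (hF : OrdGe c F)
    (hG : OrdGe 0 G) : OrdGe c (F * G) := by
  simpa using hF.mul hG

theorem OrdGe.neg {K : Type} [Field K] {c : ℤ} {F : Fn (Laurent K)} (hF : OrdGe c F) :
    OrdGe c (-F) := by
  have h := (ordGe_C_single 0 (-1 : K)).mul hF
  rw [← Laurent.const_eq_single, map_neg, map_one] at h
  simpa using h

theorem upperPart_neg {K : Type} [Field K] (A : Mat K) : upperPart (-A) = -upperPart A := by
  ext i j : 2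
  simp only [upperPart, Matrix.neg_apply]
  split_ifs <;> simp

theorem lowerPart_neg {K : Type} [Field K] (A : Mat K) : lowerPart (-A) = -lowerPart A := by
  ext i j : 2
  simp only [lowerPart, Matrix.neg_apply]
  split_ifs <;> simp

theorem mul_inv_lam_sub : invOneSubLam * (scal lam⁻¹ - varT) = scal lam⁻¹ := by
  linear_combination scal lam⁻¹ * invOneSubLam_mul + invOneSubLam * varT * scal_lam_mul_inv

namespace Solution

variable {D : Solution} {τ : ℤ → Fn ℂ}

theorem IsTau.isUnit_Psi₁ (hτ : D.IsTau τ) (n : ℤ) : IsUnit (D.Psi₁ n) := by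
  rw [hτ.Psi₁_eq n]
  have h0 : IsUnit (invTau (τ n)) :=
    IsUnit.of_mul_eq_one _ ((mul_comm _ _).trans (sh_mul_invTau (hτ.isUnit n)))
  exact ((isUnit_powT _).mul (((hτ.isUnit n).map (shZ Side.x)).mul (isUnit_expZ _))).mul h0

theorem IsTau.isUnit_Psi₂ (hτ : D.IsTau τ) (n : ℤ) : IsUnit (D.Psi₂ n) := by
  rw [hτ.Psi₂_eq n]
  have h0 : IsUnit (invTau (τ n)) :=
    IsUnit.of_mul_eq_one _ ((mul_comm _ _).trans (sh_mul_invTau (hτ.isUnit n)))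
  exact ((isUnit_powT _).mul (((hτ.isUnit (n + 1)).map (shZ Side.y)).mul (isUnit_expZ _))).mul h0

/-- The primitive `Z k` is the displayed expression with `k` in place of `n` except in the fixed
factor `Ψ₁(n;μ)`. Its increment is the Fay identity in `λ, z` divided by `τ(k) τ(k+1)`. -/
theorem IsTau.flow₁Psi₁_eq_sum (hτ : D.IsTau τ) (n : ℤ) : D.flow₁Psi₁ n =
    powT (1 - n) * (lift (lift (psi₁ D.W₁ n)) * invOneSubLam * scal (lam ^ (-n)) *
      shLZ Side.x Side.x (τ n) * invTau (τ n) * expLam Side.x * expZ Side.x) := by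
  refine psi₁_mulMat_lowerPart (c := 1) (Z := fun k => powT (1 - k) *
    (lift (lift (psi₁ D.W₁ n)) * invOneSubLam * scal (lam ^ (-k)) *
      shLZ Side.x Side.x (τ k) * invTau (τ k) * expLam Side.x * expZ Side.x))
    D.coeff_liftMat_liftMat_W₁ (fun k => ?_) fun k => ?_
  · change _ = _ * D.Psi₁ k
    have h0 := sh_mul_invTau (hτ.isUnit k)
    have h1 := sh_mul_invTau (hτ.isUnit (k + 1))
    have e := hτ.isFay_x.lam_z k
    have h2 := mul_inv_lam_sub
    have hp : powT (1 - k) = powT (-k) * varT := by rw [← powT_add_one]; congr 1; ring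
    have hl : scal (lam ^ (-(k + 1))) = scal (lam ^ (-k)) * scal lam⁻¹ := by
      rw [← scal_mul, neg_add, zpow_add₀ lam_ne_zero, zpow_neg_one]
    rw [lift_gen₁, hτ.psi₁Star_lam, hτ.Psi₁_eq, hp, hl, show 1 - (k + 1) = -k by ring]
    generalize lift (lift (psi₁ D.W₁ n)) = P at *
    have h3 : varT * invTau (τ k) * shLZ Side.x Side.x (τ k) -
        scal lam⁻¹ * invTau (τ (k + 1)) * shLZ Side.x Side.x (τ (k + 1)) =
        (varT - scal lam⁻¹) * shZ Side.x (τ k) * shL Side.x (τ (k + 1)) * invTau (τ k) *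
          invTau (τ (k + 1)) := by
      linear_combination (-invTau (τ k) * invTau (τ (k + 1))) * e -
        varT * invTau (τ k) * shLZ Side.x Side.x (τ k) * h1 +
        scal lam⁻¹ * invTau (τ (k + 1)) * shLZ Side.x Side.x (τ (k + 1)) * h0
    linear_combination
      (-P * invOneSubLam * powT (-k) * scal (lam ^ (-k)) * expLam Side.x * expZ Side.x) * h3 +
      P * powT (-k) * scal (lam ^ (-k)) * expLam Side.x * expZ Side.x * shZ Side.x (τ k) *
        shL Side.x (τ (k + 1)) * invTau (τ k) * invTau (τ (k + 1)) * h2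
  -- The factor `T^{1-k}` supplies the order; each remaining factor lowers it by at most the weight
  -- of the monomial.
  · exact (ordGe_C_single _ _).mul_of_zero <| (((((((ordGe_lift _).mul_of_zero
      (ordGe_C_oneSub_inv _)).mul_of_zero (ordGe_scal _)).mul_of_zero
      (ordGe_shiftRingHom _ _ _)).mul_of_zero (ordGe_lift _)).mul_of_zero
      (ordGe_lift _)).mul_of_zero (ordGe_expXi _ _))

/-- The mixed Fay identity makes the products `Ψ₁*(k;λ) Ψ₂(k;z)` telescope. No factor `1/(1 - λT)`
occurs, since `λ` and `z` belong to different families of times. -/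
theorem IsTau.flow₁Psi₂_eq_sum (hτ : D.IsTau τ) (n : ℤ) : D.flow₁Psi₂ n =
    -(powT n * (scal lam⁻¹ * lift (lift (psi₁ D.W₁ n)) * scal (lam ^ (-n)) *
      shLZ Side.x Side.y (τ (n + 1)) * invTau (τ n) * expLam Side.x * expZ Side.y)) := by
  change psi₂ (-mulMat (upperPart D.gen₁) (liftMat (liftMat D.W₂))) n = _
  rw [← mulMat_neg, ← upperPart_neg]
  refine psi₂_mulMat_upperPart (c := 0) (Z := fun k =>
    -(powT k * (scal lam⁻¹ * lift (lift (psi₁ D.W₁ n)) * scal (lam ^ (-k)) *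
      shLZ Side.x Side.y (τ (k + 1)) * invTau (τ k) * expLam Side.x * expZ Side.y)))
    D.coeff_liftMat_liftMat_W₂ (fun k => ?_) fun k => ?_
  · change _ = lift (-D.gen₁ n k) * D.Psi₂ k
    have h0 := sh_mul_invTau (hτ.isUnit k)
    have h1 := sh_mul_invTau (hτ.isUnit (k + 1))
    have e := hτ.isFay_x.mixed_lam_z k
    have hl : scal (lam ^ (-(k + 1))) = scal (lam ^ (-k)) * scal lam⁻¹ := by
      rw [← scal_mul, neg_add, zpow_add₀ lam_ne_zero, zpow_neg_one]
    rw [map_neg, lift_gen₁, hτ.psi₁Star_lam, hτ.Psi₂_eq, powT_add_one, hl]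
    generalize lift (lift (psi₁ D.W₁ n)) = P at *
    linear_combination
      (P * scal lam⁻¹ * powT k * scal (lam ^ (-k)) * expLam Side.x * expZ Side.y) *
        ((invTau (τ k) * invTau (τ (k + 1))) * e +
          invTau (τ k) * shLZ Side.x Side.y (τ (k + 1)) * h1 -
          scal lam⁻¹ * varT * invTau (τ (k + 1)) * shLZ Side.x Side.y (τ (k + 1 + 1)) * h0)
  · rw [zero_add]
    exact ((ordGe_C_single _ _).mul_of_zero <| (((((((ordGe_scal _).mul_of_zero
      (ordGe_lift _)).mul_of_zero (ordGe_scal _)).mul_of_zero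
      (ordGe_shiftRingHom _ _ _)).mul_of_zero (ordGe_lift _)).mul_of_zero
      (ordGe_lift _)).mul_of_zero (ordGe_expXi _ _))).neg

/-- Telescoping now uses the reflected Fay identity at `-k`, which relates `τ(k+1)`, `τ(k)` and
`τ(k-1)`. -/
theorem IsTau.flow₂Psi₁_eq_sum (hτ : D.IsTau τ) (n : ℤ) : D.flow₂Psi₁ n =
    -(powT (1 - n) * (scal lam⁻¹ * lift (lift (psi₂ D.W₂ n)) * scal (lam ^ (n - 1)) *
      shLZ Side.y Side.x (τ (n - 1)) * invTau (τ n) * expLam Side.y * expZ Side.x)) := by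
  change psi₁ (-mulMat (lowerPart D.gen₂) (liftMat (liftMat D.W₁))) n = _
  rw [← mulMat_neg, ← lowerPart_neg]
  refine psi₁_mulMat_lowerPart (c := 1) (Z := fun k =>
    -(powT (1 - k) * (scal lam⁻¹ * lift (lift (psi₂ D.W₂ n)) * scal (lam ^ (k - 1)) *
      shLZ Side.y Side.x (τ (k - 1)) * invTau (τ k) * expLam Side.y * expZ Side.x)))
    D.coeff_liftMat_liftMat_W₁ (fun k => ?_) fun k => ?_
  · change _ = lift (-D.gen₂ n k) * D.Psi₁ k
    have h0 := sh_mul_invTau (hτ.isUnit k)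
    have h1 := sh_mul_invTau (hτ.isUnit (k + 1))
    have e := hτ.isFay_y.mixed_lam_z (-k)
    have hp : powT (1 - k) = powT (-k) * varT := by rw [← powT_add_one]; congr 1; ring
    have hl : scal (lam ^ (k - 1)) = scal (lam ^ k) * scal lam⁻¹ := by
      rw [← scal_mul, zpow_sub_one₀ lam_ne_zero]
    simp only [show 1 - (-k + 1) = k by ring, show 1 - -k = k + 1 by ring,
      show 1 - (-k + 1 + 1) = k - 1 by ring] at e
    rw [map_neg, lift_gen₂, hτ.psi₂Star_lam, hτ.Psi₁_eq, hp, hl, show 1 - (k + 1) = -k by ring,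
      show k + 1 - 1 = k by ring]
    generalize lift (lift (psi₂ D.W₂ n)) = P at *
    linear_combination
      (P * scal lam⁻¹ * powT (-k) * scal (lam ^ k) * expLam Side.y * expZ Side.x) *
        ((invTau (τ k) * invTau (τ (k + 1))) * e +
          invTau (τ (k + 1)) * shLZ Side.y Side.x (τ k) * h0 -
          scal lam⁻¹ * varT * invTau (τ k) * shLZ Side.y Side.x (τ (k - 1)) * h1)
  · exact ((ordGe_C_single _ _).mul_of_zero <| (((((((ordGe_scal _).mul_of_zero
      (ordGe_lift _)).mul_of_zero (ordGe_scal _)).mul_of_zero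
      (ordGe_shiftRingHom _ _ _)).mul_of_zero (ordGe_lift _)).mul_of_zero
      (ordGe_lift _)).mul_of_zero (ordGe_expXi _ _))).neg

theorem IsTau.flow₂Psi₂_eq_sum (hτ : D.IsTau τ) (n : ℤ) : D.flow₂Psi₂ n =
    powT n * (scal lam⁻¹ * lift (lift (psi₂ D.W₂ n)) * invOneSubLam * scal (lam ^ n) *
      shLZ Side.y Side.y (τ n) * invTau (τ n) * expLam Side.y * expZ Side.y) := by
  refine psi₂_mulMat_upperPart (c := 0) (Z := fun k =>
    powT k * (scal lam⁻¹ * lift (lift (psi₂ D.W₂ n)) * invOneSubLam * scal (lam ^ k) *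
      shLZ Side.y Side.y (τ k) * invTau (τ k) * expLam Side.y * expZ Side.y))
    D.coeff_liftMat_liftMat_W₂ (fun k => ?_) fun k => ?_
  · change _ = _ * D.Psi₂ k
    have h0 := sh_mul_invTau (hτ.isUnit k)
    have h1 := sh_mul_invTau (hτ.isUnit (k + 1))
    have e := hτ.isFay_y.lam_z (-k)
    have h2 := mul_inv_lam_sub
    simp only [show 1 - (-k + 1) = k by ring, show 1 - -k = k + 1 by ring] at e
    rw [lift_gen₂, hτ.psi₂Star_lam, hτ.Psi₂_eq, powT_add_one, scal_zpow_add_one lam_ne_zero]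
    generalize lift (lift (psi₂ D.W₂ n)) = P at *
    have h3 : (varT - scal lam⁻¹) * shZ Side.y (τ (k + 1)) * shL Side.y (τ k) * invTau (τ k) *
          invTau (τ (k + 1)) = varT * invTau (τ (k + 1)) * shLZ Side.y Side.y (τ (k + 1)) -
        scal lam⁻¹ * invTau (τ k) * shLZ Side.y Side.y (τ k) := by
      linear_combination (invTau (τ k) * invTau (τ (k + 1))) * e +
        varT * invTau (τ (k + 1)) * shLZ Side.y Side.y (τ (k + 1)) * h0 -
        scal lam⁻¹ * invTau (τ k) * shLZ Side.y Side.y (τ k) * h1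
    linear_combination
      (P * powT k * scal (lam ^ k) * expLam Side.y * expZ Side.y) *
        (invOneSubLam * h3 + shZ Side.y (τ (k + 1)) * shL Side.y (τ k) * invTau (τ k) *
          invTau (τ (k + 1)) * h2 -
        invOneSubLam * varT * invTau (τ (k + 1)) * shLZ Side.y Side.y (τ (k + 1)) *
          scal_lam_mul_inv)
  · rw [zero_add]
    exact (ordGe_C_single _ _).mul_of_zero <| ((((((((ordGe_scal _).mul_of_zero
      (ordGe_lift _)).mul_of_zero (ordGe_C_oneSub_inv _)).mul_of_zero (ordGe_scal _)).mul_of_zero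
      (ordGe_shiftRingHom _ _ _)).mul_of_zero (ordGe_lift _)).mul_of_zero
      (ordGe_lift _)).mul_of_zero (ordGe_expXi _ _))

end Solution

end

/-! ### Comparison of the telescoped sums with the vertex operators -/

theorem mul_inv_eq_of_eq_mul {F P R : Fn Klmz} (hP : IsUnit P) (h : F = P * R) : F * P⁻¹ = R := by
  have hc : MvPowerSeries.constantCoeff P ≠ 0 :=
    (hP.map (MvPowerSeries.constantCoeff (R := Klmz))).ne_zero
  rw [h, mul_right_comm, MvPowerSeries.mul_inv_cancel _ hc, one_mul]

theorem scal_mu_div_lam : scal (mu / lam) = scal mu * scal lam⁻¹ := by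
  rw [← scal_mul, div_eq_mul_inv]

theorem lift_vertexRatioX (τ : ℤ → Fn ℂ) (n : ℤ) : lift (vertexRatioX τ n) =
    scal (mu ^ n) * scal (lam ^ (-n)) * (lift (vertexOp Side.x (τ n)) * invTau (τ n)) := by
  rw [vertexRatioX, MvPowerSeries.smul_eq_C_mul, map_mul, map_mul, lift_C_eq_scal, scal_div_zpow]
  rfl

theorem lift_vertexRatioY (τ : ℤ → Fn ℂ) (n : ℤ) : lift (vertexRatioY τ n) =
    scal (lam ^ n) * scal (mu ^ (-n)) * (lift (vertexOp Side.y (τ n)) * invTau (τ n)) := by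
  rw [vertexRatioY, MvPowerSeries.smul_eq_C_mul, map_mul, map_mul, lift_C_eq_scal, scal_div_zpow]
  rfl

theorem shiftFn_vertexRatioX (b : Side) (τ : ℤ → Fn ℂ) (n : ℤ) :
    shiftFn b (-1) (vertexRatioX τ n) = scal (mu ^ n) * scal (lam ^ (-n)) *
      (shiftRingHom b (-1) (vertexOp Side.x (τ n)) * invTauZ b (τ n)) := by
  rw [shiftFn_eq, vertexRatioX, MvPowerSeries.smul_eq_C_mul, map_mul, map_mul,
    shiftRingHom_C_eq_scal, scal_div_zpow]
  rfl

theorem shiftFn_vertexRatioY (b : Side) (τ : ℤ → Fn ℂ) (n : ℤ) :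
    shiftFn b (-1) (vertexRatioY τ n) = scal (lam ^ n) * scal (mu ^ (-n)) *
      (shiftRingHom b (-1) (vertexOp Side.y (τ n)) * invTauZ b (τ n)) := by
  rw [shiftFn_eq, vertexRatioY, MvPowerSeries.smul_eq_C_mul, map_mul, map_mul,
    shiftRingHom_C_eq_scal, scal_div_zpow]
  rfl

namespace Solution

variable {D : Solution} {τ : ℤ → Fn ℂ}

/-- Once the exponentials and powers common to both sides are removed, this is `IsFay.three_term` at
`n`, divided by `τ(n)`. -/
theorem IsTau.flow₁Psi₁_eq (hτ : D.IsTau τ) (n : ℤ) :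
    D.flow₁Psi₁ n = D.Psi₁ n * G₁SubOne (vertexRatioX τ) n := by
  have h0 := sh_mul_invTau (hτ.isUnit n)
  have hz := shZ_mul_invTauZ Side.x (hτ.isUnit n)
  have e := hτ.isFay_x.three_term hτ.isUnit n
  have hp : powT (1 - n) = powT (-n) * varT := by rw [← powT_add_one]; congr 1; ring
  have hu := scal_mu_mul_inv
  have hr := invOneSubMuLam_mul
  have h2 := mul_inv_lam_sub
  rw [hτ.flow₁Psi₁_eq_sum, hτ.psi₁_mu, hτ.Psi₁_eq, G₁SubOne, shiftFn_vertexRatioX,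
    lift_vertexRatioX, lift_vertexOp, shiftRingHom_vertexOp_self, hp]
  generalize scal mu = u, scal mu⁻¹ = M, scal lam⁻¹ = L, invOneSubLam = q, invOneSubMuLam = r,
    varT = T, shM Side.x (τ n) = sM, shLM Side.x (τ n) = sLM, shLZ Side.x Side.x (τ n) = sLZ,
    shLMZ Side.x Side.x (τ n) = sLMZ, shZ Side.x (τ n) = sZ, sh (τ n) = s0, invTau (τ n) = i0,
    invTauZ Side.x (τ n) = iz, scal (mu ^ n) = mn, scal (lam ^ (-n)) = ln, powT (-n) = p,
    expMu Side.x = Em, expLam Side.x = El, expZ Side.x = Ez at *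
  have a : (M - L) * T * sM * sLZ * i0 = L * (M - T) * sLMZ - M * (L - T) * sLM * sZ * i0 := by
    linear_combination i0 * e + L * (M - T) * sLMZ * h0
  -- Multiplication of `a` by `μ/((1 - μ/λ)(1 - λT))`: the factor `M - L` cancels against `u * r`,
  -- and `q * (L - T) = L`.
  have h3 : T * q * sM * sLZ * i0 = L * (1 - u * T) * r * q * sLMZ - L * r * sLM * sZ * i0 := by
    linear_combination u * r * q * a - T * q * sM * sLZ * i0 * (hr + r * hu) +
      L * r * q * sLMZ * hu - r * sLM * sZ * i0 * (h2 + q * (L - T) * hu)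
  linear_combination (mn * Em * i0 * p * ln * El * Ez) *
    (h3 - L * (1 - u * T) * r * q * sLMZ * hz)

theorem IsTau.flow₁Psi₂_eq (hτ : D.IsTau τ) (n : ℤ) :
    D.flow₁Psi₂ n = D.Psi₂ n * ΛG₂SubOne (vertexRatioX τ) n := by
  have h0 := sh_mul_invTau (hτ.isUnit n)
  have hz := shZ_mul_invTauZ Side.y (hτ.isUnit (n + 1))
  have e := hτ.isFay_x.three_term_mixed hτ.isUnit n
  have hl : scal (lam ^ (-(n + 1))) = scal (lam ^ (-n)) * scal lam⁻¹ := by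
    rw [← scal_mul, neg_add, zpow_add₀ lam_ne_zero, zpow_neg_one]
  have hu := scal_mu_mul_inv
  have hr := invOneSubMuLam_mul
  rw [hτ.flow₁Psi₂_eq_sum, hτ.psi₁_mu, hτ.Psi₂_eq, ΛG₂SubOne, shiftFn_vertexRatioX,
    lift_vertexRatioX, lift_vertexOp, shiftRingHom_vertexOp_of_ne (by decide), hl,
    scal_zpow_add_one mu_ne_zero]
  generalize scal mu = u, scal mu⁻¹ = M, scal lam⁻¹ = L, invOneSubMuLam = r,
    shM Side.x (τ n) = sM, shLM Side.x (τ n) = sLM, shLZ Side.x Side.y (τ (n + 1)) = sLZ,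
    shLMZ Side.x Side.y (τ (n + 1)) = sLMZ, shZ Side.y (τ (n + 1)) = sZ, sh (τ n) = s0,
    invTau (τ n) = i0, invTauZ Side.y (τ (n + 1)) = iz, scal (mu ^ n) = mn,
    scal (lam ^ (-n)) = ln, powT n = p, expMu Side.x = Em, expLam Side.x = El,
    expZ Side.y = Ez at *
  have a : -(M - L) * sM * sLZ * i0 = L * sLMZ - M * sLM * sZ * i0 := by
    linear_combination i0 * e + L * sLMZ * h0
  have h3 : -(sM * sLZ * i0) = u * L * r * sLMZ - r * sLM * sZ * i0 := by
    linear_combination u * r * a + sM * sLZ * i0 * (hr + r * hu) - r * sLM * sZ * i0 * hu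
  linear_combination (L * mn * Em * i0 * p * ln * El * Ez) * (h3 - u * L * r * sLMZ * hz)

/-- The numerator of `Ψ₂(n;μ⁻¹)` is a shift of `τ(n+1)`, whereas the vertex operator acts on `τ(n)`.
This offset calls for the `succ` form of the three-term identity, at the reflected index `-n`. -/
theorem IsTau.flow₂Psi₁_eq (hτ : D.IsTau τ) (n : ℤ) :
    D.flow₂Psi₁ n = D.Psi₁ n * (scal (mu / lam) * G₁SubOne (vertexRatioY τ) n) := by
  have h0 := sh_mul_invTau (hτ.isUnit n)
  have hz := shZ_mul_invTauZ Side.x (hτ.isUnit n)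
  have e := hτ.isFay_y.three_term_mixed_succ (fun i => hτ.isUnit _) (-n)
  simp only [show 1 - (-n + 1) = n by ring, show 1 - -n = n + 1 by ring,
    show 1 - (-n + 1 + 1) = n - 1 by ring] at e
  have hp : powT (1 - n) = powT (-n) * varT := by rw [← powT_add_one]; congr 1; ring
  have hl : scal (lam ^ (n - 1)) = scal (lam ^ n) * scal lam⁻¹ := by
    rw [← scal_mul, zpow_sub_one₀ lam_ne_zero]
  have hu := scal_mu_mul_inv
  have hr := invOneSubMuLam_mul
  rw [hτ.flow₂Psi₁_eq_sum, hτ.psi₂_mu, hτ.Psi₁_eq, G₁SubOne, shiftFn_vertexRatioY,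
    lift_vertexRatioY, lift_vertexOp, shiftRingHom_vertexOp_of_ne (by decide), hl, hp,
    scal_mu_div_lam]
  generalize scal mu = u, scal mu⁻¹ = M, scal lam⁻¹ = L, invOneSubMuLam = r, varT = T,
    shM Side.y (τ (n + 1)) = sM, shLM Side.y (τ n) = sLM, shLZ Side.y Side.x (τ (n - 1)) = sLZ,
    shLMZ Side.y Side.x (τ n) = sLMZ, shZ Side.x (τ n) = sZ, sh (τ n) = s0, invTau (τ n) = i0,
    invTauZ Side.x (τ n) = iz, scal (mu ^ (-n)) = mn, scal (lam ^ n) = ln, powT (-n) = p,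
    expMu Side.y = Em, expLam Side.y = El, expZ Side.x = Ez at *
  have a : -(M - L) * T * sM * sLZ * i0 = sLMZ - sLM * sZ * i0 := by
    linear_combination i0 * e + sLMZ * h0
  have h3 : -(T * sM * sLZ * i0) = u * r * sLMZ - u * r * sLM * sZ * i0 := by
    linear_combination u * r * a + T * sM * sLZ * i0 * (hr + r * hu)
  linear_combination (L * L * mn * Em * i0 * p * ln * El * Ez) * (h3 - u * r * sLMZ * hz)

theorem IsTau.flow₂Psi₂_eq (hτ : D.IsTau τ) (n : ℤ) :
    D.flow₂Psi₂ n = D.Psi₂ n * (scal (mu / lam) * ΛG₂SubOne (vertexRatioY τ) n) := by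
  have h0 := sh_mul_invTau (hτ.isUnit n)
  have hz := shZ_mul_invTauZ Side.y (hτ.isUnit (n + 1))
  have e := hτ.isFay_y.three_term_succ (fun i => hτ.isUnit _) (-n)
  simp only [show 1 - (-n + 1) = n by ring, show 1 - -n = n + 1 by ring] at e
  have hm : scal (mu ^ (-(n + 1))) = scal (mu ^ (-n)) * scal mu⁻¹ := by
    rw [← scal_mul, neg_add, zpow_add₀ mu_ne_zero, zpow_neg_one]
  have hu := scal_mu_mul_inv
  have hll := scal_lam_mul_inv
  have hr := invOneSubMuLam_mul
  have h2 := mul_inv_lam_sub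
  rw [hτ.flow₂Psi₂_eq_sum, hτ.psi₂_mu, hτ.Psi₂_eq, ΛG₂SubOne, shiftFn_vertexRatioY,
    lift_vertexRatioY, lift_vertexOp, shiftRingHom_vertexOp_self, hm,
    scal_zpow_add_one lam_ne_zero, scal_mu_div_lam]
  generalize scal mu = u, scal mu⁻¹ = M, scal lam = l, scal lam⁻¹ = L, invOneSubLam = q,
    invOneSubMuLam = r, varT = T, shM Side.y (τ (n + 1)) = sM, shLM Side.y (τ n) = sLM,
    shLZ Side.y Side.y (τ n) = sLZ, shLMZ Side.y Side.y (τ (n + 1)) = sLMZ,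
    shZ Side.y (τ (n + 1)) = sZ, sh (τ n) = s0, invTau (τ n) = i0,
    invTauZ Side.y (τ (n + 1)) = iz, scal (mu ^ (-n)) = mn, scal (lam ^ n) = ln, powT n = p,
    expMu Side.y = Em, expLam Side.y = El, expZ Side.y = Ez at *
  have a : (M - L) * sM * sLZ * i0 = (M - T) * sLMZ - (L - T) * sLM * sZ * i0 := by
    linear_combination i0 * e + (M - T) * sLMZ * h0
  have h3 : q * sM * sLZ * i0 = (1 - u * T) * r * q * sLMZ - u * L * r * sLM * sZ * i0 := by
    linear_combination u * r * q * a - q * sM * sLZ * i0 * (hr + r * hu) + r * q * sLMZ * hu -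
      u * r * sLM * sZ * i0 * h2
  -- The step from `n` to `n + 1` multiplies `(λ/μ)^n` by `λ/μ`, which the prefactor `μ/λ`
  -- compensates.
  have hul : u * L * l * M = 1 := by linear_combination L * l * hu + hll
  linear_combination (L * mn * Em * i0 * p * ln * El * Ez) *
    (h3 - u * L * l * M * (1 - u * T) * r * q * sLMZ * hz - (1 - u * T) * r * q * sLMZ * hul)

end Solution

end TodaLattice

end

theorem mainTheorem3 (D : Solution) (τ : ℤ → Fn ℂ) (hτ : D.IsTau τ) (n : ℤ) :
    (IsUnit (D.Psi₁ n) ∧ IsUnit (D.Psi₂ n)) ∧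
    (D.flow₁Psi₁ n * (D.Psi₁ n)⁻¹ = G₁SubOne (vertexRatioX τ) n ∧
      D.flow₁Psi₂ n * (D.Psi₂ n)⁻¹ = ΛG₂SubOne (vertexRatioX τ) n) ∧
    (D.flow₂Psi₁ n * (D.Psi₁ n)⁻¹ =
        (Laurent.const (mu / lam) : Klmz) • G₁SubOne (vertexRatioY τ) n ∧
      D.flow₂Psi₂ n * (D.Psi₂ n)⁻¹ =
        (Laurent.const (mu / lam) : Klmz) • ΛG₂SubOne (vertexRatioY τ) n) := by
  have h₁ := hτ.isUnit_Psi₁ n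
  have h₂ := hτ.isUnit_Psi₂ n
  rw [MvPowerSeries.smul_eq_C_mul, MvPowerSeries.smul_eq_C_mul]
  exact ⟨⟨h₁, h₂⟩, ⟨mul_inv_eq_of_eq_mul h₁ (hτ.flow₁Psi₁_eq n),
    mul_inv_eq_of_eq_mul h₂ (hτ.flow₁Psi₂_eq n)⟩, mul_inv_eq_of_eq_mul h₁ (hτ.flow₂Psi₁_eq n),
    mul_inv_eq_of_eq_mul h₂ (hτ.flow₂Psi₂_eq n)⟩
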